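/- There is a universal constant $c>0$ such that for every integer $r\ge 3$ the following two decision problems are solved by randomized algorithms with one-sided error within the running times stated below. A directed $r$-uniform hypergraph has as hyperedges sequences of $r$ distinct nodes; $n$ and $m$ denote its numbers of nodes and hyperedges. (1) Directed $r$-uniform $k$-HyperPath (given a directed $r$-uniform hypergraph $H$, as a list of its hyperedges, and $k\ge 0$, decide whether $H$ has a tight path on $k$ nodes, that is, a sequence of $k$ distinct nodes in which every $r$ consecutive nodes form, in this order, a hyperedge) is solved in time $O_r(2^k\, m\, n^{c})$. (2) Directed $r$-uniform $k$-HyperCycle (given such $H$ and $k$, decide whether $H$ has a tight cycle on $k$ nodes, that is, $k\ge 1$ distinct nodes in cyclic order such that every $r$ cyclically consecutive ones form, in this order, a hyperedge) is solved in time $O_r(2^k\, m^2\, n^{c})$. Here the time is the worst-case logarithmic cost on a random access machine with coin tosses, the constant in $O_r$ depends only on $r$, and the factors $m$ and $n$ are read as $1$ when they are $0$. The algorithms always answer "no" on no-instances, and answer "yes" with high probability, namely at least $1-2^{-n}$, on yes-instances. -/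

import Mathlib

/-! ### A probabilistic random access machine with logarithmic cost

The machine has registers and an unbounded random access memory, both holding natural numbers, and
a source of fair coins. Its instructions are the usual ones (constants, arithmetic, indirect load
and store, coin toss); programs are finite terms built from them by composition, zero tests and
loops. Every instruction and every test is charged the bit lengths of the numbers (operands and
memory addresses) that it handles. -/

namespace LogRAM

/-- A configuration: the registers, the memory, and the coins that have not been tossed yet. -/
structure State where
  reg : ℕ → ℕ
  mem : ℕ → ℕ
  coins : ℕ → Bool

/-- The logarithmic cost of handling the number `x`. -/
def bitCost (x : ℕ) : ℕ := Nat.size x + 1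

/-- Basic instructions. The arguments that name registers are fixed by the program. -/
inductive Instr where
  /-- `R[i] := a` -/
  | const (i a : ℕ)
  /-- `R[i] := R[j] + R[l]` -/
  | add (i j l : ℕ)
  /-- `R[i] := R[j] - R[l]`, truncated at zero -/
  | sub (i j l : ℕ)
  /-- `R[i] := R[j] * R[l]` -/
  | mul (i j l : ℕ)
  /-- `R[i] := ⌊R[j] / R[l]⌋` (zero if `R[l] = 0`) -/
  | div (i j l : ℕ)
  /-- `R[i] := M[R[j]]` -/
  | load (i j : ℕ)
  /-- `M[R[i]] := R[j]` -/
  | store (i j : ℕ)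
  /-- `R[i] :=` the next coin -/
  | flip (i : ℕ)

/-- `R[i] := a` -/
def State.setReg (s : State) (i a : ℕ) : State := { s with reg := Function.update s.reg i a }

/-- The effect of an instruction. -/
def Instr.apply : Instr → State → State
  | .const i a, s => s.setReg i a
  | .add i j l, s => s.setReg i (s.reg j + s.reg l)
  | .sub i j l, s => s.setReg i (s.reg j - s.reg l)
  | .mul i j l, s => s.setReg i (s.reg j * s.reg l)
  | .div i j l, s => s.setReg i (s.reg j / s.reg l)
  | .load i j, s => s.setReg i (s.mem (s.reg j))
  | .store i j, s => { s with mem := Function.update s.mem (s.reg i) (s.reg j) }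
  | .flip i, s =>
      { s with
        reg := Function.update s.reg i (s.coins 0).toNat
        coins := fun t => s.coins (t + 1) }

/-- The logarithmic cost of an instruction. -/
def Instr.cost : Instr → State → ℕ
  | .const _ a, _ => bitCost a
  | .add _ j l, s => bitCost (s.reg j) + bitCost (s.reg l)
  | .sub _ j l, s => bitCost (s.reg j) + bitCost (s.reg l)
  | .mul _ j l, s => bitCost (s.reg j) + bitCost (s.reg l)
  | .div _ j l, s => bitCost (s.reg j) + bitCost (s.reg l)
  | .load _ j, s => bitCost (s.reg j) + bitCost (s.mem (s.reg j))
  | .store i j, s => bitCost (s.reg i) + bitCost (s.reg j)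
  | .flip _, _ => 1

/-- Programs. -/
inductive Prog where
  | skip
  | instr (a : Instr)
  | seq (p q : Prog)
  /-- if `R[i] ≠ 0` then `p` else `q` -/
  | ite (i : ℕ) (p q : Prog)
  /-- while `R[i] ≠ 0` do `p` -/
  | loop (i : ℕ) (p : Prog)

/-- `Exec p s s' t`: started in `s`, the program `p` halts in `s'`, at total cost `t`. -/
inductive Exec : Prog → State → State → ℕ → Prop where
  | skip (s : State) : Exec .skip s s 1
  | instr (a : Instr) (s : State) : Exec (.instr a) s (a.apply s) (a.cost s)
  | seq {p q : Prog} {s s' s'' : State} {t t' : ℕ} :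
      Exec p s s' t → Exec q s' s'' t' → Exec (.seq p q) s s'' (t + t')
  | ite_true {i : ℕ} {p q : Prog} {s s' : State} {t : ℕ} :
      s.reg i ≠ 0 → Exec p s s' t → Exec (.ite i p q) s s' (bitCost (s.reg i) + t)
  | ite_false {i : ℕ} {p q : Prog} {s s' : State} {t : ℕ} :
      s.reg i = 0 → Exec q s s' t → Exec (.ite i p q) s s' (bitCost (s.reg i) + t)
  | loop_true {i : ℕ} {p : Prog} {s s' s'' : State} {t t' : ℕ} :
      s.reg i ≠ 0 → Exec p s s' t → Exec (.loop i p) s' s'' t' →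
        Exec (.loop i p) s s'' (bitCost (s.reg i) + t + t')
  | loop_false {i : ℕ} {p : Prog} {s : State} :
      s.reg i = 0 → Exec (.loop i p) s s (bitCost (s.reg i))

/-- The program halts from `s` at cost at most `T`. -/
def HaltsWithin (p : Prog) (s : State) (T : ℕ) : Prop := ∃ s' t, Exec p s s' t ∧ t ≤ T

/-- The program halts from `s` with the answer "yes", that is, with `R[0] ≠ 0`. -/
def Accepts (p : Prog) (s : State) : Prop := ∃ s' t, Exec p s s' t ∧ s'.reg 0 ≠ 0

/-- Infinitely many independent fair coins. -/
noncomputable def coinMeasure : MeasureTheory.Measure (ℕ → Bool) :=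
  MeasureTheory.Measure.infinitePi fun _ : ℕ => (PMF.uniformOfFintype Bool).toMeasure

end LogRAM

/-! ### Directed hypergraphs, tight paths and tight cycles -/

/-- A directed `r`-uniform hypergraph: every hyperedge is a sequence of `r` distinct nodes. -/
structure DirHypergraph (V : Type) (r : ℕ) where
  edges : Finset (Fin r ↪ V)

namespace DirHypergraph

variable {V : Type} {r : ℕ}

/-- There is a tight path on `k` nodes: `k` distinct nodes such that every `r` consecutive ones, in
their order, form a hyperedge. -/
def HasTightPath (H : DirHypergraph V r) (k : ℕ) : Prop :=
  ∃ v : Fin k ↪ V, ∀ (i : ℕ) (hi : i + r ≤ k),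
    ∃ e ∈ H.edges, ∀ j : Fin r, e j = v ⟨i + j, by omega⟩

/-- There is a tight cycle on `k` nodes: the same, with consecutiveness understood cyclically. -/
def HasTightCycle (H : DirHypergraph V r) (k : ℕ) : Prop :=
  0 < k ∧ ∃ v : Fin k ↪ V, ∀ i : Fin k,
    ∃ e ∈ H.edges, ∀ j : Fin r, e j = v ⟨(i + j) % k, Nat.mod_lt _ i.pos⟩

/-- `l` lists the hyperedges of `H`, each of them once, in some order. -/
def IsListing (H : DirHypergraph V r) (l : List (Fin r ↪ V)) : Prop :=
  l.Nodup ∧ ∀ e, e ∈ l ↔ e ∈ H.edges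

end DirHypergraph

namespace LogRAM

/-- The initial state on the input `(H, k)`, where `H` has the nodes `0, …, n - 1` and is given by
the list `l` of its hyperedges: the numbers of nodes and of hyperedges and `k` are in the first
three registers, the hyperedges are written one after another in memory, and all the rest is zero.
-/
def inputState {r n : ℕ} (l : List (Fin r ↪ Fin n)) (k : ℕ) (ω : ℕ → Bool) : State where
  reg i := if i = 0 then n else if i = 1 then l.length else if i = 2 then k else 0
  mem a := (l.flatMap fun e => List.ofFn fun j => (e j : ℕ)).getD a 0
  coins := ω

/-- The program `p` solves the problem "given a directed `r`-uniform hypergraph `H` and `k`, does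
`Q n H k` hold?" as a randomized algorithm with one-sided error: on every input with `n` nodes and
`m` hyperedges it halts within cost `T n m k` whatever the coins are; on a yes-instance it answers
"yes" with probability at least `1 - 2⁻ⁿ`; on a no-instance it always answers "no". -/
def Solves {r : ℕ} (p : Prog) (Q : (n : ℕ) → DirHypergraph (Fin n) r → ℕ → Prop)
    (T : ℕ → ℕ → ℕ → ℕ) : Prop :=
  ∀ (n : ℕ) (H : DirHypergraph (Fin n) r) (l : List (Fin r ↪ Fin n)) (k : ℕ), H.IsListing l →
    (∀ ω, HaltsWithin p (inputState l k ω) (T n H.edges.card k)) ∧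
    (Q n H k → 1 - (1 / 2 : ℝ) ^ n ≤ coinMeasure.real {ω | Accepts p (inputState l k ω)}) ∧
    (¬ Q n H k → ∀ ω, ¬ Accepts p (inputState l k ω))

end LogRAM

/-! Write `r = d + 1`. A tight path becomes a walk whose states record the last `d` nodes. Each
hyperedge contributes `d + 1` transitions along its prefixes; a node `u` is written as the digit `u
+ 1` in base `n + 1`, and only the last `d` digits are kept. The digit zero marks a missing node, so
a state without zero digits can be left only by the last step of a hyperedge that begins with the
`d` recorded nodes. Hence, for `k ≥ r`, tight paths on `k` nodes correspond to walks of `k` steps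
from the empty code with distinct labels, and tight cycles to closed walks of `k` steps with
distinct labels (`windows_of_isWalk`, `exists_isWalk_of_windows` and their closed versions).

Distinctness is enforced by the exterior algebra on `k` generators. Each label gets a vector, and a
walk contributes the exterior product of the vectors of its labels, which vanishes if a label
repeats. A nonzero sum over walks therefore proves that a walk with distinct labels exists
(`exists_isWalk_of_walkSum_ne_zero`), so "yes" is never wrong. The products also carry weights that
depend on step and label, since otherwise walks through the same labels in different orders could
cancel. If a walk with distinct labels exists, the top coefficient is a nonzero polynomial of degree
at most `2 * k` in the weights and coordinates: when these are indicators that follow the walk,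
every walk that survives counts `+1` (`walkSum_indicator`). With random values of `2 * n` bits, the
Schwartz-Zippel lemma bounds the probability of a wrong "no" by `2⁻ⁿ`
(`coinMeasure_eval_eq_zero_le`).

The coefficient at `S` matters only for walks of `|S|` steps, and it is computed from coefficients
at the sets `S` minus one element. A table indexed by `S` and the final state, filled in the order
of the binary codes of the sets, costs about `k` operations per set and transition, that is `2 ^ k *
m` up to factors depending on `r` and polynomial in `n`. The table has `2 ^ k * (n + 1) ^ d` entries
but needs no initialisation, because it lies in memory that is still zero. For cycles the
computation is repeated, in fresh memory, from the source of every transition, whence the second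
factor `m`. All numbers have a number of bits of order `r * n ^ 2`, so logarithmic costs add only
another such factor. The cases `k < r` and `k > n` are answered directly. -/

namespace LogRAM

/-! ### Runs of programs and bounds for their cost -/

theorem Exec.deterministic {p : Prog} {s s₁ s₂ : State} {t₁ t₂ : ℕ} (h₁ : Exec p s s₁ t₁)
    (h₂ : Exec p s s₂ t₂) : s₁ = s₂ := by
  induction h₁ generalizing s₂ t₂ with
  | skip s => cases h₂; rfl
  | instr a s => cases h₂; rfl
  | seq _ _ ih₁ ih₂ =>
    cases h₂ with
    | seq g₁ g₂ => cases ih₁ g₁; exact ih₂ g₂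
  | ite_true h _ ih =>
    cases h₂ with
    | ite_true _ g => exact ih g
    | ite_false h' _ => exact absurd h' h
  | ite_false h _ ih =>
    cases h₂ with
    | ite_true h' _ => exact absurd h h'
    | ite_false _ g => exact ih g
  | loop_true h _ _ ih₁ ih₂ =>
    cases h₂ with
    | loop_true _ g₁ g₂ => cases ih₁ g₁; exact ih₂ g₂
    | loop_false h' => exact absurd h' h
  | loop_false h =>
    cases h₂ with
    | loop_true h' _ _ => exact absurd h h'
    | loop_false _ => rfl

/-- All numbers in the registers and in the memory have at most `B` bits. -/
def Small (B : ℕ) (s : State) : Prop := (∀ i, s.reg i < 2 ^ B) ∧ ∀ a, s.mem a < 2 ^ B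

/-- Started in `s` with numbers of at most `B` bits, the program `p` halts at the cost of at most
`N` operations on such numbers, all numbers keep at most `B` bits, and `Q` holds at the end. -/
def Within (B : ℕ) (p : Prog) (N : ℕ) (Q : State → Prop) (s : State) : Prop :=
  Small B s → ∃ s' t, Exec p s s' t ∧ t ≤ N * (2 * B + 3) ∧ Small B s' ∧ Q s'

/-- Straight-line programs. -/
def block : List Instr → Prog
  | [] => .skip
  | a :: l => .seq (.instr a) (block l)

/-- The effect of a straight-line program. -/
@[simp] def runBlock : List Instr → State → State
  | [], s => s
  | a :: l, s => runBlock l (a.apply s)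

/-- The number computed by an instruction has at most `B` bits. Only the instructions that can
create numbers larger than those present in the configuration matter. -/
@[simp] def Instr.Fits (B : ℕ) : Instr → State → Prop
  | .const _ a, _ => a < 2 ^ B
  | .add _ j l, s => s.reg j + s.reg l < 2 ^ B
  | .mul _ j l, s => s.reg j * s.reg l < 2 ^ B
  | .flip _, _ => 1 < 2 ^ B
  | _, _ => True

/-- All the numbers computed by a straight-line program have at most `B` bits. -/
@[simp] def BlockFits (B : ℕ) : List Instr → State → Prop
  | [], _ => True
  | a :: l, s => a.Fits B s ∧ BlockFits B l (a.apply s)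

theorem bitCost_le {B x : ℕ} (h : x < 2 ^ B) : bitCost x ≤ B + 1 :=
  Nat.succ_le_succ (Nat.size_le.2 h)

theorem Small.setReg {B : ℕ} {s : State} (h : Small B s) {i a : ℕ} (ha : a < 2 ^ B) :
    Small B (s.setReg i a) := by
  refine ⟨fun j => ?_, h.2⟩
  by_cases hj : j = i
  · subst hj; simpa [State.setReg] using ha
  · simpa [State.setReg, hj] using h.1 j

theorem Small.apply {B : ℕ} {s : State} (h : Small B s) {a : Instr} (ha : a.Fits B s) :
    Small B (a.apply s) := by
  cases a with
  | const i a => exact h.setReg ha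
  | add i j l => exact h.setReg ha
  | sub i j l => exact h.setReg ((Nat.sub_le _ _).trans_lt (h.1 j))
  | mul i j l => exact h.setReg ha
  | div i j l => exact h.setReg ((Nat.div_le_self _ _).trans_lt (h.1 j))
  | load i j => exact h.setReg (h.2 _)
  | store i j =>
    refine ⟨h.1, fun b => ?_⟩
    by_cases hb : b = s.reg i
    · subst hb; simpa [Instr.apply] using h.1 j
    · simpa [Instr.apply, hb] using h.2 b
  | flip i =>
    refine (show Small B (s.setReg i (s.coins 0).toNat) from h.setReg ?_)
    exact lt_of_le_of_lt (Bool.toNat_le _) ha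

theorem Small.cost_le {B : ℕ} {s : State} (h : Small B s) {a : Instr} (ha : a.Fits B s) :
    a.cost s ≤ 2 * B + 3 := by
  have h₁ := fun i => bitCost_le (h.1 i)
  have h₂ := fun i => bitCost_le (h.2 i)
  cases a with
  | const i a => have := bitCost_le (B := B) (x := a) ha; simp only [Instr.cost]; omega
  | add i j l => have := h₁ j; have := h₁ l; simp only [Instr.cost]; omega
  | sub i j l => have := h₁ j; have := h₁ l; simp only [Instr.cost]; omega
  | mul i j l => have := h₁ j; have := h₁ l; simp only [Instr.cost]; omega
  | div i j l => have := h₁ j; have := h₁ l; simp only [Instr.cost]; omega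
  | load i j => have := h₁ j; have := h₂ (s.reg j); simp only [Instr.cost]; omega
  | store i j => have := h₁ i; have := h₁ j; simp only [Instr.cost]; omega
  | flip i => simp only [Instr.cost]; omega

namespace Within

variable {B N M : ℕ} {p q : Prog} {Q R : State → Prop} {s : State}

theorem mono (h : Within B p N Q s) (hN : N ≤ M) (hQ : ∀ s', Q s' → R s') :
    Within B p M R s := by
  intro hs
  obtain ⟨s', t, h₁, h₂, h₃, h₄⟩ := h hs
  exact ⟨s', t, h₁, h₂.trans (Nat.mul_le_mul_right _ hN), h₃, hQ _ h₄⟩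

theorem seq (h : Within B p N (Within B q M Q) s) : Within B (.seq p q) (N + M) Q s := by
  intro hs
  obtain ⟨s', t, h₁, h₂, h₃, h₄⟩ := h hs
  obtain ⟨s'', t', g₁, g₂, g₃, g₄⟩ := h₄ h₃
  exact ⟨s'', t + t', .seq h₁ g₁, by rw [add_mul]; omega, g₃, g₄⟩

theorem seq' (h : Within B p N R s) (h' : ∀ s', R s' → Within B q M Q s') :
    Within B (.seq p q) (N + M) Q s :=
  seq (h.mono le_rfl h')

theorem ite {i : ℕ} (h₁ : s.reg i ≠ 0 → Within B p N Q s) (h₂ : s.reg i = 0 → Within B q N Q s) :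
    Within B (.ite i p q) (N + 1) Q s := by
  intro hs
  have hb := bitCost_le (hs.1 i)
  by_cases h : s.reg i = 0
  · obtain ⟨s', t, h₁, h₂, h₃, h₄⟩ := h₂ h hs
    exact ⟨s', _, .ite_false h h₁, by rw [add_mul]; omega, h₃, h₄⟩
  · obtain ⟨s', t, h₁, h₂, h₃, h₄⟩ := h₁ h hs
    exact ⟨s', _, .ite_true h h₁, by rw [add_mul]; omega, h₃, h₄⟩

theorem block {l : List Instr} (h : BlockFits B l s) (hQ : Q (runBlock l s)) :
    Within B (block l) (l.length + 1) Q s := by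
  induction l generalizing s with
  | nil => exact fun hs => ⟨s, 1, .skip s, by simp, hs, hQ⟩
  | cons a l ih =>
    intro hs
    obtain ⟨s', t, h₁, h₂, h₃, h₄⟩ := ih h.2 hQ (hs.apply h.1)
    have := hs.cost_le h.1
    refine ⟨s', _, .seq (.instr a s) h₁, ?_, h₃, h₄⟩
    rw [List.length_cons, add_right_comm, add_mul (_ + _)]
    omega

/-- A loop with a counter that runs down to zero. -/
theorem loop {c n : ℕ} (I : ℕ → State → Prop) (h₀ : I 0 s)
    (hc : ∀ i s, i ≤ n → I i s → s.reg c = n - i)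
    (hI : ∀ i s, i < n → I i s → Within B p N (I (i + 1)) s) :
    Within B (.loop c p) (n * (N + 1) + 1) (I n) s := by
  suffices H : ∀ d i s, i + d = n → I i s → Within B (.loop c p) (d * (N + 1) + 1) (I n) s from
    H n 0 s (by omega) h₀
  intro d
  induction d with
  | zero =>
    intro i s hi h hs
    have hr := hc i s (by omega) h
    have : i = n := by omega
    subst this
    have hb := bitCost_le (hs.1 c)
    exact ⟨s, _, .loop_false (by omega), by omega, hs, h⟩
  | succ d ih =>
    intro i s hi h hs
    have hr := hc i s (by omega) h
    have hb := bitCost_le (hs.1 c)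
    obtain ⟨s', t, h₁, h₂, h₃, h₄⟩ := hI i s (by omega) h hs
    obtain ⟨s'', t', g₁, g₂, g₃, g₄⟩ := ih (i + 1) s' (by omega) h₄ h₃
    refine ⟨s'', _, .loop_true (by omega) h₁ g₁, ?_, g₃, g₄⟩
    have : ((d + 1) * (N + 1) + 1) * (2 * B + 3)
      = N * (2 * B + 3) + (2 * B + 3) + (d * (N + 1) + 1) * (2 * B + 3) := by ring
    omega

end Within

attribute [simp] Instr.apply State.setReg

/-- The memory that holds the list `M` from address `0` on and zeros after it. -/
def listMem (M : List ℕ) (a : ℕ) : ℕ := M.getD a 0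

/-- A write to the first free address appends to the list. All writes of the preparation are of this
kind, so its invariants can describe the memory by lists. -/
theorem update_listMem (M : List ℕ) (x : ℕ) :
    Function.update (listMem M) M.length x = listMem (M ++ [x]) := by
  funext a
  rcases lt_trichotomy a M.length with h | h | h
  · simp [listMem, Function.update_of_ne h.ne, List.getElem?_append_left h]
  · subst h; simp [listMem]
  · rw [Function.update_of_ne h.ne']
    simp [listMem, List.getElem?_eq_none, h.le, Nat.succ_le_of_lt h]

end LogRAM

/-! ### Exterior products along walks -/

section ExteriorWalk

variable {R : Type*} [CommRing R]

/-- The product in the exterior algebra of `f`, written in coordinates indexed by finite sets, with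
the vector `z`. -/
def extMul (z : ℕ → R) (f : Finset ℕ → R) (S : Finset ℕ) : R :=
  ∑ j ∈ S, (-1) ^ (S.filter (j < ·)).card * z j * f (S.erase j)

theorem card_filter_lt_erase_of_lt {S : Finset ℕ} {j l : ℕ} (hl : l ∈ S) (h : j < l) :
    (S.filter (j < ·)).card = ((S.erase l).filter (j < ·)).card + 1 := by
  rw [Finset.filter_erase, Finset.card_erase_of_mem (by simp [hl, h])]
  have : 0 < (S.filter (j < ·)).card := Finset.card_pos.2 ⟨l, by simp [hl, h]⟩
  omega

theorem card_filter_lt_erase_of_ge {S : Finset ℕ} {j l : ℕ} (h : l ≤ j) :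
    (S.filter (j < ·)).card = ((S.erase l).filter (j < ·)).card := by
  rw [Finset.filter_erase, Finset.erase_eq_of_notMem (by simp [h])]

/-- If `j < l`, removing `l` first lowers the number of elements above `j` by one, while removing
`j` first does not affect the number of elements above `l`. The two orders of removal thus differ by
one sign. -/
theorem neg_one_pow_erase_antisymm {S : Finset ℕ} {j l : ℕ} (hj : j ∈ S) (hl : l ∈ S)
    (h : j ≠ l) :
    (-1 : R) ^ (S.filter (j < ·)).card * (-1) ^ ((S.erase j).filter (l < ·)).card =
      -((-1) ^ (S.filter (l < ·)).card * (-1) ^ ((S.erase l).filter (j < ·)).card) := by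
  wlog hjl : j < l generalizing j l
  · rw [this hl hj h.symm (by omega), neg_neg]
  rw [card_filter_lt_erase_of_lt hl hjl, card_filter_lt_erase_of_ge (S := S) hjl.le, pow_succ]
  ring

theorem extMul_extMul (z w : ℕ → R) (f : Finset ℕ → R) (S : Finset ℕ) :
    extMul z (extMul w f) S = ∑ p ∈ S.offDiag,
      ((-1) ^ (S.filter (p.1 < ·)).card * (-1) ^ ((S.erase p.1).filter (p.2 < ·)).card) *
        (z p.1 * w p.2) * f ((S.erase p.1).erase p.2) := by
  simp only [extMul, Finset.mul_sum]
  rw [Finset.sum_sigma']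
  refine Finset.sum_bij' (fun x _ => (x.1, x.2)) (fun p _ => ⟨p.1, p.2⟩) ?_ ?_ ?_ ?_ ?_
  · rintro ⟨a, b⟩ h
    simp only [Finset.mem_sigma, Finset.mem_erase] at h
    simp [h.1, h.2.2, Ne.symm h.2.1]
  · rintro ⟨a, b⟩ h
    simp only [Finset.mem_offDiag] at h
    simp [h.1, h.2.1, Ne.symm h.2.2]
  · simp
  · simp
  · rintro ⟨a, b⟩ _
    dsimp only
    ring

/-- The terms of the two sides correspond under the exchange of the two removed indices, which
changes the sign. -/
theorem extMul_anticomm (z w : ℕ → R) (f : Finset ℕ → R) (S : Finset ℕ) :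
    extMul z (extMul w f) S = -extMul w (extMul z f) S := by
  rw [extMul_extMul, extMul_extMul, ← Finset.sum_neg_distrib]
  refine Finset.sum_bij' (fun p _ => p.swap) (fun p _ => p.swap) ?_ ?_ ?_ ?_ ?_
  · rintro ⟨a, b⟩ h; simp_all [Finset.mem_offDiag, eq_comm]
  · rintro ⟨a, b⟩ h; simp_all [Finset.mem_offDiag, eq_comm]
  · simp
  · simp
  · rintro ⟨a, b⟩ h
    rw [Finset.mem_offDiag] at h
    simp only [Prod.fst_swap, Prod.snd_swap]
    rw [neg_one_pow_erase_antisymm h.1 h.2.1 h.2.2, Finset.erase_right_comm]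
    ring

/-- Anticommutativity only gives that the double vanishes; torsion-freeness does the rest. -/
theorem extMul_self [IsAddTorsionFree R] (z : ℕ → R) (f : Finset ℕ → R) (S : Finset ℕ) :
    extMul z (extMul z f) S = 0 :=
  self_eq_neg.1 (extMul_anticomm z z f S)

theorem extMul_zero (z : ℕ → R) : extMul z (fun _ => 0) = fun _ => 0 := by
  funext S; simp [extMul]

theorem extMul_add (z : ℕ → R) (f g : Finset ℕ → R) :
    extMul z (f + g) = extMul z f + extMul z g := by
  funext S; simp [extMul, mul_add, Finset.sum_add_distrib]

theorem extMul_smul (z : ℕ → R) (c : R) (f : Finset ℕ → R) :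
    extMul z (c • f) = c • extMul z f := by
  funext S
  simp only [extMul, Pi.smul_apply, smul_eq_mul, Finset.mul_sum]
  exact Finset.sum_congr rfl fun j _ => by ring

/-- The unit of the exterior algebra. -/
def extOne (S : Finset ℕ) : R := if S = ∅ then 1 else 0

/-- The exterior product of the vectors of the first `i` terms of the sequence `v`. -/
def extProd (z : ℕ → ℕ → R) (v : ℕ → ℕ) : ℕ → Finset ℕ → R
  | 0 => extOne
  | i + 1 => extMul (fun j => z j (v i)) (extProd z v i)

theorem extProd_congr (z : ℕ → ℕ → R) {v w : ℕ → ℕ} {i : ℕ} (h : ∀ l < i, v l = w l) :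
    extProd z v i = extProd z w i := by
  induction i with
  | zero => rfl
  | succ i ih =>
    rw [extProd, extProd, ih fun l hl => h l (by omega), h i (by omega)]

/-- The new factor is moved inwards by anticommutativity until it meets a factor equal to it. -/
theorem extMul_extProd_eq_zero [IsAddTorsionFree R] (z : ℕ → ℕ → R) (v : ℕ → ℕ) {a i : ℕ}
    (h : a < i) : extMul (fun j => z j (v a)) (extProd z v i) = 0 := by
  induction i with
  | zero => omega
  | succ i ih =>
    funext S
    rw [extProd]
    by_cases hv : v i = v a
    · rw [hv, extMul_self]; rfl
    · have hai : a ≠ i := fun h => hv (h ▸ rfl)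
      rw [extMul_anticomm, ih (by omega)]
      simp [extMul]

theorem injOn_of_extProd_ne_zero [IsAddTorsionFree R] (z : ℕ → ℕ → R) (v : ℕ → ℕ) {i : ℕ}
    (h : extProd z v i ≠ 0) : ∀ a b, a < b → b < i → v a ≠ v b := by
  induction i with
  | zero => intro a b _ hb; omega
  | succ i ih =>
    intro a b hab hb hv
    have h0 : extProd z v i ≠ 0 := by
      intro h0; apply h; rw [extProd, h0]; exact extMul_zero _
    rcases Nat.lt_succ_iff_lt_or_eq.1 hb with hb | rfl
    · exact ih h0 a b hab hb hv
    · exact h (by rw [extProd, ← hv]; exact extMul_extProd_eq_zero z v hab)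

/-- A walk of `i` steps from `a` to `t` with the transitions in `T`, given as triples of source,
label and target: the states are `st`, the labels `v`. -/
structure IsWalk (T : List (ℕ × ℕ × ℕ)) (a t i : ℕ) (st v : ℕ → ℕ) : Prop where
  start : st 0 = a
  finish : st i = t
  step : ∀ l < i, (st l, v l, st (l + 1)) ∈ T

/-- The sum, over the walks of `i` steps from `a` to `t`, of the exterior products of their labels,
the label `v` in position `l` being weighted with `y l v`. -/
def walkSum (T : List (ℕ × ℕ × ℕ)) (y z : ℕ → ℕ → R) (a : ℕ) : ℕ → ℕ → Finset ℕ → R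
  | 0, t, S => if t = a then extOne S else 0
  | i + 1, t, S => (T.map fun τ => if τ.2.2 = t then
      y (i + 1) τ.2.1 * extMul (fun j => z j τ.2.1) (walkSum T y z a i τ.1) S else 0).sum

theorem walkSum_succ_eq (T : List (ℕ × ℕ × ℕ)) (y z : ℕ → ℕ → R) (a i t : ℕ) :
    walkSum T y z a (i + 1) t = (T.map fun τ => if τ.2.2 = t then
      y (i + 1) τ.2.1 • extMul (fun j => z j τ.2.1) (walkSum T y z a i τ.1) else 0).sum := by
  funext S
  rw [walkSum]
  generalize walkSum T y z a i = f
  induction T with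
  | nil => rfl
  | cons τ T ih => 
    rw [List.map_cons, List.sum_cons, List.map_cons, List.sum_cons, Pi.add_apply, ih]
    split_ifs <;> simp

/-- Expanding the recursion by linearity leaves a combination of exterior products along walks. Only
membership in the span is recorded: for the vanishing argument the coefficients, which are products
of the weights, are irrelevant. -/
theorem walkSum_mem_span (T : List (ℕ × ℕ × ℕ)) (y z : ℕ → ℕ → R) (a i t : ℕ) :
    walkSum T y z a i t ∈
      Submodule.span R {f | ∃ st v, IsWalk T a t i st v ∧ f = extProd z v i} := by
  induction i generalizing t with
  | zero =>
    by_cases h : t = a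
    · refine Submodule.subset_span ⟨fun _ => a, fun _ => 0, ⟨rfl, h.symm, by simp⟩, ?_⟩
      funext S; simp [walkSum, h, extProd]
    · have : walkSum T y z a 0 t = 0 := by funext S; simp [walkSum, h]
      rw [this]; exact Submodule.zero_mem _
  | succ i ih =>
    rw [walkSum_succ_eq]
    refine list_sum_mem ?_
    intro g hg
    obtain ⟨τ, hτ, rfl⟩ := List.mem_map.1 hg
    split_ifs with h
    swap
    · exact Submodule.zero_mem _
    refine Submodule.smul_mem _ _ ?_
    -- Multiplication by a vector is linear, so it suffices to treat the product along one walk,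
    -- which is then prolonged by the transition `τ`.
    refine Submodule.span_induction (p := fun f _ => extMul (fun j => z j τ.2.1) f ∈ _)
      ?_ ?_ ?_ ?_ (ih τ.1)
    · rintro f ⟨st, v, hw, rfl⟩
      refine Submodule.subset_span ⟨Function.update st (i + 1) t, Function.update v i τ.2.1,
        ⟨?_, ?_, ?_⟩, ?_⟩
      · simpa using hw.start
      · simp
      · intro l hl
        rcases Nat.lt_succ_iff_lt_or_eq.1 hl with hl | rfl
        · rw [Function.update_of_ne (by omega), Function.update_of_ne (by omega),
            Function.update_of_ne (by omega)]
          exact hw.step l hl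
        · rw [Function.update_of_ne (by omega), Function.update_self, Function.update_self,
            hw.finish, ← h]
          exact hτ
      · rw [extProd, Function.update_self]
        congr 1
        exact extProd_congr z fun l hl => by rw [Function.update_of_ne (by omega)]
    · convert Submodule.zero_mem _ using 1; exact extMul_zero _
    · intro f g _ _ hf hg
      rw [extMul_add]; exact Submodule.add_mem _ hf hg
    · intro c f _ hf
      rw [extMul_smul]; exact Submodule.smul_mem _ _ hf

/-- A nonzero sum over walks comes from a walk with distinct labels. -/
theorem exists_isWalk_of_walkSum_ne_zero [IsAddTorsionFree R] {T : List (ℕ × ℕ × ℕ)}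
    {y z : ℕ → ℕ → R} {a i t : ℕ} (h : walkSum T y z a i t ≠ 0) :
    ∃ st v, IsWalk T a t i st v ∧ ∀ l m, l < m → m < i → v l ≠ v m := by
  by_contra! H
  apply h
  have := walkSum_mem_span T y z a i t
  -- If every walk repeats a label, all the generators of the span vanish.
  refine (Submodule.mem_bot R).1 (Submodule.span_le.2 ?_ this)
  rintro f ⟨st, v, hw, rfl⟩
  by_contra h0
  obtain ⟨l, m, hlm, hm, hv⟩ := H st v hw
  exact injOn_of_extProd_ne_zero z v h0 l m hlm hm hv

theorem map_extMul {R' : Type*} [CommRing R'] (φ : R →+* R') (z : ℕ → R) (f : Finset ℕ → R)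
    (S : Finset ℕ) : φ (extMul z f S) = extMul (fun j => φ (z j)) (fun S => φ (f S)) S := by
  simp [extMul]

/-- This is applied to the evaluation of polynomials: the walk sum of the variables specialises to
the walk sum of the random numbers. -/
theorem map_walkSum {R' : Type*} [CommRing R'] (φ : R →+* R') (T : List (ℕ × ℕ × ℕ))
    (y z : ℕ → ℕ → R) (a i t : ℕ) (S : Finset ℕ) :
    φ (walkSum T y z a i t S) =
      walkSum T (fun i v => φ (y i v)) (fun j v => φ (z j v)) a i t S := by
  induction i generalizing t S with
  | zero => simp only [walkSum, extOne]; split_ifs <;> simp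
  | succ i ih =>
    simp only [walkSum, map_list_sum, List.map_map]
    congr 1
    refine List.map_congr_left fun τ _ => ?_
    simp only [Function.comp]
    split_ifs
    · rw [map_mul, map_extMul]; simp only [ih]
    · simp

/-- With indicator weights that follow a given walk with distinct labels, only this walk
contributes. -/
theorem walkSum_indicator {T : List (ℕ × ℕ × ℕ)} {y z : ℕ → ℕ → ℤ} {a t k : ℕ} {st v : ℕ → ℕ}
    (hw : IsWalk T a t k st v) (hv : ∀ l m, l < m → m < k → v l ≠ v m)
    (hy : ∀ i < k, ∀ τ ∈ T, y (i + 1) τ.2.1 = if τ.2.1 = v i then 1 else 0)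
    (hz : ∀ j < k, ∀ τ ∈ T, z j τ.2.1 = if τ.2.1 = v j then 1 else 0) (i : ℕ) (hi : i ≤ k) :
    (∀ s S, S ⊆ Finset.range k → S ≠ Finset.range i → walkSum T y z a i s S = 0) ∧
    (∀ s, 0 ≤ walkSum T y z a i s (Finset.range i)) ∧
      0 < walkSum T y z a i (st i) (Finset.range i) := by
  induction i with
  | zero =>
    refine ⟨fun s S _ hS => ?_, fun s => ?_, ?_⟩
    · simp only [Finset.range_zero] at hS
      simp [walkSum, extOne, hS]
    · simp only [walkSum, extOne]; split_ifs <;> simp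
    · simp [walkSum, extOne, hw.start]
  | succ i ih =>
    obtain ⟨ih₁, ih₂, ih₃⟩ := ih (by omega)
    -- The label `v i` differs from the other `v j`, so only the coordinate `i` of its vector is
    -- nonzero. As `i` is the largest element of `range (i + 1)`, its sign is `+1`.
    have key : ∀ τ ∈ T, τ.2.1 = v i → ∀ S ⊆ Finset.range k,
        extMul (fun j => z j τ.2.1) (walkSum T y z a i τ.1) S =
          if S = Finset.range (i + 1) then walkSum T y z a i τ.1 (Finset.range i) else 0 := by
      intro τ hτ hτi S hS
      rw [extMul]
      have hz' : ∀ j ∈ S, j ≠ i → (-1) ^ (S.filter (j < ·)).card * z j τ.2.1 *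
          walkSum T y z a i τ.1 (S.erase j) = 0 := by
        intro j hj hji
        have hjk := Finset.mem_range.1 (hS hj)
        have : v i ≠ v j := by
          rcases lt_or_gt_of_ne hji with h | h
          · exact (hv j i h (by omega)).symm
          · exact hv i j h hjk
        rw [hz j hjk τ hτ, hτi, if_neg this]; simp
      by_cases hiS : i ∈ S
      · rw [Finset.sum_eq_single_of_mem i hiS hz', hz i (by omega) τ hτ, if_pos hτi]
        split_ifs with h
        · subst h
          have h1 : (Finset.range (i + 1)).filter (i < ·) = ∅ := by
            ext x; simp
          have h2 : (Finset.range (i + 1)).erase i = Finset.range i := by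
            ext x; simp; omega
          rw [h1, h2]; simp
        · rw [ih₁ τ.1 (S.erase i) ((Finset.erase_subset _ _).trans hS), mul_zero]
          intro h'
          apply h
          rw [← Finset.insert_erase hiS, h', Finset.range_add_one]
      · rw [Finset.sum_eq_zero fun j hj => hz' j hj (by rintro rfl; exact hiS hj), if_neg]
        rintro rfl
        simp at hiS
    have key' : ∀ s, ∀ S ⊆ Finset.range k, walkSum T y z a (i + 1) s S =
        (T.map fun τ => if τ.2.2 = s ∧ τ.2.1 = v i ∧ S = Finset.range (i + 1) then
          walkSum T y z a i τ.1 (Finset.range i) else 0).sum := by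
      intro s S hS
      rw [walkSum]
      congr 1
      refine List.map_congr_left fun τ hτ => ?_
      rw [hy i (by omega) τ hτ]
      by_cases h1 : τ.2.2 = s <;> by_cases h2 : τ.2.1 = v i
      · simp only [h1, if_true, true_and, h2, one_mul]
        rw [← h2, key τ hτ h2 S hS]
      all_goals simp [h1, h2]
    have hsub : Finset.range (i + 1) ⊆ Finset.range k := Finset.range_subset_range.2 hi
    have hnn : ∀ s, ∀ x ∈ T.map (fun τ => if τ.2.2 = s ∧ τ.2.1 = v i ∧
        Finset.range (i + 1) = Finset.range (i + 1) then
          walkSum T y z a i τ.1 (Finset.range i) else 0), 0 ≤ x := by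
      intro s x hx
      obtain ⟨τ, hτ, rfl⟩ := List.mem_map.1 hx
      split_ifs
      · exact ih₂ _
      · exact le_rfl
    refine ⟨fun s S hS hne => ?_, fun s => ?_, ?_⟩
    · rw [key' s S hS]; simp [hne]
    · rw [key' s _ hsub]; exact List.sum_nonneg (hnn s)
    · rw [key' _ _ hsub]
      -- Other walks with the same labels may contribute too, for instance through repeated
      -- transitions, but all terms are nonnegative and nothing cancels.
      refine lt_of_lt_of_le ih₃ (List.single_le_sum (hnn _) _ ?_)
      refine List.mem_map.2 ⟨_, hw.step i (by omega), by simp⟩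

end ExteriorWalk

/-! ### The degree of walk sums -/

section Degree

open MvPolynomial

theorem totalDegree_list_sum_le {σ : Type*} {L : List (MvPolynomial σ ℤ)} {d : ℕ}
    (h : ∀ p ∈ L, p.totalDegree ≤ d) : L.sum.totalDegree ≤ d := by
  induction L with
  | nil => simp
  | cons p L ih =>
    rw [List.sum_cons]
    refine (totalDegree_add _ _).trans (max_le (h p (by simp)) (ih fun q hq => h q ?_))
    simp [hq]

/-- Each step contributes one weight and one coordinate. -/
theorem totalDegree_walkSum_le {σ : Type*} (T : List (ℕ × ℕ × ℕ))
    {y z : ℕ → ℕ → MvPolynomial σ ℤ} (hy : ∀ i v, (y i v).totalDegree ≤ 1)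
    (hz : ∀ i v, (z i v).totalDegree ≤ 1) (a i t : ℕ) (S : Finset ℕ) :
    (walkSum T y z a i t S).totalDegree ≤ 2 * i := by
  induction i generalizing t S with
  | zero => simp only [walkSum, extOne]; split_ifs <;> simp
  | succ i ih =>
    rw [walkSum]
    refine totalDegree_list_sum_le fun p hp => ?_
    obtain ⟨τ, _, rfl⟩ := List.mem_map.1 hp
    split_ifs
    swap
    · simp
    refine (totalDegree_mul _ _).trans ?_
    have h1 : (extMul (fun j => z j τ.2.1) (walkSum T y z a i τ.1) S).totalDegree
        ≤ 1 + 2 * i := by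
      refine totalDegree_finsetSum_le fun j _ => ?_
      refine (totalDegree_mul _ _).trans (add_le_add ?_ (ih _ _))
      refine (totalDegree_mul _ _).trans ?_
      have h2 : ((-1 : MvPolynomial σ ℤ) ^ (S.filter (j < ·)).card).totalDegree = 0 := by
        rcases neg_one_pow_eq_or (MvPolynomial σ ℤ) (S.filter (j < ·)).card with h | h <;>
          simp [h]
      have := hz j τ.2.1
      dsimp only
      omega
    have := hy (i + 1) τ.2.1
    omega

end Degree

/-! ### Zeros of polynomials at random points -/

namespace LogRAM

open MeasureTheory

/-- The number with the binary digits `ω s, …, ω (s + L - 1)`, the most significant one first. -/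
def coinNum (ω : ℕ → Bool) (s : ℕ) : ℕ → ℕ
  | 0 => 0
  | L + 1 => 2 * coinNum ω s L + (ω (s + L)).toNat

theorem coinNum_lt (ω : ℕ → Bool) (s L : ℕ) : coinNum ω s L < 2 ^ L := by
  induction L with
  | zero => simp [coinNum]
  | succ L ih =>
    have := Bool.toNat_lt (ω (s + L))
    rw [coinNum, pow_succ]; omega

theorem coin_eq_of_coinNum_eq {ω ω' : ℕ → Bool} {s L : ℕ}
    (h : coinNum ω s L = coinNum ω' s L) : ∀ q < L, ω (s + q) = ω' (s + q) := by
  induction L with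
  | zero => intro q hq; omega
  | succ L ih =>
    rw [coinNum, coinNum] at h
    have h₁ := Bool.toNat_lt (ω (s + L))
    have h₂ := Bool.toNat_lt (ω' (s + L))
    intro q hq
    rcases Nat.lt_succ_iff_lt_or_eq.1 hq with hq | rfl
    · exact ih (by omega) q hq
    · have h₃ : (ω (s + q)).toNat = (ω' (s + q)).toNat := by omega
      revert h₃; cases ω (s + q) <;> cases ω' (s + q) <;> simp_all

instance : IsProbabilityMeasure coinMeasure := by
  unfold coinMeasure; infer_instance

theorem coinMeasure_cylinder (ω₀ : ℕ → Bool) (M : ℕ) :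
    coinMeasure {ω | ∀ q < M, ω q = ω₀ q} = (1 / 2) ^ M := by
  have : {ω : ℕ → Bool | ∀ q < M, ω q = ω₀ q} =
      Set.pi (Finset.range M) fun q => {ω₀ q} := by
    ext ω; simp [Set.mem_pi]
  rw [this, coinMeasure, Measure.infinitePi_pi _ fun _ _ => MeasurableSet.of_discrete]
  rw [Finset.prod_congr rfl (g := fun _ => (1 / 2 : ENNReal)), Finset.prod_const,
    Finset.card_range]
  intro q _
  rw [PMF.toMeasure_apply_singleton _ _ (MeasurableSet.of_discrete)]
  simp [PMF.uniformOfFintype_apply]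

/-- The numbers use disjoint blocks of coins and determine them, so the event, unless it is empty,
lies in a cylinder over the first `N * L` coins. -/
theorem coinMeasure_coinNum_eq_le {N L : ℕ} (f : Fin N → ℤ) :
    coinMeasure {ω | ∀ t : Fin N, (coinNum ω (t * L) L : ℤ) = f t} ≤ (1 / 2) ^ (N * L) := by
  rcases Set.eq_empty_or_nonempty {ω | ∀ t : Fin N, (coinNum ω (t * L) L : ℤ) = f t} with
    h | ⟨ω₀, h₀⟩
  · rw [h]; simp
  · rw [← coinMeasure_cylinder ω₀]
    refine measure_mono fun ω hω q hq => ?_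
    have hL : 0 < L := Nat.pos_of_ne_zero fun h => by simp [h] at hq
    have ht : q / L < N := (Nat.div_lt_iff_lt_mul hL).2 hq
    have h₁ := hω ⟨q / L, ht⟩
    have h₂ := h₀ ⟨q / L, ht⟩
    have := coin_eq_of_coinNum_eq (Nat.cast_inj.1 (h₁.trans h₂.symm)) (q % L) (Nat.mod_lt _ hL)
    rwa [show q / L * L + q % L = q from Nat.div_add_mod' q L] at this

/-- A nonzero polynomial of degree at most `2 ^ n` rarely vanishes at random points whose
coordinates have `2 * n` bits. -/
theorem coinMeasure_eval_eq_zero_le {N n : ℕ} {p : MvPolynomial (Fin N) ℤ} (hp : p ≠ 0)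
    (hd : p.totalDegree ≤ 2 ^ n) :
    coinMeasure {ω | MvPolynomial.eval (fun t : Fin N => (coinNum ω (t * (2 * n)) (2 * n) : ℤ)) p
      = 0} ≤ (1 / 2) ^ n := by
  set L := 2 * n with hL
  set S : Finset ℤ := (Finset.range (2 ^ L)).image Nat.cast with hS
  have hcard : S.card = 2 ^ L := by
    rw [hS, Finset.card_image_of_injective _ Nat.cast_injective, Finset.card_range]
  set Z := {f ∈ Fintype.piFinset fun _ : Fin N => S | MvPolynomial.eval f p = 0} with hZ
  have hsub : {ω | MvPolynomial.eval (fun t : Fin N => (coinNum ω (t * L) L : ℤ)) p = 0} ⊆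
      ⋃ f ∈ Z, {ω | ∀ t : Fin N, (coinNum ω (t * L) L : ℤ) = f t} := by
    intro ω hω
    simp only [Set.mem_iUnion]
    refine ⟨fun t => (coinNum ω (t * L) L : ℤ), ?_, fun t => rfl⟩
    rw [hZ, Finset.mem_filter, Fintype.mem_piFinset]
    exact ⟨fun t => Finset.mem_image_of_mem _ (Finset.mem_range.2 (coinNum_lt _ _ _)), hω⟩
  -- Schwartz-Zippel on a grid of side `2 ^ (2 * n)`: the proportion of zeros is at most `2 ^ n / 2
  -- ^ (2 * n)`.
  have hZcard : Z.card * 2 ^ n ≤ 2 ^ (N * L) := by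
    have h := MvPolynomial.schwartz_zippel_totalDegree hp S
    rw [hcard, div_le_div_iff₀ (by positivity) (by positivity)] at h
    have h' : Z.card * 2 ^ L ≤ p.totalDegree * (2 ^ L) ^ N := by exact_mod_cast h
    have h2 : Z.card * 2 ^ n * 2 ^ n ≤ 2 ^ (N * L) * 2 ^ n := by
      calc Z.card * 2 ^ n * 2 ^ n = Z.card * 2 ^ L := by rw [hL, two_mul, pow_add, mul_assoc]
        _ ≤ _ := h'
        _ ≤ 2 ^ n * (2 ^ L) ^ N := Nat.mul_le_mul_right _ hd
        _ = _ := by rw [← pow_mul, mul_comm L N, mul_comm]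
    exact Nat.le_of_mul_le_mul_right h2 (by positivity)
  calc _ ≤ ∑ f ∈ Z, coinMeasure {ω | ∀ t : Fin N, (coinNum ω (t * L) L : ℤ) = f t} :=
        (measure_mono hsub).trans (measure_biUnion_finset_le _ _)
    _ ≤ ∑ f ∈ Z, (1 / 2) ^ (N * L) := Finset.sum_le_sum fun f _ => coinMeasure_coinNum_eq_le f
    _ = Z.card * (1 / 2) ^ (N * L) := by simp
    _ ≤ _ := by
      rw [one_div, ← ENNReal.inv_pow, ← ENNReal.inv_pow, ← div_eq_mul_inv]
      refine ENNReal.div_le_of_le_mul ?_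
      rw [mul_comm, ← div_eq_mul_inv]
      rw [ENNReal.le_div_iff_mul_le (by simp) (by simp)]
      exact_mod_cast hZcard

/-- Subadditivity is enough, so neither the accepting set nor the bad set has to be shown
measurable. -/
theorem coinMeasure_real_ge {n : ℕ} {A B : Set (ℕ → Bool)} (hB : coinMeasure B ≤ (1 / 2) ^ n)
    (h : ∀ ω, ω ∉ B → ω ∈ A) : 1 - (1 / 2 : ℝ) ^ n ≤ coinMeasure.real A := by
  have h₁ : coinMeasure.real (A ∪ B) ≤ coinMeasure.real A + coinMeasure.real B :=
    measureReal_union_le A B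
  have h₂ : A ∪ B = Set.univ := by
    ext ω; by_cases hω : ω ∈ B <;> simp [hω, h ω]
  have h₃ : coinMeasure.real B ≤ (1 / 2) ^ n := by
    have := ENNReal.toReal_mono (by simp) hB
    simpa [Measure.real] using this
  rw [h₂, probReal_univ] at h₁
  linarith

end LogRAM

/-! ### Tight paths and cycles as walks between codes -/

section Codes

/-- Append the digit `u + 1` to the number `c` in base `b`, and keep the residue modulo `Q`. -/
def shiftCode (b Q c u : ℕ) : ℕ := (c * b + (u + 1)) % Q

/-- The codes of the beginnings of the sequence `u`. -/
def prefixCode (b Q : ℕ) (u : ℕ → ℕ) : ℕ → ℕ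
  | 0 => 0
  | a + 1 => shiftCode b Q (prefixCode b Q u a) (u a)

/-- The digit number `l`, the last one being number zero. -/
def digitAt (b c l : ℕ) : ℕ := c / b ^ l % b

theorem mod_pow_div_pow_mod {b d l : ℕ} (x : ℕ) (h : l < d) :
    x % b ^ d / b ^ l % b = x / b ^ l % b := by
  obtain ⟨e, rfl⟩ := Nat.exists_eq_add_of_lt h
  rw [show l + e + 1 = l + (e + 1) by ring, pow_add, Nat.mod_mul_right_div_self,
    Nat.mod_mod_of_dvd _ (Dvd.intro_left (b ^ e) (pow_succ b e).symm)]

theorem digitAt_shiftCode_zero {b d c u : ℕ} (hd : 0 < d) (hu : u + 1 < b) :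
    digitAt b (shiftCode b (b ^ d) c u) 0 = u + 1 := by
  have := mod_pow_div_pow_mod (b := b) (c * b + (u + 1)) hd
  rw [digitAt, shiftCode, this]
  rw [pow_zero, Nat.div_one, mul_comm, Nat.mul_add_mod, Nat.mod_eq_of_lt hu]

theorem digitAt_shiftCode_succ {b d c u l : ℕ} (hl : l + 1 < d) (hu : u + 1 < b) :
    digitAt b (shiftCode b (b ^ d) c u) (l + 1) = digitAt b c l := by
  have := mod_pow_div_pow_mod (b := b) (c * b + (u + 1)) hl
  rw [digitAt, shiftCode, this, digitAt, pow_succ', ← Nat.div_div_eq_div_mul]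
  rw [mul_comm c b, Nat.mul_add_div (by omega), Nat.div_eq_of_lt hu, add_zero]

theorem eq_of_digitAt_eq {b d x y : ℕ} (hx : x < b ^ d) (hy : y < b ^ d)
    (h : ∀ l < d, digitAt b x l = digitAt b y l) : x = y := by
  induction d generalizing x y with
  | zero => simp at hx hy; omega
  | succ d ih =>
    have h₀ := h 0 (by omega)
    simp only [digitAt, pow_zero, Nat.div_one] at h₀
    rw [pow_succ] at hx hy
    have h₁ : x / b = y / b := by
      refine ih (Nat.div_lt_of_lt_mul (by rwa [mul_comm]))
        (Nat.div_lt_of_lt_mul (by rwa [mul_comm])) fun l hl => ?_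
      have := h (l + 1) (by omega)
      simp only [digitAt] at this ⊢
      rwa [pow_succ', ← Nat.div_div_eq_div_mul, ← Nat.div_div_eq_div_mul] at this
    rw [← Nat.div_add_mod x b, ← Nat.div_add_mod y b, h₀, h₁]

/-- The digits of the codes along a sequence of shifts. -/
theorem digitAt_of_shifts {b d k : ℕ} {st v : ℕ → ℕ} (hv : ∀ i < k, v i + 1 < b)
    (hst : ∀ i < k, st (i + 1) = shiftCode b (b ^ d) (st i) (v i)) (i : ℕ) (hi : i ≤ k) (l : ℕ)
    (hl : l < d) :
    digitAt b (st i) l = if l < i then v (i - 1 - l) + 1 else digitAt b (st 0) (l - i) := by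
  induction i generalizing l with
  | zero => simp
  | succ i ih =>
    rw [hst i (by omega)]
    cases l with
    | zero => simp [digitAt_shiftCode_zero hl (hv i (by omega))]
    | succ l =>
      rw [digitAt_shiftCode_succ hl (hv i (by omega)), ih (by omega) l (by omega)]
      simp only [Nat.add_lt_add_iff_right]
      rw [show i + 1 - 1 - (l + 1) = i - 1 - l by omega, show l + 1 - (i + 1) = l - i by omega]

theorem digitAt_prefixCode {b d k : ℕ} {u : ℕ → ℕ} (hu : ∀ i < k, u i + 1 < b) (i : ℕ) (hi : i ≤ k)
    (l : ℕ) (hl : l < d) :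
    digitAt b (prefixCode b (b ^ d) u i) l = if l < i then u (i - 1 - l) + 1 else 0 := by
  rw [digitAt_of_shifts hu (fun _ _ => rfl) i hi l hl]
  simp [prefixCode, digitAt]

theorem prefixCode_congr {b Q : ℕ} {u w : ℕ → ℕ} {i : ℕ} (h : ∀ l < i, u l = w l) :
    prefixCode b Q u i = prefixCode b Q w i := by
  induction i with
  | zero => rfl
  | succ i ih => rw [prefixCode, prefixCode, ih fun l hl => h l (by omega), h i (by omega)]

theorem prefixCode_lt {b Q : ℕ} (hQ : 0 < Q) (u : ℕ → ℕ) (i : ℕ) : prefixCode b Q u i < Q := by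
  cases i with
  | zero => exact hQ
  | succ i => exact Nat.mod_lt _ hQ

/-- The transitions between codes along the sequences `u 0, …, u (m - 1)` of length `r`. -/
def transitions (b Q r m : ℕ) (u : ℕ → ℕ → ℕ) : List (ℕ × ℕ × ℕ) :=
  (List.range m).flatMap fun e => (List.range r).map fun a =>
    (prefixCode b Q (u e) a, u e a, prefixCode b Q (u e) (a + 1))

theorem mem_transitions {b Q r m : ℕ} {u : ℕ → ℕ → ℕ} {τ : ℕ × ℕ × ℕ} :
    τ ∈ transitions b Q r m u ↔ ∃ e < m, ∃ a < r,
      (prefixCode b Q (u e) a, u e a, prefixCode b Q (u e) (a + 1)) = τ := by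
  simp [transitions]

variable {n d m k : ℕ} {u : ℕ → ℕ → ℕ}

/-- A transition from a code without zero digits comes from the last step of a sequence. -/
theorem exists_of_mem_transitions (hu : ∀ e < m, ∀ a < d + 1, u e a < n) {s w s' : ℕ}
    (h : (s, w, s') ∈ transitions (n + 1) ((n + 1) ^ d) (d + 1) m u)
    (hs : ∀ l < d, digitAt (n + 1) s l ≠ 0) :
    ∃ e < m, w = u e d ∧ ∀ l < d, digitAt (n + 1) s l = u e (d - 1 - l) + 1 := by
  obtain ⟨e, he, a, ha, heq⟩ := mem_transitions.1 h
  simp only [Prod.mk.injEq] at heq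
  obtain ⟨rfl, rfl, rfl⟩ := heq
  have hd := fun l hl => digitAt_prefixCode (b := n + 1) (d := d) (u := u e) (k := d + 1)
    (fun i hi => Nat.succ_lt_succ (hu e he i hi)) a (by omega) l hl
  -- The code of a prefix of length `a < d` has the digit zero at place `a`.
  have had : a = d := by
    by_contra had
    have h₁ := hd a (by omega)
    simp only [lt_irrefl, if_false] at h₁
    exact hs a (by omega) h₁
  subst had
  refine ⟨e, he, rfl, fun l hl => ?_⟩
  rw [hd l hl, if_pos hl]

theorem IsWalk.shift (hu : ∀ e < m, ∀ a < d + 1, u e a < n) {a t : ℕ} {st v : ℕ → ℕ}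
    (hw : IsWalk (transitions (n + 1) ((n + 1) ^ d) (d + 1) m u) a t k st v) :
    (∀ i < k, v i < n) ∧
      ∀ i < k, st (i + 1) = shiftCode (n + 1) ((n + 1) ^ d) (st i) (v i) := by
  constructor <;> intro i hi <;> obtain ⟨e, he, a, ha, heq⟩ := mem_transitions.1 (hw.step i hi) <;>
    simp only [Prod.mk.injEq] at heq
  · rw [← heq.2.1]; exact hu e he a ha
  · rw [← heq.2.2, ← heq.1, ← heq.2.1]; rfl

/-- After `i + d` steps the state shows the last `d` labels and has no zero digit. The step that
follows is thus the last one of a hyperedge, and the digits, read backwards, identify its first `d`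
nodes. -/
theorem windows_of_isWalk (hu : ∀ e < m, ∀ a < d + 1, u e a < n) {t : ℕ} {st v : ℕ → ℕ}
    (hw : IsWalk (transitions (n + 1) ((n + 1) ^ d) (d + 1) m u) 0 t k st v) (i : ℕ)
    (hi : i + (d + 1) ≤ k) : ∃ e < m, ∀ j < d + 1, u e j = v (i + j) := by
  obtain ⟨hv, hst⟩ := hw.shift hu
  have hd := fun l hl => digitAt_of_shifts (k := k) (fun i hi => Nat.succ_lt_succ (hv i hi)) hst
    (i + d) (by omega) l hl
  obtain ⟨e, he, h₁, h₂⟩ := exists_of_mem_transitions hu (hw.step (i + d) (by omega)) fun l hl => by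
    rw [hd l hl, if_pos (by omega)]; omega
  refine ⟨e, he, fun j hj => ?_⟩
  rcases Nat.lt_succ_iff_lt_or_eq.1 hj with hj | rfl
  · have h₃ := h₂ (d - 1 - j) (by omega)
    rw [hd _ (by omega), if_pos (by omega)] at h₃
    rw [show d - 1 - (d - 1 - j) = j by omega, show i + d - 1 - (d - 1 - j) = i + j by omega] at h₃
    omega
  · exact h₁.symm

/-- The initial state is also the final one, and after `k ≥ d + 1` steps all `d` digits are labels.
Hence no state of the walk has a zero digit, and digits older than the start are labels from the end
of the walk. -/
theorem windows_of_isWalk_closed (hu : ∀ e < m, ∀ a < d + 1, u e a < n) {t : ℕ} {st v : ℕ → ℕ}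
    (hw : IsWalk (transitions (n + 1) ((n + 1) ^ d) (d + 1) m u) t t k st v) (hk : d + 1 ≤ k)
    (i : ℕ) (hi : i < k) : ∃ e < m, ∀ j < d + 1, u e j = v ((i + j) % k) := by
  obtain ⟨hv, hst⟩ := hw.shift hu
  have hd := digitAt_of_shifts (d := d) (fun i hi => Nat.succ_lt_succ (hv i hi)) hst
  have hmod : ∀ i' < k, ∀ l < d,
      digitAt (n + 1) (st i') l = v ((i' + k - 1 - l) % k) + 1 := by
    intro i' hi' l hl
    rw [hd i' hi'.le l hl]
    split_ifs with h
    · rw [show i' + k - 1 - l = i' - 1 - l + k by omega, Nat.add_mod_right,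
        Nat.mod_eq_of_lt (by omega)]
    · rw [hw.start, ← hw.finish, hd k le_rfl _ (by omega), if_pos (by omega),
        show i' + k - 1 - l = k - 1 - (l - i') by omega, Nat.mod_eq_of_lt (by omega)]
  have hik : (i + d) % k < k := Nat.mod_lt _ (by omega)
  obtain ⟨e, he, h₁, h₂⟩ := exists_of_mem_transitions hu (hw.step ((i + d) % k) hik)
    fun l hl => by rw [hmod _ hik l hl]; omega
  refine ⟨e, he, fun j hj => ?_⟩
  rcases Nat.lt_succ_iff_lt_or_eq.1 hj with hj | rfl
  · have h₃ := h₂ (d - 1 - j) (by omega)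
    rw [hmod _ hik _ (by omega), show d - 1 - (d - 1 - j) = j by omega] at h₃
    have h₄ : ((i + d) % k + k - 1 - (d - 1 - j)) % k = (i + j) % k := by
      rw [show (i + d) % k + k - 1 - (d - 1 - j) = (i + d) % k + (k - d + j) by omega,
        Nat.mod_add_mod, show i + d + (k - d + j) = i + j + k by omega, Nat.add_mod_right]
    rw [h₄] at h₃
    omega
  · exact h₁.symm

/-- The first `d + 1` steps follow the prefixes of the hyperedge at position `0`, which exists
because `d + 1 ≤ k`. A later step `i` is the last step of the hyperedge at position `i - d`:
truncation to `d` digits makes its prefix code equal to that of the whole sequence. -/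
theorem exists_isWalk_of_windows (hu : ∀ e < m, ∀ a < d + 1, u e a < n) {v : ℕ → ℕ}
    (hk : d + 1 ≤ k) (h : ∀ i, i + (d + 1) ≤ k → ∃ e < m, ∀ j < d + 1, u e j = v (i + j)) :
    IsWalk (transitions (n + 1) ((n + 1) ^ d) (d + 1) m u) 0
      (prefixCode (n + 1) ((n + 1) ^ d) v k) k (prefixCode (n + 1) ((n + 1) ^ d) v) v := by
  have hv : ∀ i < k, v i < n := by
    intro i hi
    by_cases hid : i < d + 1
    · obtain ⟨e, he, h₁⟩ := h 0 (by omega)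
      have := h₁ i hid
      rw [zero_add] at this
      rw [← this]; exact hu e he i hid
    · obtain ⟨e, he, h₁⟩ := h (i - d) (by omega)
      have := h₁ d (by omega)
      rw [show i - d + d = i by omega] at this
      rw [← this]; exact hu e he d (by omega)
  refine ⟨rfl, rfl, fun i hi => mem_transitions.2 ?_⟩
  by_cases hid : i < d + 1
  · obtain ⟨e, he, h₁⟩ := h 0 (by omega)
    simp only [zero_add] at h₁
    refine ⟨e, he, i, hid, ?_⟩
    rw [prefixCode_congr (w := v) fun l hl => h₁ l (by omega), h₁ i hid,
      prefixCode_congr (i := i + 1) (w := v) fun l hl => h₁ l (by omega)]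
  · obtain ⟨e, he, h₁⟩ := h (i - d) (by omega)
    have h₂ : prefixCode (n + 1) ((n + 1) ^ d) (u e) d = prefixCode (n + 1) ((n + 1) ^ d) v i := by
      refine eq_of_digitAt_eq (prefixCode_lt (by positivity) _ _)
        (prefixCode_lt (by positivity) _ _) fun l hl => ?_
      rw [digitAt_prefixCode (k := d) (fun i hi => Nat.succ_lt_succ (hu e he i (by omega))) d le_rfl
        l hl, digitAt_prefixCode (k := k) (fun i hi => Nat.succ_lt_succ (hv i hi)) i hi.le l hl,
        if_pos hl, if_pos (by omega), h₁ _ (by omega),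
        show i - d + (d - 1 - l) = i - 1 - l by omega]
    have h₃ := h₁ d (by omega)
    rw [show i - d + d = i by omega] at h₃
    refine ⟨e, he, d, by omega, ?_⟩
    rw [prefixCode, prefixCode, h₂, h₃]

theorem exists_isWalk_closed_of_windows (hu : ∀ e < m, ∀ a < d + 1, u e a < n) {v : ℕ → ℕ}
    (hk : d + 1 ≤ k) (h : ∀ i < k, ∃ e < m, ∀ j < d + 1, u e j = v ((i + j) % k)) :
    ∃ τ ∈ transitions (n + 1) ((n + 1) ^ d) (d + 1) m u, ∃ st,
      IsWalk (transitions (n + 1) ((n + 1) ^ d) (d + 1) m u) τ.1 τ.1 k st v := by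
  choose! E hE hEu using h
  have hmod : ∀ x, x % k < k := fun x => Nat.mod_lt _ (by omega)
  -- `E i` is the hyperedge at position `i`. The state before step `i` is the code of the `d`
  -- preceding nodes, which begin the hyperedge at position `i - d` modulo `k`; adding `k` avoids
  -- truncated subtraction.
  set st : ℕ → ℕ := fun i => prefixCode (n + 1) ((n + 1) ^ d) (u (E ((i + k - d) % k))) d with hst
  have hlabel : ∀ i < k, u (E ((i + k - d) % k)) d = v i := by
    intro i hi
    rw [hEu _ (hmod _) d (by omega), Nat.mod_add_mod, show i + k - d + d = i + k by omega,
      Nat.add_mod_right, Nat.mod_eq_of_lt hi]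
  have hnext : ∀ i < k, prefixCode (n + 1) ((n + 1) ^ d) (u (E ((i + k - d) % k))) (d + 1) =
      st (i + 1) := by
    intro i hi
    refine eq_of_digitAt_eq (prefixCode_lt (by positivity) _ _)
      (prefixCode_lt (by positivity) _ _) fun l hl => ?_
    rw [digitAt_prefixCode (k := d + 1)
        (fun i hi => Nat.succ_lt_succ (hu _ (hE _ (hmod _)) i (by omega))) (d + 1) le_rfl l hl,
      digitAt_prefixCode (k := d)
        (fun i hi => Nat.succ_lt_succ (hu _ (hE _ (hmod _)) i (by omega))) d le_rfl l hl,
      if_pos hl, if_pos (by omega), hEu _ (hmod _) _ (by omega), hEu _ (hmod _) _ (by omega),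
      Nat.mod_add_mod, Nat.mod_add_mod]
    congr 3
    omega
  have hmem : ∀ i < k, (st i, v i, st (i + 1)) ∈
      transitions (n + 1) ((n + 1) ^ d) (d + 1) m u := by
    intro i hi
    refine mem_transitions.2 ⟨_, hE _ (hmod (i + k - d)), d, by omega, ?_⟩
    rw [hlabel i hi, hnext i hi]
  refine ⟨_, hmem 0 (by omega), st, rfl, ?_, hmem⟩
  simp only [hst]
  rw [show k + k - d = 0 + k - d + k by omega, Nat.add_mod_right]

end Codes

/-! ### Signed arithmetic with pairs of natural numbers -/

section Pairs

/-- The first `q` steps of the computation of a product in the exterior algebra over the integers,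
each integer being represented as a difference of two natural numbers. -/
def pairMul (z : ℕ → ℕ) (f : Finset ℕ → ℕ × ℕ) (S : Finset ℕ) : ℕ → ℕ × ℕ
  | 0 => 0
  | q + 1 => if q ∈ S then
      ((pairMul z f S q).2 + (f (S.erase q)).1 * z q, (pairMul z f S q).1 + (f (S.erase q)).2 * z q)
    else pairMul z f S q

/-- The integer represented by a pair of natural numbers. -/
def pairVal : ℕ × ℕ →+ ℤ where
  toFun p := p.1 - p.2
  map_zero' := by simp
  map_add' p q := by simp; ring

theorem pairVal_apply (p : ℕ × ℕ) : pairVal p = (p.1 : ℤ) - p.2 := rfl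

/-- Each new element `q` of `S` lies above all earlier ones and flips the signs of their terms.
Exchanging the two components of the accumulator does this without negative numbers. -/
theorem pairVal_pairMul_eq (z : ℕ → ℕ) (f : Finset ℕ → ℕ × ℕ) (S : Finset ℕ) (q : ℕ) :
    pairVal (pairMul z f S q) = ∑ j ∈ S.filter (· < q),
      (-1) ^ ((S.filter (· < q)).filter (j < ·)).card * z j * pairVal (f (S.erase j)) := by
  induction q with
  | zero => simp [pairMul]
  | succ q ih =>
    rw [pairMul]
    by_cases hq : q ∈ S
    · have hins : S.filter (· < q + 1) = insert q (S.filter (· < q)) := by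
        ext x
        simp only [Finset.mem_filter, Finset.mem_insert, Nat.lt_succ_iff_lt_or_eq]
        constructor
        · rintro ⟨h, h' | rfl⟩ <;> simp_all
        · rintro (rfl | ⟨h, h'⟩) <;> simp_all
      have h0 : (insert q (S.filter (· < q))).filter (q < ·) = ∅ := by
        ext x; simp; omega
      rw [if_pos hq, hins, Finset.sum_insert (by simp), h0]
      have h1 : ∀ j ∈ S.filter (· < q),
          (-1 : ℤ) ^ ((insert q (S.filter (· < q))).filter (j < ·)).card * z j *
            pairVal (f (S.erase j)) =
          -((-1) ^ ((S.filter (· < q)).filter (j < ·)).card * z j * pairVal (f (S.erase j))) := by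
        intro j hj
        have hjq : j < q := (Finset.mem_filter.1 hj).2
        rw [Finset.filter_insert, if_pos hjq, Finset.card_insert_of_notMem (by simp), pow_succ]
        ring
      rw [Finset.sum_congr rfl h1, Finset.sum_neg_distrib, ← ih]
      simp only [pairVal_apply]
      push_cast
      simp
      ring
    · have : S.filter (· < q + 1) = S.filter (· < q) := by
        ext x
        simp only [Finset.mem_filter, Nat.lt_succ_iff_lt_or_eq]
        constructor
        · rintro ⟨h, h' | rfl⟩ <;> simp_all
        · rintro ⟨h, h'⟩; simp_all
      rw [if_neg hq, this, ih]

theorem pairVal_pairMul {k : ℕ} (z : ℕ → ℕ) (f : Finset ℕ → ℕ × ℕ) {S : Finset ℕ}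
    (hS : S ⊆ Finset.range k) :
    pairVal (pairMul z f S k) = extMul (fun j => (z j : ℤ)) (fun S => pairVal (f S)) S := by
  rw [pairVal_pairMul_eq, Finset.filter_true_of_mem fun j hj => Finset.mem_range.1 (hS hj), extMul]

/-- Sums over walks, computed with pairs of natural numbers. -/
def walkPair (k : ℕ) (T : List (ℕ × ℕ × ℕ)) (y z : ℕ → ℕ → ℕ) (a : ℕ) :
    ℕ → ℕ → Finset ℕ → ℕ × ℕ
  | 0, t, S => if t = a ∧ S = ∅ then (1, 0) else 0
  | i + 1, t, S => (T.map fun τ => if τ.2.2 = t then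
      y (i + 1) τ.2.1 • pairMul (fun j => z j τ.2.1) (walkPair k T y z a i τ.1) S k else 0).sum

theorem pairVal_walkPair (k : ℕ) (T : List (ℕ × ℕ × ℕ)) (y z : ℕ → ℕ → ℕ) (a i t : ℕ)
    {S : Finset ℕ} (hS : S ⊆ Finset.range k) :
    pairVal (walkPair k T y z a i t S) =
      walkSum T (fun i v => (y i v : ℤ)) (fun j v => (z j v : ℤ)) a i t S := by
  induction i generalizing t S with
  | zero =>
    simp only [walkPair, walkSum, extOne]
    by_cases h : t = a <;> by_cases h' : S = ∅ <;> simp [h, h', pairVal_apply]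
  | succ i ih =>
    simp only [walkPair, walkSum, map_list_sum, List.map_map]
    congr 1
    refine List.map_congr_left fun τ _ => ?_
    simp only [Function.comp]
    split_ifs
    · rw [map_nsmul, pairVal_pairMul _ _ hS, nsmul_eq_mul]
      congr 1
      refine Finset.sum_congr rfl fun j _ => ?_
      dsimp only
      rw [ih τ.1 ((Finset.erase_subset _ _).trans hS)]
    · simp

/-- The sum of the two components is insensitive to the exchanges, and it bounds both of them. -/
theorem pairMul_sum_le {z : ℕ → ℕ} {f : Finset ℕ → ℕ × ℕ} {S : Finset ℕ} {X F q : ℕ}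
    (hz : ∀ j < q, z j ≤ X) (hf : ∀ j ∈ S, (f (S.erase j)).1 + (f (S.erase j)).2 ≤ F) :
    (pairMul z f S q).1 + (pairMul z f S q).2 ≤ q * (F * X) := by
  induction q with
  | zero => simp [pairMul]
  | succ q ih =>
    have h₁ := ih fun j hj => hz j (by omega)
    rw [pairMul]
    split_ifs with hq
    · have h₂ := Nat.mul_le_mul (hf q hq) (hz q (by omega))
      rw [add_mul] at h₂
      dsimp only
      rw [add_mul q 1, one_mul]
      omega
    · exact h₁.trans (Nat.mul_le_mul_right _ (by omega))

theorem list_sum_pair_le {L : List (ℕ × ℕ)} {D : ℕ} (h : ∀ p ∈ L, p.1 + p.2 ≤ D) :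
    L.sum.1 + L.sum.2 ≤ L.length * D := by
  induction L with
  | nil => simp
  | cons p L ih =>
    have h₁ := h p (by simp)
    have h₂ := ih fun q hq => h q (by simp [hq])
    simp only [List.sum_cons, Prod.fst_add, Prod.snd_add, List.length_cons, add_mul]
    omega

/-- The factor by which numbers grow in one step of the computation of the sum over walks. -/
def walkGrowth (k X t : ℕ) : ℕ := t * (k * (X * X)) + 1

theorem walkPair_term_le {k X : ℕ} {T : List (ℕ × ℕ × ℕ)} {y z : ℕ → ℕ → ℕ} {a i F : ℕ}
    {τ : ℕ × ℕ × ℕ} {S : Finset ℕ} (hz : ∀ j < k, z j τ.2.1 ≤ X) (hy : y (i + 1) τ.2.1 ≤ X)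
    (hF : ∀ j ∈ S, (walkPair k T y z a i τ.1 (S.erase j)).1 +
      (walkPair k T y z a i τ.1 (S.erase j)).2 ≤ F) (t : ℕ) :
    (if τ.2.2 = t then
      y (i + 1) τ.2.1 • pairMul (fun j => z j τ.2.1) (walkPair k T y z a i τ.1) S k else 0).1 +
    (if τ.2.2 = t then
      y (i + 1) τ.2.1 • pairMul (fun j => z j τ.2.1) (walkPair k T y z a i τ.1) S k else 0).2 ≤
      F * (k * (X * X)) := by
  split_ifs
  swap
  · simp
  have h₁ := pairMul_sum_le (q := k) hz hF
  simp only [Prod.smul_fst, Prod.smul_snd, smul_eq_mul, ← mul_add]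
  calc _ ≤ X * (k * (F * X)) := Nat.mul_le_mul hy h₁
    _ = _ := by ring

theorem walkPair_le {k X : ℕ} {T : List (ℕ × ℕ × ℕ)} {y z : ℕ → ℕ → ℕ}
    (hz : ∀ j < k, ∀ τ ∈ T, z j τ.2.1 ≤ X) (hy : ∀ i < k, ∀ τ ∈ T, y (i + 1) τ.2.1 ≤ X)
    (a i t : ℕ) (hi : i ≤ k) (S : Finset ℕ) :
    (walkPair k T y z a i t S).1 + (walkPair k T y z a i t S).2 ≤ walkGrowth k X T.length ^ i := by
  induction i generalizing t S with
  | zero => simp only [walkPair]; split_ifs <;> simp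
  | succ i ih =>
    rw [walkPair]
    refine (list_sum_pair_le (D := walkGrowth k X T.length ^ i * (k * (X * X))) ?_).trans ?_
    · intro p hp
      obtain ⟨τ, hτ, rfl⟩ := List.mem_map.1 hp
      exact walkPair_term_le (fun j hj => hz j hj τ hτ) (hy i (by omega) τ hτ)
        (fun j _ => ih τ.1 (by omega) _) t
    · rw [List.length_map, pow_succ, walkGrowth]
      rw [show T.length * ((T.length * (k * (X * X)) + 1) ^ i * (k * (X * X))) =
        (T.length * (k * (X * X)) + 1) ^ i * (T.length * (k * (X * X))) by ring]
      exact Nat.mul_le_mul_left _ (by omega)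

end Pairs

/-! ### Subsets as binary numbers -/

section Bits

/-- The set of the positions below `k` of the nonzero binary digits of `S`. -/
def bitSet (k S : ℕ) : Finset ℕ := (Finset.range k).filter fun j => S.testBit j

theorem bitSet_subset (k S : ℕ) : bitSet k S ⊆ Finset.range k := Finset.filter_subset _ _

theorem bitSet_zero (k : ℕ) : bitSet k 0 = ∅ := by simp [bitSet]

theorem bitSet_two_pow_sub_one (k : ℕ) : bitSet k (2 ^ k - 1) = Finset.range k := by
  ext j; simp [bitSet, Nat.testBit_two_pow_sub_one]

theorem card_bitSet_pos {k S : ℕ} (h : 0 < S) (hS : S < 2 ^ k) : 0 < (bitSet k S).card := by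
  refine Finset.card_pos.2 (Finset.nonempty_iff_ne_empty.2 fun h0 => h.ne' ?_)
  refine Nat.eq_of_testBit_eq fun j => ?_
  rw [Nat.zero_testBit]
  by_cases hj : j < k
  · by_contra hb
    have : j ∈ bitSet k S := by simpa [bitSet, hj] using hb
    simp [h0] at this
  · exact Nat.testBit_lt_two_pow (hS.trans_le (Nat.pow_le_pow_right (by norm_num) (by omega)))

theorem card_bitSet_le (k S : ℕ) : (bitSet k S).card ≤ k := by
  simpa using Finset.card_le_card (bitSet_subset k S)

/-- With `S = 2 ^ j * (2 * c + 1) + d` and `d < 2 ^ j`, the subtraction turns `2 * c + 1` into `2 *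
c`; there is no borrow. -/
theorem testBit_sub_two_pow {S j : ℕ} (h : S.testBit j = true) (l : ℕ) :
    (S - 2 ^ j).testBit l = (S.testBit l && decide (l ≠ j)) := by
  have hodd : S / 2 ^ j % 2 = 1 := by simpa [Nat.testBit_eq_decide_div_mod_eq] using h
  obtain ⟨c, hc⟩ : ∃ c, S / 2 ^ j = 2 * c + 1 := ⟨S / 2 ^ j / 2, by omega⟩
  have hd : S % 2 ^ j < 2 ^ j := Nat.mod_lt _ (by positivity)
  have hS : S = 2 ^ j * (2 * c + 1) + S % 2 ^ j := by rw [← hc, Nat.div_add_mod]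
  generalize S % 2 ^ j = d at hd hS
  have hS' : S - 2 ^ j = 2 ^ j * (2 * c) + d := by
    rw [hS, mul_add, mul_one]; omega
  rw [hS', hS, Nat.testBit_two_pow_mul_add _ hd, Nat.testBit_two_pow_mul_add _ hd]
  rcases lt_trichotomy l j with hl | rfl | hl
  · simp [hl, hl.ne]
  · simp
  · obtain ⟨e, rfl⟩ := Nat.exists_eq_add_of_lt hl
    have : ¬ (j + e + 1 < j) := by omega
    rw [if_neg this, if_neg this, show j + e + 1 - j = e + 1 by omega, Nat.testBit_succ,
      Nat.testBit_succ, show (2 * c + 1) / 2 = c by omega, show 2 * c / 2 = c by omega]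
    simp; omega

/-- Removing an element lowers the code, so in a table filled by increasing codes the entries needed
for `S` are already there. -/
theorem bitSet_sub_two_pow {k S j : ℕ} (hj : j ∈ bitSet k S) :
    bitSet k (S - 2 ^ j) = (bitSet k S).erase j := by
  have h := (Finset.mem_filter.1 hj).2
  ext l
  simp only [bitSet, Finset.mem_filter, testBit_sub_two_pow h, Finset.mem_erase]
  simp
  tauto

theorem mem_bitSet_iff {k S j : ℕ} (hj : j < k) : j ∈ bitSet k S ↔ S / 2 ^ j % 2 = 1 := by
  simp [bitSet, hj, Nat.testBit_eq_decide_div_mod_eq]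

theorem two_pow_le_of_mem_bitSet {k S j : ℕ} (hj : j ∈ bitSet k S) : 2 ^ j ≤ S :=
  Nat.ge_two_pow_of_testBit (Finset.mem_filter.1 hj).2

theorem card_bitSet_inter_range_succ {k S q : ℕ} :
    (bitSet k S ∩ Finset.range (q + 1)).card =
      (bitSet k S ∩ Finset.range q).card + if q ∈ bitSet k S then 1 else 0 := by
  rw [Finset.range_add_one]
  split_ifs with h
  · rw [Finset.inter_insert_of_mem h, Finset.card_insert_of_notMem (by simp)]
  · rw [Finset.inter_insert_of_notMem h, add_zero]

end Bits

/-! ### The program that fills the table of walk sums -/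

namespace LogRAM

/-- The data of the computation of a sum over walks: `n` labels, `k` steps, states below `Q`,
transitions `T` written from address `tb` on, random numbers below `X` from address `xb` on, an
initial state, and the table of the computed numbers from address `gb` on; `M` is the memory below
`lim`. -/
structure Layout where
  (n k Q tb xb lim gb start X : ℕ)
  T : List (ℕ × ℕ × ℕ)
  M : ℕ → ℕ

namespace Layout

variable (D : Layout)

/-- The weights of the labels at the different steps. -/
def y (i v : ℕ) : ℕ := D.M (D.xb + (D.k + i) * D.n + v)

/-- The coordinates of the vectors of the labels. -/
def z (j v : ℕ) : ℕ := D.M (D.xb + j * D.n + v)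

/-- The table entry for the coordinates coded by `S` and the final state `t`. -/
def entry (S t : ℕ) : ℕ × ℕ :=
  walkPair D.k D.T D.y D.z D.start (bitSet D.k S).card t (bitSet D.k S)

/-- The address of a table entry. -/
def addr (S t : ℕ) : ℕ := D.gb + 2 * (S * D.Q + t)

/-- The contribution of the last transition `τ` to a table entry, after `q` steps of the
computation. -/
def acc (S : ℕ) (τ : ℕ × ℕ × ℕ) (q : ℕ) : ℕ × ℕ :=
  pairMul (fun j => D.z j τ.2.1)
    (walkPair D.k D.T D.y D.z D.start ((bitSet D.k S).card - 1) τ.1) (bitSet D.k S) q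

/-- The contribution of the last transition `τ` to a table entry. -/
def term (S t : ℕ) (τ : ℕ × ℕ × ℕ) : ℕ × ℕ :=
  if τ.2.2 = t then D.y (bitSet D.k S).card τ.2.1 • D.acc S τ D.k else 0

/-- The equation `tb_eq` reflects that there are as many transitions as words of input, and that the
transitions are written directly after the input. One register thus serves both as the address of
the transitions and as their number. The last bounds make all addresses and all table entries fit in
`B` bits. -/
structure Valid (B : ℕ) : Prop where
  lt_of_mem : ∀ τ ∈ D.T, τ.1 < D.Q ∧ τ.2.1 < D.n ∧ τ.2.2 < D.Q
  start_lt : D.start < D.Q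
  tb_eq : D.tb = D.T.length
  tb_le : D.tb + 3 * D.T.length ≤ D.lim
  xb_le : D.xb + (2 * D.k + 1) * D.n ≤ D.lim
  lim_le : D.lim ≤ D.gb
  pos : 0 < D.X
  le_X : ∀ q < (2 * D.k + 1) * D.n, D.M (D.xb + q) ≤ D.X
  table_lt : D.gb + 2 * (2 ^ D.k * D.Q) < 2 ^ B
  growth_lt : walkGrowth D.k D.X D.T.length ^ D.k < 2 ^ B
  read : ∀ q (h : q < D.T.length), D.M (D.tb + 3 * q) = D.T[q].1 ∧
    D.M (D.tb + 3 * q + 1) = D.T[q].2.1 ∧ D.M (D.tb + 3 * q + 2) = D.T[q].2.2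

/-- The registers below `25` and the memory below `D.lim` hold the given data. -/
structure Holds (s : State) : Prop where
  r0 : s.reg 0 = D.n
  r2 : s.reg 2 = D.k
  r3 : s.reg 3 = 1
  r4 : s.reg 4 = 2
  r6 : s.reg 6 = D.Q
  r7 : s.reg 7 = 2 ^ D.k
  r8 : s.reg 8 = D.gb
  r9 : s.reg 9 = 0
  r11 : s.reg 11 = D.tb
  r18 : s.reg 18 = D.xb
  r23 : s.reg 23 = D.start
  low : ∀ a < D.lim, s.mem a = D.M a

variable {D}

theorem Holds.congr {s s' : State} (h : D.Holds s) (hr : ∀ i < 25, s'.reg i = s.reg i)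
    (hm : ∀ a < D.lim, s'.mem a = s.mem a) : D.Holds s' :=
  have H : ∀ i < 25, ∀ x, s.reg i = x → s'.reg i = x := fun i hi x hx => (hr i hi).trans hx
  ⟨H 0 (by norm_num) _ h.r0, H 2 (by norm_num) _ h.r2, H 3 (by norm_num) _ h.r3,
    H 4 (by norm_num) _ h.r4, H 6 (by norm_num) _ h.r6, H 7 (by norm_num) _ h.r7,
    H 8 (by norm_num) _ h.r8, H 9 (by norm_num) _ h.r9, H 11 (by norm_num) _ h.r11,
    H 18 (by norm_num) _ h.r18, H 23 (by norm_num) _ h.r23,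
    fun a ha => (hm a ha).trans (h.low a ha)⟩

/-- The table entries with first index below `S` have been computed. -/
def Table (D : Layout) (S : ℕ) (s : State) : Prop :=
  ∀ S' < S, ∀ t < D.Q, s.mem (D.addr S' t) = (D.entry S' t).1 ∧
    s.mem (D.addr S' t + 1) = (D.entry S' t).2

theorem index_lt {S t : ℕ} (hS : S < 2 ^ D.k) (ht : t < D.Q) : S * D.Q + t < 2 ^ D.k * D.Q := by
  calc S * D.Q + t < (S + 1) * D.Q := by rw [add_mul, one_mul]; omega
    _ ≤ _ := Nat.mul_le_mul_right _ hS

/-- For a nonempty set the number `|S|` of steps is a successor, and the recursion for walk sums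
applies. -/
theorem entry_succ {S : ℕ} (h : 0 < S) (hS : S < 2 ^ D.k) (t : ℕ) :
    D.entry S t = (D.T.map (D.term S t)).sum := by
  obtain ⟨c, hc⟩ := Nat.exists_eq_succ_of_ne_zero (card_bitSet_pos h hS).ne'
  rw [entry, hc, walkPair]
  congr 1
  refine List.map_congr_left fun τ _ => ?_
  simp only [term, acc, hc, Nat.succ_eq_add_one, Nat.add_sub_cancel]

/-- The walks that `τ` prolongs have `|S| - 1` steps, which is the cardinality of `S` without `q`.
The factor needed is therefore a table entry. -/
theorem acc_succ {S : ℕ} (τ : ℕ × ℕ × ℕ) (q : ℕ) :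
    D.acc S τ (q + 1) = if q ∈ bitSet D.k S then
      ((D.acc S τ q).2 + (D.entry (S - 2 ^ q) τ.1).1 * D.z q τ.2.1,
        (D.acc S τ q).1 + (D.entry (S - 2 ^ q) τ.1).2 * D.z q τ.2.1)
    else D.acc S τ q := by
  rw [acc, pairMul]
  split_ifs with hq
  · rw [entry, bitSet_sub_two_pow hq, Finset.card_erase_of_mem hq]
    rfl
  · rfl

section Bounds

variable {B : ℕ} (hD : D.Valid B)
include hD

theorem Valid.z_le {τ : ℕ × ℕ × ℕ} (hτ : τ ∈ D.T) {j : ℕ} (hj : j < D.k) : D.z j τ.2.1 ≤ D.X := by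
  have h₁ := (hD.lt_of_mem τ hτ).2.1
  have h₂ : j * D.n + D.n ≤ (2 * D.k + 1) * D.n := by
    rw [← Nat.succ_mul]; exact Nat.mul_le_mul_right _ (by omega)
  rw [z, add_assoc]
  exact hD.le_X _ (by omega)

theorem Valid.y_le {τ : ℕ × ℕ × ℕ} (hτ : τ ∈ D.T) {i : ℕ} (hi : i ≤ D.k) :
    D.y i τ.2.1 ≤ D.X := by
  have h₁ := (hD.lt_of_mem τ hτ).2.1
  have h₂ : (D.k + i) * D.n + D.n ≤ (2 * D.k + 1) * D.n := by
    rw [← Nat.succ_mul]; exact Nat.mul_le_mul_right _ (by omega)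
  rw [y, add_assoc]
  exact hD.le_X _ (by omega)

theorem Valid.walkPair_le (i t : ℕ) (hi : i ≤ D.k) (S : Finset ℕ) :
    (walkPair D.k D.T D.y D.z D.start i t S).1 + (walkPair D.k D.T D.y D.z D.start i t S).2 ≤
      walkGrowth D.k D.X D.T.length ^ i :=
  _root_.walkPair_le (fun _ hj _ hτ => hD.z_le hτ hj) (fun _ hi _ hτ => hD.y_le hτ hi) _ _ _ hi _

/-- The summand `1` in `walkGrowth` keeps the base positive, so that its powers increase with the
exponent. -/
theorem Valid.growth_pow_lt {i : ℕ} (hi : i ≤ D.k) :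
    walkGrowth D.k D.X D.T.length ^ i < 2 ^ B :=
  (Nat.pow_le_pow_right (by rw [walkGrowth]; omega) hi).trans_lt hD.growth_lt

theorem Valid.sum_term_lt {S t q : ℕ} (h : 0 < S) (hS : S < 2 ^ D.k) (hq : q ≤ D.T.length) :
    ((D.T.take q).map (D.term S t)).sum.1 + ((D.T.take q).map (D.term S t)).sum.2 < 2 ^ B := by
  obtain ⟨c, hc⟩ := Nat.exists_eq_succ_of_ne_zero (card_bitSet_pos h hS).ne'
  have hck := card_bitSet_le D.k S
  have h₁ := list_sum_pair_le (L := (D.T.take q).map (D.term S t))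
    (D := walkGrowth D.k D.X D.T.length ^ c * (D.k * (D.X * D.X))) (by
      intro p hp
      obtain ⟨τ, hτ, rfl⟩ := List.mem_map.1 hp
      have hτ := List.mem_of_mem_take hτ
      rw [term, acc, hc]
      exact walkPair_term_le (fun j hj => hD.z_le hτ hj) (hD.y_le hτ (by omega))
        (fun j _ => hD.walkPair_le _ _ (by omega) _) t)
  refine h₁.trans_lt (lt_of_le_of_lt ?_ (hD.growth_pow_lt (i := c + 1) (by omega)))
  rw [List.length_map, List.length_take, min_eq_left hq, pow_succ, mul_left_comm]
  refine Nat.mul_le_mul_left _ ?_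
  have := Nat.mul_le_mul_right (D.k * (D.X * D.X)) hq
  rw [walkGrowth]; omega

theorem Valid.acc_lt {S q : ℕ} {τ : ℕ × ℕ × ℕ} (h : 0 < S) (hS : S < 2 ^ D.k) (hτ : τ ∈ D.T)
    (hq : q ≤ D.k) : (D.acc S τ q).1 + (D.acc S τ q).2 < 2 ^ B := by
  obtain ⟨c, hc⟩ := Nat.exists_eq_succ_of_ne_zero (card_bitSet_pos h hS).ne'
  have hck := card_bitSet_le D.k S
  have hX := hD.pos
  have h₁ := pairMul_sum_le (q := q) (S := bitSet D.k S)
    (z := fun j => D.z j τ.2.1) (X := D.X)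
    (f := walkPair D.k D.T D.y D.z D.start ((bitSet D.k S).card - 1) τ.1)
    (F := walkGrowth D.k D.X D.T.length ^ c)
    (fun j hj => hD.z_le hτ (by omega)) fun j _ => by
      rw [hc]; exact hD.walkPair_le _ _ (by omega) _
  refine h₁.trans_lt (lt_of_le_of_lt ?_ (hD.growth_pow_lt (i := c + 1) (by omega)))
  rw [pow_succ, mul_left_comm]
  refine Nat.mul_le_mul_left _ ?_
  have h₂ : 1 ≤ D.T.length := List.length_pos_of_mem hτ
  calc q * D.X ≤ D.k * (D.X * D.X) := Nat.mul_le_mul hq (Nat.le_mul_of_pos_left _ hX)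
    _ ≤ D.T.length * (D.k * (D.X * D.X)) := Nat.le_mul_of_pos_left _ h₂
    _ ≤ _ := Nat.le_succ _

end Bounds

end Layout

/-- One step of the multiplication by a vector: it treats one coordinate. -/
def coordBody : Prog :=
  .seq (block [.div 40 37 4, .add 41 40 40, .sub 41 37 41, .add 37 40 9])
    (.seq (.ite 41
      (block [.add 36 36 0, .sub 42 26 38, .mul 42 42 6, .add 42 42 30, .add 42 42 42,
        .add 42 42 8, .load 43 42, .add 42 42 3, .load 44 42, .load 45 35, .mul 43 43 45,
        .mul 44 44 45, .add 46 33 9, .add 33 34 43, .add 34 46 44])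
      (block []))
      (block [.add 35 35 0, .add 38 38 38, .sub 39 39 3]))

/-- The state of the multiplication by a vector after `q` coordinates. -/
structure CoordInv (D : Layout) (S : ℕ) (τ : ℕ × ℕ × ℕ) (s₀ : State) (q : ℕ) (s : State) :
    Prop where
  r33 : s.reg 33 = (D.acc S τ q).1
  r34 : s.reg 34 = (D.acc S τ q).2
  r35 : s.reg 35 = D.xb + q * D.n + τ.2.1
  r36 : s.reg 36 = D.xb + (D.k + (bitSet D.k S ∩ Finset.range q).card) * D.n + τ.2.1
  r37 : s.reg 37 = S / 2 ^ q
  r38 : s.reg 38 = 2 ^ q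
  r39 : s.reg 39 = D.k - q
  frame : ∀ i < 33, s.reg i = s₀.reg i
  mem : s.mem = s₀.mem

/-- Register `37` yields the binary digits of `S` one by one. Register `36` advances by `n` only at
elements of `S`, so at the end it points to the weights of step `|S|` without a separate count; the
weights start at block `k` of the random numbers, whose step `0` is not used. -/
theorem coordBody_within {D : Layout} {B S q : ℕ} {τ : ℕ × ℕ × ℕ} {s₀ s : State} (hD : D.Valid B)
    (h₀ : D.Holds s₀) (hS₀ : 0 < S) (hS : S < 2 ^ D.k) (hτ : τ ∈ D.T) (h26 : s₀.reg 26 = S)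
    (h30 : s₀.reg 30 = τ.1) (htab : D.Table S s₀) (hq : q < D.k) (hs : CoordInv D S τ s₀ q s) :
    Within B coordBody 26 (CoordInv D S τ s₀ (q + 1)) s := by
  have hQ := (hD.lt_of_mem τ hτ)
  have hB := hD.table_lt
  have hlim := hD.lim_le
  have e0 : s.reg 0 = D.n := (hs.frame 0 (by norm_num)).trans h₀.r0
  have e3 : s.reg 3 = 1 := (hs.frame 3 (by norm_num)).trans h₀.r3
  have e4 : s.reg 4 = 2 := (hs.frame 4 (by norm_num)).trans h₀.r4
  have e6 : s.reg 6 = D.Q := (hs.frame 6 (by norm_num)).trans h₀.r6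
  have e8 : s.reg 8 = D.gb := (hs.frame 8 (by norm_num)).trans h₀.r8
  have e9 : s.reg 9 = 0 := (hs.frame 9 (by norm_num)).trans h₀.r9
  have e26 : s.reg 26 = S := (hs.frame 26 (by norm_num)).trans h26
  have e30 : s.reg 30 = τ.1 := (hs.frame 30 (by norm_num)).trans h30
  have hSB : 2 ^ D.k ≤ 2 ^ D.k * D.Q := Nat.le_mul_of_pos_right _ (by omega)
  have hdiv : S / 2 ^ q ≤ S := Nat.div_le_self _ _
  have hhalf : S / 2 ^ q / 2 = S / 2 ^ (q + 1) := by
    rw [Nat.div_div_eq_div_mul, pow_succ]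
  have hcard := card_bitSet_inter_range_succ (k := D.k) (S := S) (q := q)
  have hcardle : (bitSet D.k S ∩ Finset.range (q + 1)).card ≤ D.k :=
    (Finset.card_le_card Finset.inter_subset_left).trans (card_bitSet_le _ _)
  have hxb := hD.xb_le
  have hq2 : 2 ^ (q + 1) ≤ 2 ^ D.k := Nat.pow_le_pow_right (by norm_num) hq
  have hpow : 2 ^ (q + 1) = 2 ^ q + 2 ^ q := by rw [pow_succ]; omega
  have hqn : (q + 1) * D.n ≤ (2 * D.k) * D.n := Nat.mul_le_mul_right _ (by omega)
  have hqn' : (q + 1) * D.n = q * D.n + D.n := by ring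
  have hkn' : (2 * D.k + 1) * D.n = 2 * D.k * D.n + D.n := by ring
  have haccq := hD.acc_lt hS₀ hS hτ (q := q + 1) hq
  -- The common end of both branches.
  have hlast : ∀ s' : State, s'.reg 33 = (D.acc S τ (q + 1)).1 →
      s'.reg 34 = (D.acc S τ (q + 1)).2 →
      s'.reg 36 = D.xb + (D.k + (bitSet D.k S ∩ Finset.range (q + 1)).card) * D.n + τ.2.1 →
      s'.reg 37 = S / 2 ^ (q + 1) → s'.reg 35 = s.reg 35 → s'.reg 38 = s.reg 38 →
      s'.reg 39 = s.reg 39 → (∀ i < 33, s'.reg i = s.reg i) → s'.mem = s.mem →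
      Within B (block [.add 35 35 0, .add 38 38 38, .sub 39 39 3]) 4
        (CoordInv D S τ s₀ (q + 1)) s' := by
    intro s' f33 f34 f36 f37 f35 f38 f39 ff fm
    have f0 := (ff 0 (by norm_num)).trans e0
    have f3 := (ff 3 (by norm_num)).trans e3
    refine (Within.block ?_ ?_).mono (by simp) fun _ h => h
    · simp [f35, hs.r35, f0, f38, hs.r38]
      omega
    · constructor
      · simpa using f33
      · simpa using f34
      · simp [f35, hs.r35, f0]; rw [hqn']; omega
      · simpa using f36
      · simpa using f37
      · simp [f38, hs.r38]; omega
      · simp [f39, hs.r39, f3]; omega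
      · intro i hi
        simp (disch := omega) [Function.update_of_ne, ff i hi, hs.frame i hi]
      · simpa using fm.trans hs.mem
  refine (Within.seq' (N := 5) (M := 21) (R := fun s' => s'.reg 41 = S / 2 ^ q % 2 ∧
    s'.reg 37 = S / 2 ^ (q + 1) ∧ s'.mem = s.mem ∧
    ∀ i, i ≠ 37 → i ≠ 40 → i ≠ 41 → s'.reg i = s.reg i) ?_ ?_).mono le_rfl fun _ h => h
  · refine Within.block ?_ ?_
    · simp [hs.r37, e4, e9]
      omega
    · refine ⟨?_, ?_, ?_, ?_⟩
      · simp [hs.r37, e4]; omega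
      · simp [hs.r37, e4, e9, hhalf]
      · simp
      · intro i h1 h2 h3; simp [h1, h2, h3]
  rintro s₁ ⟨g41, g37, gm, gf⟩
  have g0 : s₁.reg 0 = D.n := (gf 0 (by norm_num) (by norm_num) (by norm_num)).trans e0
  have g3 : s₁.reg 3 = 1 := (gf 3 (by norm_num) (by norm_num) (by norm_num)).trans e3
  have g6 : s₁.reg 6 = D.Q := (gf 6 (by norm_num) (by norm_num) (by norm_num)).trans e6
  have g8 : s₁.reg 8 = D.gb := (gf 8 (by norm_num) (by norm_num) (by norm_num)).trans e8
  have g9 : s₁.reg 9 = 0 := (gf 9 (by norm_num) (by norm_num) (by norm_num)).trans e9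
  have g26 : s₁.reg 26 = S := (gf 26 (by norm_num) (by norm_num) (by norm_num)).trans e26
  have g30 : s₁.reg 30 = τ.1 := (gf 30 (by norm_num) (by norm_num) (by norm_num)).trans e30
  have g33 := (gf 33 (by norm_num) (by norm_num) (by norm_num)).trans hs.r33
  have g34 := (gf 34 (by norm_num) (by norm_num) (by norm_num)).trans hs.r34
  have g35 := (gf 35 (by norm_num) (by norm_num) (by norm_num)).trans hs.r35
  have g36 := (gf 36 (by norm_num) (by norm_num) (by norm_num)).trans hs.r36
  have g38 := (gf 38 (by norm_num) (by norm_num) (by norm_num)).trans hs.r38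
  refine Within.seq (N := 17) (M := 4) (Within.ite (N := 16) (fun hne => ?_) (fun heq => ?_))
  · have hmem : q ∈ bitSet D.k S := (mem_bitSet_iff hq).2 (by omega)
    have hle := two_pow_le_of_mem_bitSet hmem
    have hpos : 0 < 2 ^ q := by positivity
    rw [if_pos hmem] at hcard
    rw [D.acc_succ, if_pos hmem] at haccq
    simp only at haccq
    have hidx := Layout.index_lt (D := D) (S := S - 2 ^ q) (t := τ.1) (by omega) hQ.1
    have hcn : (D.k + (bitSet D.k S ∩ Finset.range (q + 1)).card) * D.n ≤ 2 * D.k * D.n :=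
      Nat.mul_le_mul_right _ (by omega)
    have hcn' : (D.k + (bitSet D.k S ∩ Finset.range (q + 1)).card) * D.n =
      (D.k + (bitSet D.k S ∩ Finset.range q).card) * D.n + D.n := by rw [hcard]; ring
    have hzm : s.mem (D.xb + q * D.n + τ.2.1) = D.z q τ.2.1 := by
      rw [hs.mem, h₀.low _ (by omega)]; rfl
    have ht := htab (S - 2 ^ q) (by omega) τ.1 hQ.1
    rw [← hs.mem] at ht
    have ha : (S - 2 ^ q) * D.Q + τ.1 + ((S - 2 ^ q) * D.Q + τ.1) + D.gb =
      D.addr (S - 2 ^ q) τ.1 := by rw [Layout.addr]; omega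
    have hexp : D.addr (S - 2 ^ q) τ.1 = D.gb + 2 * ((S - 2 ^ q) * D.Q + τ.1) := rfl
    refine (Within.block ?_ (hlast _ ?_ ?_ ?_ ?_ ?_ ?_ ?_ ?_ ?_)).mono (by simp) fun _ h => h
    · simp [g0, g3, g6, g8, g9, g26, g30, g33, g34, g35, g36, g38, gm, ha, ht.1, ht.2, hzm]
      rw [hexp]
      omega
    · simp [g6, g8, g9, g26, g30, g33, g34, g35, g36, g38, gm, ha, ht.1, hzm,
        D.acc_succ, hmem]
    · simp [g3, g6, g8, g9, g26, g30, g33, g34, g35, g36, g38, gm, ha, ht.1, ht.2, hzm,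
        D.acc_succ, hmem]
    · simp [g36, g0]; omega
    · simpa using g37
    · simpa using gf 35 (by norm_num) (by norm_num) (by norm_num)
    · simpa using gf 38 (by norm_num) (by norm_num) (by norm_num)
    · simpa using gf 39 (by norm_num) (by norm_num) (by norm_num)
    · intro i hi
      simp (disch := omega) [Function.update_of_ne, gf i]
    · simpa using gm
  · have hmem : q ∉ bitSet D.k S := fun h => by have := (mem_bitSet_iff hq).1 h; omega
    rw [if_neg hmem] at hcard
    refine (Within.block ?_ (hlast _ ?_ ?_ ?_ ?_ ?_ ?_ ?_ ?_ ?_)).mono (by simp) fun _ h => h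
    · simp
    · simp [g33, D.acc_succ, hmem]
    · simp [g34, D.acc_succ, hmem]
    · simp [g36, hcard]
    · simpa using g37
    · simpa using gf 35 (by norm_num) (by norm_num) (by norm_num)
    · simpa using gf 38 (by norm_num) (by norm_num) (by norm_num)
    · simpa using gf 39 (by norm_num) (by norm_num) (by norm_num)
    · intro i hi
      simp (disch := omega) [gf i]
    · simpa using gm


theorem Layout.Valid.bits_ne_zero {D : Layout} {B : ℕ} (hD : D.Valid B) : B ≠ 0 := by
  rintro rfl
  have h₁ := hD.table_lt
  have h₂ := hD.start_lt
  have : 0 < 2 ^ D.k * D.Q := Nat.mul_pos (by positivity) (by omega)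
  omega

/-- The treatment of one transition: its contribution is computed and added to the table. -/
def transBody : Prog :=
  .seq (block [.load 30 28, .add 28 28 3, .load 31 28, .add 28 28 3, .load 32 28, .add 28 28 3,
      .const 33 0, .const 34 0, .add 35 18 31, .mul 36 2 0, .add 36 36 35, .add 37 26 9,
      .const 38 1, .add 39 2 9])
    (.seq (.loop 39 coordBody)
      (block [.load 45 36, .mul 33 33 45, .mul 34 34 45, .mul 42 26 6, .add 42 42 32,
        .add 42 42 42, .add 42 42 8, .load 43 42, .add 43 43 33, .store 42 43, .add 42 42 3,
        .load 44 42, .add 44 44 34, .store 42 44, .sub 29 29 3]))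

/-- The part of a table entry that comes from the first `q` transitions. -/
def Layout.partialEntry (D : Layout) (S t q : ℕ) : ℕ × ℕ :=
  ((D.T.take q).map (D.term S t)).sum

theorem Layout.partialEntry_succ (D : Layout) (S t : ℕ) {q : ℕ} (hq : q < D.T.length) :
    D.partialEntry S t (q + 1) = D.partialEntry S t q + D.term S t D.T[q] := by
  rw [partialEntry, partialEntry, List.take_succ_eq_append_getElem hq, List.map_append,
    List.sum_append]
  simp

/-- The state of the computation of the table entries with first index `S` after `q`
transitions. -/
structure TransInv (D : Layout) (S : ℕ) (s₀ : State) (q : ℕ) (s : State) : Prop where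
  r28 : s.reg 28 = D.tb + 3 * q
  r29 : s.reg 29 = D.T.length - q
  frame : ∀ i < 28, s.reg i = s₀.reg i
  low : ∀ a < D.addr S 0, s.mem a = s₀.mem a
  cur : ∀ t < D.Q, s.mem (D.addr S t) = (D.partialEntry S t q).1 ∧
    s.mem (D.addr S t + 1) = (D.partialEntry S t q).2
  high : ∀ a, D.addr (S + 1) 0 ≤ a → s.mem a = 0

theorem Layout.Table.congr {D : Layout} {S : ℕ} {s s' : State} (h : D.Table S s)
    (hm : ∀ a < D.addr S 0, s'.mem a = s.mem a) : D.Table S s' := by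
  intro S' hS' t ht
  have h₁ : S' * D.Q + t < S * D.Q := by
    calc S' * D.Q + t < (S' + 1) * D.Q := by rw [add_mul, one_mul]; omega
      _ ≤ _ := Nat.mul_le_mul_right _ hS'
  rw [hm _ (by simp only [Layout.addr]; omega), hm _ (by simp only [Layout.addr]; omega)]
  exact h S' hS' t ht

/-- The entries that are read belong to rows below `S`, while the only entry that changes is the one
of row `S` for the target of the transition. -/
theorem transBody_within {D : Layout} {B S q : ℕ} {s₀ s : State} (hD : D.Valid B)
    (h₀ : D.Holds s₀) (hS₀ : 0 < S) (hS : S < 2 ^ D.k) (h26 : s₀.reg 26 = S)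
    (htab : D.Table S s₀) (hq : q < D.T.length) (hs : TransInv D S s₀ q s) :
    Within B transBody (27 * D.k + 32) (TransInv D S s₀ (q + 1)) s := by
  have hQ := hD.lt_of_mem _ (List.getElem_mem hq)
  have hB := hD.table_lt
  have hlim := hD.lim_le
  have hxb := hD.xb_le
  have htb := hD.tb_le
  obtain ⟨m1, m2, m3⟩ := hD.read q hq
  have hD0 : D.Holds s := h₀.congr (fun i hi => hs.frame i (by omega))
    (fun a ha => hs.low a (by rw [Layout.addr]; omega))
  have e26 : s.reg 26 = S := (hs.frame 26 (by norm_num)).trans h26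
  have htab' : D.Table S s := htab.congr hs.low
  have hsum₁ := hD.sum_term_lt (t := D.T[q].2.2) hS₀ hS (q := q + 1) hq
  have hSB : 2 ^ D.k ≤ 2 ^ D.k * D.Q := Nat.le_mul_of_pos_right _ (by omega)
  have hpos : 0 < 2 ^ D.k := by positivity
  have hkn : (2 * D.k + 1) * D.n = D.k * D.n + D.k * D.n + D.n := by ring
  have hlow : ∀ a < D.lim, s.mem a = D.M a := hD0.low
  have hkle : D.k < 2 ^ D.k := Nat.lt_two_pow_self
  have l1 : s.mem (D.tb + 3 * q) = D.T[q].1 := by rw [hlow _ (by omega), m1]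
  have l2 : s.mem (D.tb + 3 * q + 1) = D.T[q].2.1 := by rw [hlow _ (by omega), m2]
  have l3 : s.mem (D.tb + 3 * q + 1 + 1) = D.T[q].2.2 := by rw [hlow _ (by omega), ← m3]
  refine (Within.seq' (N := 15) (M := 27 * D.k + 17)
    (R := fun s' => s'.reg 28 = D.tb + 3 * (q + 1) ∧ s'.reg 32 = D.T[q].2.2 ∧
    s'.reg 30 = D.T[q].1 ∧ s'.mem = s.mem ∧
    (∀ i, i < 28 ∨ i = 29 → s'.reg i = s.reg i) ∧ CoordInv D S D.T[q] s' 0 s') ?_ ?_).mono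
      (by omega) fun _ h => h
  · refine Within.block ?_ ⟨?_, ?_, ?_, ?_, ?_, ?_, ?_, ?_, ?_, ?_, ?_, ?_, ?_, ?_⟩
    · simp [hs.r28, hD0.r0, hD0.r2, hD0.r3, hD0.r9, hD0.r18, l2, e26, hD.bits_ne_zero]
      omega
    · simp [hs.r28, hD0.r3]; omega
    · simp [hs.r28, hD0.r3, l3]
    · simp [hs.r28, l1]
    · simp
    · intro i hi
      simp (disch := omega) [Function.update_of_ne]
    · simp [Layout.acc, pairMul]
    · simp [Layout.acc, pairMul]
    · simp [hs.r28, hD0.r3, hD0.r18, l2]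
    · simp [hs.r28, hD0.r0, hD0.r2, hD0.r3, hD0.r18, l2]; omega
    · simp [e26, hD0.r9]
    · simp
    · simp [hD0.r2, hD0.r9]
    · intro i _; rfl
    · rfl
  rintro s₁ ⟨g28, g32, g30, gm, gf, ginv⟩
  have hD1 : D.Holds s₁ := hD0.congr (fun i hi => gf i (by omega)) fun a _ => by rw [gm]
  have g26 : s₁.reg 26 = S := (gf 26 (by norm_num)).trans e26
  have hloop := Within.loop (B := B) (p := coordBody) (N := 26) (c := 39) (n := D.k)
    (CoordInv D S D.T[q] s₁) ginv (fun i s _ h => h.r39)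
    (fun i s hi h => coordBody_within hD hD1 hS₀ hS (List.getElem_mem hq) g26 g30
      (htab'.congr fun a _ => by rw [gm]) hi h)
  refine (Within.seq' hloop (M := 16) ?_).mono (by omega) fun _ h => h
  intro s₂ hs₂
  have hD2 : D.Holds s₂ := hD1.congr (fun i hi => hs₂.frame i (by omega)) fun a _ => by
    rw [hs₂.mem]
  have f26 := (hs₂.frame 26 (by norm_num)).trans g26
  have f28 := (hs₂.frame 28 (by norm_num)).trans g28
  have f29 := ((hs₂.frame 29 (by norm_num)).trans (gf 29 (by norm_num))).trans hs.r29
  have f32 := (hs₂.frame 32 (by norm_num)).trans g32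
  have fm : s₂.mem = s.mem := hs₂.mem.trans gm
  have f36 := hs₂.r36
  rw [Finset.inter_eq_left.2 (bitSet_subset _ _)] at f36
  have hcn : (D.k + (bitSet D.k S).card) * D.n ≤ D.k * D.n + D.k * D.n := by
    rw [← add_mul]; exact Nat.mul_le_mul_right _ (by have := card_bitSet_le D.k S; omega)
  have l36 : s.mem (D.xb + (D.k + (bitSet D.k S).card) * D.n + D.T[q].2.1) =
      D.y (bitSet D.k S).card D.T[q].2.1 := by rw [hlow _ (by omega)]; rfl
  have hidx := Layout.index_lt (D := D) hS hQ.2.2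
  have ha : S * D.Q + D.T[q].2.2 + (S * D.Q + D.T[q].2.2) + D.gb = D.addr S D.T[q].2.2 := by
    rw [Layout.addr]; omega
  have hexp : D.addr S D.T[q].2.2 = D.gb + 2 * (S * D.Q + D.T[q].2.2) := rfl
  obtain ⟨c1, c2⟩ := hs.cur _ hQ.2.2
  have hterm : D.term S D.T[q].2.2 D.T[q] =
      ((D.acc S D.T[q] D.k).1 * D.y (bitSet D.k S).card D.T[q].2.1,
      (D.acc S D.T[q] D.k).2 * D.y (bitSet D.k S).card D.T[q].2.1) := by
    rw [Layout.term, if_pos rfl]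
    ext <;> simp [mul_comm]
  -- The bound for the sum that includes the new term shows that the products and the two additions
  -- fit.
  change (D.partialEntry S _ (q + 1)).1 + (D.partialEntry S _ (q + 1)).2 < _ at hsum₁
  rw [D.partialEntry_succ S _ hq, hterm] at hsum₁
  simp only [Prod.fst_add, Prod.snd_add] at hsum₁
  have hexp' : D.addr (S + 1) 0 = D.gb + 2 * (S * D.Q + D.Q) := by
    rw [Layout.addr]; ring
  refine Within.block ?_ ⟨?_, ?_, ?_, ?_, ?_, ?_⟩
  · simp [f36, hs₂.r33, hs₂.r34, fm, l36, f26, f32, hD2.r3, hD2.r6, hD2.r8, ha, c1, c2]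
    rw [hexp]
    omega
  · simp [f28]
  · simp [f29, hD2.r3]; omega
  · intro i hi
    simp (disch := omega) [Function.update_of_ne, hs₂.frame i, gf i, hs.frame i]
  · intro a h
    have hexp0 : D.addr S 0 = D.gb + 2 * (S * D.Q) := rfl
    have h1 : a ≠ D.addr S D.T[q].2.2 := by omega
    have h2 : a ≠ D.addr S D.T[q].2.2 + 1 := by omega
    simp [f26, f32, hD2.r3, hD2.r6, hD2.r8, ha, h1, h2, fm, hs.low a h]
  · intro t ht
    rw [D.partialEntry_succ S t hq]
    obtain ⟨d1, d2⟩ := hs.cur t ht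
    by_cases htq : t = D.T[q].2.2
    · rw [← htq] at c1 c2 ha hterm f32
      rw [hterm]
      simp [f36, hs₂.r33, hs₂.r34, fm, l36, f26, f32, hD2.r3, hD2.r6, hD2.r8, ha, c1, c2]
    · have hterm0 : D.term S t D.T[q] = 0 := by rw [Layout.term, if_neg (Ne.symm htq)]
      have hexpt : D.addr S t = D.gb + 2 * (S * D.Q + t) := rfl
      have h1 : D.addr S t ≠ D.addr S D.T[q].2.2 := by omega
      have h2 : D.addr S t ≠ D.addr S D.T[q].2.2 + 1 := by omega
      have h3 : D.addr S t + 1 ≠ D.addr S D.T[q].2.2 := by omega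
      rw [hterm0]
      simp [f26, f32, hD2.r3, hD2.r6, hD2.r8, ha, h1, h2, h3, fm, d1, d2]
  · intro a h
    have h1 : a ≠ D.addr S D.T[q].2.2 := by omega
    have h2 : a ≠ D.addr S D.T[q].2.2 + 1 := by omega
    simp [f26, f32, hD2.r3, hD2.r6, hD2.r8, ha, h1, h2, fm, hs.high a h]

/-- The computation of the table entries with the next first index. -/
def tableBody : Prog :=
  .seq (block [.add 26 26 3, .add 28 11 9, .add 29 11 9])
    (.seq (.loop 29 transBody) (block [.sub 27 27 3]))

/-- The state of the computation of the table when the entries with first index at most `i` are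
there. -/
structure TableInv (D : Layout) (s₀ : State) (i : ℕ) (s : State) : Prop where
  r26 : s.reg 26 = i
  r27 : s.reg 27 = 2 ^ D.k - 1 - i
  frame : ∀ i < 25, s.reg i = s₀.reg i
  low : ∀ a < D.gb, s.mem a = s₀.mem a
  table : D.Table (i + 1) s
  high : ∀ a, D.addr (i + 1) 0 ≤ a → s.mem a = 0

/-- The row starts from memory that has never been written and is therefore zero. No initialisation
is needed, so the cost of a row depends on the number of transitions and not on the number `Q` of
states. -/
theorem tableBody_within {D : Layout} {B i : ℕ} {s₀ s : State} (hD : D.Valid B)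
    (h₀ : D.Holds s₀) (hi : i < 2 ^ D.k - 1) (hs : TableInv D s₀ i s) :
    Within B tableBody (D.T.length * (27 * D.k + 33) + 7) (TableInv D s₀ (i + 1)) s := by
  have hD0 : D.Holds s := h₀.congr hs.frame fun a ha => hs.low a (ha.trans_le hD.lim_le)
  have hB := hD.table_lt
  have hlim := hD.lim_le
  have htb := hD.tb_le
  have hSB : 2 ^ D.k ≤ 2 ^ D.k * D.Q := Nat.le_mul_of_pos_right _ (by have := hD.start_lt; omega)
  refine (Within.seq' (N := 4) (M := D.T.length * (27 * D.k + 32 + 1) + 3)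
    (R := fun s' => s'.reg 26 = i + 1 ∧ s'.reg 27 = 2 ^ D.k - 1 - i ∧ s'.mem = s.mem ∧
      (∀ i < 25, s'.reg i = s.reg i) ∧ TransInv D (i + 1) s' 0 s') ?_ ?_).mono
      (by rw [show 27 * D.k + 32 + 1 = 27 * D.k + 33 from rfl]; omega) fun _ h => h
  · refine Within.block ?_ ⟨?_, ?_, ?_, ?_, ?_, ?_, ?_, ?_, ?_, ?_⟩
    · simp [hs.r26, hD0.r3, hD0.r9, hD0.r11]
      omega
    · simp [hs.r26, hD0.r3]
    · simp [hs.r27]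
    · simp
    · intro j hj
      simp (disch := omega) [Function.update_of_ne]
    · simp [hD0.r9, hD0.r11]
    · simp [hD0.r9, hD0.r11, hD.tb_eq]
    · intro j _; rfl
    · intro a _; rfl
    · intro t ht
      have h1 : D.addr (i + 1) 0 ≤ D.addr (i + 1) t := by simp only [Layout.addr]; omega
      simp [Layout.partialEntry, hs.high _ h1, hs.high _ (Nat.le_succ_of_le h1)]
    · intro a ha
      have h1 : D.addr (i + 1) 0 ≤ D.addr (i + 1 + 1) 0 := by
        simp only [Layout.addr, add_mul]; omega
      simp [hs.high _ (h1.trans ha)]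
  rintro s₁ ⟨g26, g27, gm, gf, ginv⟩
  have hD1 : D.Holds s₁ := hD0.congr gf fun a _ => by rw [gm]
  have htab : D.Table (i + 1) s₁ := hs.table.congr fun a _ => by rw [gm]
  have hloop := Within.loop (B := B) (p := transBody) (N := 27 * D.k + 32) (c := 29)
    (n := D.T.length) (TransInv D (i + 1) s₁) ginv (fun i s _ h => h.r29)
    (fun q s hq h => transBody_within hD hD1 (by omega) (by omega) g26 htab hq h)
  refine (Within.seq' hloop (M := 2) ?_).mono (by omega) fun _ h => h
  intro s₂ hs₂
  have hlow : ∀ a < D.gb, s₂.mem a = s.mem a := fun a ha =>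
    (hs₂.low a (by rw [Layout.addr]; omega)).trans (by rw [gm])
  have f26 := (hs₂.frame 26 (by norm_num)).trans g26
  have f27 := (hs₂.frame 27 (by norm_num)).trans g27
  have f3 : s₂.reg 3 = 1 := ((hs₂.frame 3 (by norm_num)).trans (gf 3 (by norm_num))).trans hD0.r3
  refine Within.block (by simp) ⟨?_, ?_, ?_, ?_, ?_, ?_⟩
  · simpa using f26
  · simp [f27, f3]; omega
  · intro j hj
    simp (disch := omega) [Function.update_of_ne, hs₂.frame j, gf j, hs.frame j]
  · intro a ha
    simp [hlow a ha, hs.low a ha]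
  · intro S' hS' t ht
    rcases Nat.lt_succ_iff_lt_or_eq.1 hS' with h | rfl
    · exact (htab.congr hs₂.low) S' h t ht
    · rw [Layout.entry_succ (by omega) (by omega)]
      have := hs₂.cur t ht
      rwa [Layout.partialEntry, List.take_length] at this
  · exact hs₂.high

/-- The computation of the sums over the walks from the state in register `23`. -/
def walkTable : Prog :=
  .seq (block [.add 25 23 23, .add 25 25 8, .store 25 3, .const 26 0, .sub 27 7 3])
    (.loop 27 tableBody)

theorem Layout.entry_zero (D : Layout) (t : ℕ) :
    D.entry 0 t = if t = D.start then (1, 0) else 0 := by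
  simp [entry, bitSet_zero, walkPair]

/-- Row `0` is the sum over walks without steps: one store at the initial state suffices, because
the rest of the region is zero by `hz`. -/
theorem walkTable_within {D : Layout} {B : ℕ} {s : State} (hD : D.Valid B) (hs : D.Holds s)
    (hz : ∀ a, D.gb ≤ a → s.mem a = 0) :
    Within B walkTable (2 ^ D.k * (D.T.length * (27 * D.k + 33) + 8) + 7)
      (TableInv D s (2 ^ D.k - 1)) s := by
  have hB := hD.table_lt
  have hlim := hD.lim_le
  have hst := hD.start_lt
  have hSB : D.Q ≤ 2 ^ D.k * D.Q := Nat.le_mul_of_pos_left _ (by positivity)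
  have hSB' : 2 ^ D.k ≤ 2 ^ D.k * D.Q := Nat.le_mul_of_pos_right _ (by omega)
  have ha : D.start + D.start + D.gb = D.addr 0 D.start := by rw [Layout.addr]; omega
  have hexp : ∀ t, D.addr 0 t = D.gb + 2 * t := fun t => by rw [Layout.addr]; omega
  have hexp' : ∀ t, D.addr 1 t = D.gb + 2 * (D.Q + t) := fun t => by rw [Layout.addr]; omega
  refine (Within.seq' (N := 6) (M := (2 ^ D.k - 1) * (D.T.length * (27 * D.k + 33) + 7 + 1) + 1)
    (R := TableInv D s 0) ?_ ?_).mono ?_ fun _ h => h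
  · refine Within.block ?_ ⟨?_, ?_, ?_, ?_, ?_, ?_⟩
    · simp [hs.r23, hs.r8]; omega
    · simp
    · simp [hs.r7, hs.r3]
    · intro j hj
      simp (disch := omega) [Function.update_of_ne]
    · intro a h
      have : a ≠ D.addr 0 D.start := by rw [hexp]; omega
      simp [hs.r23, hs.r8, ha, this]
    · intro S' hS' t ht
      obtain rfl : S' = 0 := by omega
      rw [D.entry_zero]
      by_cases h : t = D.start
      · subst h
        simp [hs.r23, hs.r8, hs.r3, ha, hz (D.addr 0 D.start + 1) (by rw [hexp]; omega)]
      · have h1 : D.addr 0 t ≠ D.addr 0 D.start := by rw [hexp, hexp]; omega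
        have h2 : D.addr 0 t + 1 ≠ D.addr 0 D.start := by rw [hexp, hexp]; omega
        simp [hs.r23, hs.r8, ha, h, h1, h2, hz (D.addr 0 t + 1) (by rw [hexp]; omega),
          hz (D.addr 0 t) (by rw [hexp]; omega)]
    · intro a h
      rw [hexp'] at h
      have : a ≠ D.addr 0 D.start := by rw [hexp]; omega
      simp [hs.r23, hs.r8, ha, this, hz a (by omega)]
  · intro s₁ h₁
    exact Within.loop (TableInv D s) h₁ (fun i s _ h => h.r27)
      (fun i s' hi h => tableBody_within hD hs hi h)
  · have := Nat.mul_le_mul_right (D.T.length * (27 * D.k + 33) + 7 + 1)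
      (Nat.sub_le (2 ^ D.k) 1)
    rw [show D.T.length * (27 * D.k + 33) + 7 + 1 = D.T.length * (27 * D.k + 33) + 8 from rfl] at *
    omega

/-- Set register `24` to one if the last table entry for the state in register `14` represents a
nonzero number. -/
def testEntry : Prog :=
  .seq (block [.mul 42 26 6, .add 42 42 14, .add 42 42 42, .add 42 42 8, .load 43 42,
      .add 42 42 3, .load 44 42, .sub 45 43 44, .sub 46 44 43, .add 45 45 46])
    (.ite 45 (block [.const 24 1]) (block []))

theorem testEntry_within {D : Layout} {B t : ℕ} {s₀ s : State} (hD : D.Valid B) (h₀ : D.Holds s₀)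
    (hs : TableInv D s₀ (2 ^ D.k - 1) s) (ht : t < D.Q) (h14 : s.reg 14 = t) :
    Within B testEntry 14 (fun s' => s'.mem = s.mem ∧
      (∀ i < 42, i ≠ 24 → s'.reg i = s.reg i) ∧
      s'.reg 24 = if pairVal (D.entry (2 ^ D.k - 1) t) = 0 then s.reg 24 else 1) s := by
  have hD0 : D.Holds s := h₀.congr hs.frame fun a ha => hs.low a (ha.trans_le hD.lim_le)
  have hB := hD.table_lt
  have hlim := hD.lim_le
  have hpos : 0 < 2 ^ D.k := by positivity
  have hidx := Layout.index_lt (D := D) (S := 2 ^ D.k - 1) (by omega) ht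
  have ha : (2 ^ D.k - 1) * D.Q + t + ((2 ^ D.k - 1) * D.Q + t) + D.gb =
      D.addr (2 ^ D.k - 1) t := by rw [Layout.addr]; omega
  have hexp : D.addr (2 ^ D.k - 1) t = D.gb + 2 * ((2 ^ D.k - 1) * D.Q + t) := rfl
  obtain ⟨c1, c2⟩ := hs.table (2 ^ D.k - 1) (by omega) t ht
  -- That the last addition fits follows from the size of the two stored numbers. The assumption of
  -- `Within` is used for this before it is handed on.
  intro hsmall
  have hb1 := hsmall.2 (D.addr (2 ^ D.k - 1) t)
  have hb2 := hsmall.2 (D.addr (2 ^ D.k - 1) t + 1)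
  rw [c1] at hb1
  rw [c2] at hb2
  revert hsmall
  refine (Within.seq' (N := 11) (M := 3) (R := fun s' => s'.mem = s.mem ∧
      (∀ i < 42, s'.reg i = s.reg i) ∧ s'.reg 45 =
        (D.entry (2 ^ D.k - 1) t).1 - (D.entry (2 ^ D.k - 1) t).2 +
        ((D.entry (2 ^ D.k - 1) t).2 - (D.entry (2 ^ D.k - 1) t).1)) ?_ ?_)
  · refine Within.block ?_ ⟨?_, ?_, ?_⟩
    · simp [hs.r26, h14, hD0.r6, hD0.r8, hD0.r3, ha, c1, c2]
      rw [hexp]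
      omega
    · simp
    · intro i hi
      simp (disch := omega) [Function.update_of_ne]
    · simp [hs.r26, h14, hD0.r6, hD0.r8, hD0.r3, ha, c1, c2]
  · rintro s₁ ⟨g1, g2, g3⟩
    refine Within.ite (N := 2) (fun hne => ?_) (fun heq => ?_)
    · refine (Within.block ?_ ⟨?_, ?_, ?_⟩).mono (by simp) fun _ h => h
      · simp [hD.bits_ne_zero]
      · simpa using g1
      · intro i hi h
        simp [h, g2 i hi]
      · rw [if_neg (by rw [pairVal_apply]; omega)]
        simp
    · refine (Within.block ?_ ⟨?_, ?_, ?_⟩).mono (by simp) fun _ h => h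
      · simp
      · simpa using g1
      · intro i hi h
        simp [g2 i hi]
      · rw [if_pos (by rw [pairVal_apply]; omega)]
        simpa using g2 24 (by norm_num)


/-! ### The preparation: constants, transitions, random numbers -/

/-- A list of transitions as a list of numbers. -/
def flattenTriples (T : List (ℕ × ℕ × ℕ)) : List ℕ := T.flatMap fun τ => [τ.1, τ.2.1, τ.2.2]

theorem length_flattenTriples (T : List (ℕ × ℕ × ℕ)) :
    (flattenTriples T).length = 3 * T.length := by
  induction T with
  | nil => rfl
  | cons τ T ih =>
    rw [flattenTriples] at ih ⊢
    simp only [List.flatMap_cons, List.length_append, ih, List.length_cons, List.length_nil]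
    omega

theorem getD_flattenTriples (T : List (ℕ × ℕ × ℕ)) (q : ℕ) (h : q < T.length) :
    (flattenTriples T).getD (3 * q) 0 = T[q].1 ∧ (flattenTriples T).getD (3 * q + 1) 0 = T[q].2.1 ∧
      (flattenTriples T).getD (3 * q + 2) 0 = T[q].2.2 := by
  induction T generalizing q with
  | nil => simp at h
  | cons τ T ih =>
    have hc : flattenTriples (τ :: T) = τ.1 :: τ.2.1 :: τ.2.2 :: flattenTriples T := rfl
    rw [hc]
    cases q with
    | zero => simp
    | succ q =>
      have := ih q (by simpa using h)
      rw [show 3 * (q + 1) = 3 * q + 1 + 1 + 1 by ring]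
      simpa only [List.getD_cons_succ, List.getElem_cons_succ] using this

theorem listMem_append_left {L M : List ℕ} {a : ℕ} (h : a < L.length) :
    listMem (L ++ M) a = listMem L a := by
  rw [listMem, List.getD_append _ _ _ _ h, listMem]

theorem listMem_append_right (L M : List ℕ) (a : ℕ) : listMem (L ++ M) (L.length + a) =
    listMem M a := by
  rw [listMem, List.getD_append_right _ _ _ _ (by omega), listMem]; congr 1; omega

/-- Every intermediate number of the preparation has at most `B` bits. -/
structure SetupFits (B d n m k : ℕ) : Prop where
  length_lt : 4 * (m * (d + 1)) + (2 * k + 1) * n + 2 < 2 ^ B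
  code_lt : (n + 1) ^ d * (n + 1) < 2 ^ B
  table_lt : 2 ^ k < 2 ^ B
  coin_lt : 2 ^ (2 * n) < 2 ^ B
  arity_lt : d + 2 < 2 ^ B
  steps_lt : 2 * k + 1 < 2 ^ B

/-- Compute the constants. -/
def constants (d : ℕ) : Prog :=
  .seq (block [.const 3 1, .const 4 d, .add 5 0 3, .const 6 1])
    (.seq (.loop 4 (block [.mul 6 6 5, .sub 4 4 3]))
      (.seq (block [.const 4 2, .add 10 2 9, .const 7 1])
        (.seq (.loop 10 (block [.add 7 7 7, .sub 10 10 3]))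
          (block [.const 11 (d + 1), .mul 11 11 1, .add 8 11 9, .add 12 1 9, .const 13 0]))))

/-- The constants have been computed. -/
structure Constants (d n m k : ℕ) (s : State) : Prop where
  r0 : s.reg 0 = n
  r2 : s.reg 2 = k
  r3 : s.reg 3 = 1
  r4 : s.reg 4 = 2
  r5 : s.reg 5 = n + 1
  r6 : s.reg 6 = (n + 1) ^ d
  r7 : s.reg 7 = 2 ^ k
  r9 : s.reg 9 = 0
  r11 : s.reg 11 = m * (d + 1)
  r24 : s.reg 24 = 0

theorem Constants.congr {d n m k : ℕ} {s s' : State} (h : Constants d n m k s)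
    (hr : ∀ i < 12, i ≠ 8 → s'.reg i = s.reg i) (h24 : s'.reg 24 = s.reg 24) :
    Constants d n m k s' :=
  have H : ∀ i < 12, i ≠ 8 → ∀ x, s.reg i = x → s'.reg i = x :=
    fun i hi hi' x hx => (hr i hi hi').trans hx
  ⟨H 0 (by norm_num) (by norm_num) _ h.r0, H 2 (by norm_num) (by norm_num) _ h.r2,
    H 3 (by norm_num) (by norm_num) _ h.r3, H 4 (by norm_num) (by norm_num) _ h.r4,
    H 5 (by norm_num) (by norm_num) _ h.r5, H 6 (by norm_num) (by norm_num) _ h.r6,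
    H 7 (by norm_num) (by norm_num) _ h.r7, H 9 (by norm_num) (by norm_num) _ h.r9,
    H 11 (by norm_num) (by norm_num) _ h.r11, h24.trans h.r24⟩

theorem constants_within {B d n m k : ℕ} {s : State} (hB : SetupFits B d n m k)
    (h0 : s.reg 0 = n) (h1 : s.reg 1 = m) (h2 : s.reg 2 = k) (h9 : s.reg 9 = 0)
    (h24 : s.reg 24 = 0) :
    Within B (constants d) (4 * d + 4 * k + 17) (fun s' => Constants d n m k s' ∧
      s'.reg 8 = m * (d + 1) ∧ s'.reg 12 = m ∧ s'.reg 13 = 0 ∧ s'.mem = s.mem ∧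
        s'.coins = s.coins) s := by
  obtain ⟨b1, b2, b3, b4, b5, b6⟩ := hB
  have hn : n < 2 ^ (2 * n) := lt_of_le_of_lt (by omega) (Nat.lt_two_pow_self (n := 2 * n))
  have hk : k < 2 ^ k := Nat.lt_two_pow_self
  have hm : m ≤ m * (d + 1) := Nat.le_mul_of_pos_right _ (by omega)
  have hB0 : B ≠ 0 := by rintro rfl; omega
  refine (Within.seq' (N := 5) (M := 4 * d + 4 * k + 12) (R := fun s' =>
    (∀ i, i ≠ 3 → i ≠ 4 → i ≠ 5 → i ≠ 6 → s'.reg i = s.reg i) ∧ s'.reg 3 = 1 ∧ s'.reg 5 = n + 1 ∧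
    s'.mem = s.mem ∧ s'.coins = s.coins ∧ s'.reg 6 = (n + 1) ^ 0 ∧ s'.reg 4 = d - 0) ?_ ?_).mono
      (by omega) fun _ h => h
  · refine Within.block ?_ ⟨?_, ?_, ?_, ?_, ?_, ?_, ?_⟩
    · simp [h0, hB0]; omega
    · intro i h1 h2 h3 h4; simp [h1, h2, h3, h4]
    all_goals simp [h0]
  intro s₁ hs₁
  refine (Within.seq' (M := 4 * k + 11) (Within.loop (N := 3) (n := d) (fun i s' =>
    (∀ i, i ≠ 3 → i ≠ 4 → i ≠ 5 → i ≠ 6 → s'.reg i = s.reg i) ∧ s'.reg 3 = 1 ∧ s'.reg 5 = n + 1 ∧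
    s'.mem = s.mem ∧ s'.coins = s.coins ∧ s'.reg 6 = (n + 1) ^ i ∧ s'.reg 4 = d - i) hs₁
      (fun i s' _ h => h.2.2.2.2.2.2) ?_) ?_).mono (by omega) fun _ h => h
  · rintro i s' hi ⟨f1, f2, f3, f4, f5, f6, f7⟩
    have hle : (n + 1) ^ (i + 1) ≤ (n + 1) ^ d := Nat.pow_le_pow_right (by omega) hi
    have hle' : (n + 1) ^ d ≤ (n + 1) ^ d * (n + 1) := Nat.le_mul_of_pos_right _ (by omega)
    rw [pow_succ] at hle
    refine Within.block ?_ ⟨?_, ?_, ?_, ?_, ?_, ?_, ?_⟩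
    · simp [f6, f3]; omega
    · intro i h1 h2 h3 h4; simp [h2, h4, f1 i h1 h2 h3 h4]
    · simp [f2]
    · simp [f3]
    · simp [f4]
    · simp [f5]
    · simp [f6, f3, pow_succ]
    · simp [f7, f2]; omega
  rintro s₂ ⟨f1, f2, f3, f4, f5, f6, _⟩
  refine (Within.seq' (N := 4) (M := 4 * k + 7) (R := fun s' =>
    (∀ i, i ≠ 3 → i ≠ 4 → i ≠ 5 → i ≠ 6 → i ≠ 7 → i ≠ 10 → s'.reg i = s.reg i) ∧ s'.reg 3 = 1 ∧
    s'.reg 5 = n + 1 ∧ s'.mem = s.mem ∧ s'.coins = s.coins ∧ s'.reg 6 = (n + 1) ^ d ∧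
    s'.reg 4 = 2 ∧ s'.reg 7 = 2 ^ 0 ∧ s'.reg 10 = k - 0) ?_ ?_).mono
      (by omega) fun _ h => h
  · refine Within.block ?_ ⟨?_, ?_, ?_, ?_, ?_, ?_, ?_, ?_, ?_⟩
    · simp [f1, h2, h9, hB0]; omega
    · intro i h1 h2 h3 h4 h5 h6; simp [h2, h5, h6, f1 i h1 h2 h3 h4]
    all_goals simp [f1, f2, f3, f4, f5, f6, h2, h9]
  intro s₃ hs₃
  refine (Within.seq' (M := 6) (Within.loop (N := 3) (n := k) (fun i s' =>
    (∀ i, i ≠ 3 → i ≠ 4 → i ≠ 5 → i ≠ 6 → i ≠ 7 → i ≠ 10 → s'.reg i = s.reg i) ∧ s'.reg 3 = 1 ∧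
    s'.reg 5 = n + 1 ∧ s'.mem = s.mem ∧ s'.coins = s.coins ∧ s'.reg 6 = (n + 1) ^ d ∧
    s'.reg 4 = 2 ∧ s'.reg 7 = 2 ^ i ∧ s'.reg 10 = k - i) hs₃
      (fun i s' _ h => h.2.2.2.2.2.2.2.2) ?_) ?_).mono (by omega) fun _ h => h
  · rintro i s' hi ⟨f1, f2, f3, f4, f5, f6, f7, f8, f9⟩
    have hle : 2 ^ (i + 1) ≤ 2 ^ k := Nat.pow_le_pow_right (by omega) hi
    rw [pow_succ] at hle
    refine Within.block ?_ ⟨?_, ?_, ?_, ?_, ?_, ?_, ?_, ?_, ?_⟩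
    · simp [f8]; omega
    · intro i h1 h2 h3 h4 h5 h6; simp [h5, h6, f1 i h1 h2 h3 h4 h5 h6]
    · simp [f2]
    · simp [f3]
    · simp [f4]
    · simp [f5]
    · simp [f6]
    · simp [f7]
    · simp [f8, pow_succ]; omega
    · simp [f9, f2]; omega
  rintro s₄ ⟨f1, f2, f3, f4, f5, f6, f7, f8, _⟩
  refine Within.block ?_ ⟨⟨?_, ?_, ?_, ?_, ?_, ?_, ?_, ?_, ?_, ?_⟩, ?_, ?_, ?_, ?_, ?_⟩
  · simp [f1, h1, h9, mul_comm (d + 1)]; omega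
  all_goals simp [f1, f2, f3, f4, f5, f6, f7, f8, h0, h1, h2, h9, h24, mul_comm (d + 1)]

/-- Write the transition for the next node of a hyperedge to the end of the used memory. -/
def stepBody : Prog :=
  block [.load 16 13, .add 13 13 3, .store 8 14, .add 8 8 3, .store 8 16, .add 8 8 3,
    .mul 14 14 5, .add 14 14 16, .add 14 14 3, .div 17 14 6, .mul 17 17 6, .sub 14 14 17,
    .store 8 14, .add 8 8 3, .sub 15 15 3]

/-- Write the transitions for the next hyperedge. -/
def edgeBody (d : ℕ) : Prog :=
  .seq (block [.const 14 0, .const 15 (d + 1)])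
    (.seq (.loop 15 stepBody) (block [.sub 12 12 3]))

/-- The label number `a` of the hyperedge number `e`. -/
def label (d : ℕ) (inp : List ℕ) (e a : ℕ) : ℕ := inp.getD (e * (d + 1) + a) 0

/-- The transitions for the first `a` nodes of a hyperedge. -/
def edgeTransitions (d n : ℕ) (u : ℕ → ℕ) (a : ℕ) : List (ℕ × ℕ × ℕ) :=
  (List.range a).map fun a => (prefixCode (n + 1) ((n + 1) ^ d) u a, u a,
    prefixCode (n + 1) ((n + 1) ^ d) u (a + 1))

theorem edgeTransitions_succ (d n : ℕ) (u : ℕ → ℕ) (a : ℕ) : edgeTransitions d n u (a + 1) =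
    edgeTransitions d n u a ++ [(prefixCode (n + 1) ((n + 1) ^ d) u a, u a,
      prefixCode (n + 1) ((n + 1) ^ d) u (a + 1))] := by
  simp [edgeTransitions, List.range_succ]

/-- The transitions for the first `e` hyperedges. -/
def inputTransitions (d n : ℕ) (inp : List ℕ) (e : ℕ) : List (ℕ × ℕ × ℕ) :=
  transitions (n + 1) ((n + 1) ^ d) (d + 1) e (label d inp)

theorem inputTransitions_succ (d n : ℕ) (inp : List ℕ) (e : ℕ) :
    inputTransitions d n inp (e + 1) =
      inputTransitions d n inp e ++ edgeTransitions d n (label d inp e) (d + 1) := by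
  simp [inputTransitions, transitions, edgeTransitions, List.range_succ]

theorem length_edgeTransitions (d n : ℕ) (u : ℕ → ℕ) (a : ℕ) :
    (edgeTransitions d n u a).length = a := by simp [edgeTransitions]

theorem length_inputTransitions (d n : ℕ) (inp : List ℕ) (e : ℕ) :
    (inputTransitions d n inp e).length = e * (d + 1) := by
  induction e with
  | zero => simp [inputTransitions, transitions]
  | succ e ih =>
    rw [inputTransitions_succ, List.length_append, ih, length_edgeTransitions]; ring

/-- The state after the first `a` nodes of the hyperedge number `e`. -/
structure StepInv (d n m : ℕ) (inp : List ℕ) (s₀ : State) (e a : ℕ) (s : State) : Prop where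
  mem : s.mem = listMem (inp ++ flattenTriples
    (inputTransitions d n inp e ++ edgeTransitions d n (label d inp e) a))
  r8 : s.reg 8 = m * (d + 1) + 3 * (e * (d + 1) + a)
  r12 : s.reg 12 = m - e
  r13 : s.reg 13 = e * (d + 1) + a
  r14 : s.reg 14 = prefixCode (n + 1) ((n + 1) ^ d) (label d inp e) a
  r15 : s.reg 15 = d + 1 - a
  frame : ∀ i < 12, i ≠ 8 → s.reg i = s₀.reg i
  r24 : s.reg 24 = s₀.reg 24
  coins : s.coins = s₀.coins

/-- The state after the first `e` hyperedges. -/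
structure EdgeInv (d n m : ℕ) (inp : List ℕ) (s₀ : State) (e : ℕ) (s : State) : Prop where
  mem : s.mem = listMem (inp ++ flattenTriples (inputTransitions d n inp e))
  r8 : s.reg 8 = m * (d + 1) + 3 * (e * (d + 1))
  r12 : s.reg 12 = m - e
  r13 : s.reg 13 = e * (d + 1)
  frame : ∀ i < 12, i ≠ 8 → s.reg i = s₀.reg i
  r24 : s.reg 24 = s₀.reg 24
  coins : s.coins = s₀.coins

theorem stepBody_within {B d n m k e a : ℕ} {inp : List ℕ} {s₀ s : State}
    (hB : SetupFits B d n m k) (h₀ : Constants d n m k s₀) (hinp : inp.length = m * (d + 1))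
    (hu : ∀ e < m, ∀ a < d + 1, label d inp e a < n) (he : e < m) (ha : a < d + 1)
    (hs : StepInv d n m inp s₀ e a s) :
    Within B stepBody 16 (StepInv d n m inp s₀ e (a + 1)) s := by
  have hC : Constants d n m k s := h₀.congr hs.frame hs.r24
  obtain ⟨b1, b2, b3, b4, b5, b6⟩ := hB
  have hidx : e * (d + 1) + (d + 1) ≤ m * (d + 1) := by
    rw [← Nat.succ_mul]; exact Nat.mul_le_mul_right _ he
  have hu' := hu e he a ha
  have hload : s.mem (e * (d + 1) + a) = label d inp e a := by
    rw [hs.mem, listMem_append_left (by omega)]; rfl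
  have hlt := prefixCode_lt (b := n + 1) (Q := (n + 1) ^ d) (by positivity) (label d inp e) a
  have hcode : prefixCode (n + 1) ((n + 1) ^ d) (label d inp e) a * (n + 1) + (n + 1) ≤
      (n + 1) ^ d * (n + 1) := by
    rw [← Nat.succ_mul]; exact Nat.mul_le_mul_right _ hlt
  -- The machine has no remainder instruction; the residue is `x - x / Q * Q`.
  have hnext : prefixCode (n + 1) ((n + 1) ^ d) (label d inp e) (a + 1) =
      prefixCode (n + 1) ((n + 1) ^ d) (label d inp e) a * (n + 1) + label d inp e a + 1 -
      (prefixCode (n + 1) ((n + 1) ^ d) (label d inp e) a * (n + 1) + label d inp e a + 1) /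
        (n + 1) ^ d * (n + 1) ^ d := by
    rw [prefixCode, shiftCode, ← add_assoc]
    exact Nat.mod_eq_sub_div_mul
  have hdiv := Nat.div_mul_le_self
    (prefixCode (n + 1) ((n + 1) ^ d) (label d inp e) a * (n + 1) + label d inp e a + 1)
    ((n + 1) ^ d)
  have hM : (inp ++ flattenTriples
      (inputTransitions d n inp e ++ edgeTransitions d n (label d inp e) a)).length =
      m * (d + 1) + 3 * (e * (d + 1) + a) := by
    rw [List.length_append, length_flattenTriples, List.length_append, length_inputTransitions,
      length_edgeTransitions, hinp]
  have hmem := hs.mem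
  refine Within.block ?_ ⟨?_, ?_, ?_, ?_, ?_, ?_, ?_, ?_, ?_⟩
  · simp [hs.r13, hC.r3, hs.r8, hs.r14, hC.r5, hload, hC.r6]
    omega
  -- The three stores of one pass append the source, the label and the target.
  · have hsplit : inp ++ flattenTriples
        (inputTransitions d n inp e ++ edgeTransitions d n (label d inp e) (a + 1)) =
        inp ++ flattenTriples (inputTransitions d n inp e ++ edgeTransitions d n (label d inp e) a)
        ++ [prefixCode (n + 1) ((n + 1) ^ d) (label d inp e) a] ++ [label d inp e a] ++
          [prefixCode (n + 1) ((n + 1) ^ d) (label d inp e) (a + 1)] := by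
      rw [edgeTransitions_succ]; simp [flattenTriples]
    rw [hsplit]
    generalize inp ++ flattenTriples
      (inputTransitions d n inp e ++ edgeTransitions d n (label d inp e) a) = W at hM hmem
    rw [← update_listMem, ← update_listMem, ← update_listMem, List.length_append,
      List.length_append, hM, ← hmem, hnext]
    simp [hs.r13, hC.r3, hs.r8, hs.r14, hC.r5, hload, hC.r6, hM]
  · simp [hC.r3, hs.r8]; omega
  · simp [hs.r12]
  · simp [hs.r13, hC.r3]; omega
  · rw [hnext]
    simp [hs.r13, hC.r3, hs.r14, hC.r5, hload, hC.r6]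
  · simp [hs.r15, hC.r3]; omega
  · intro i hi h8
    simp (disch := omega) [Function.update_of_ne, hs.frame i hi h8]
  · simpa using hs.r24
  · simpa using hs.coins

theorem edgeBody_within {B d n m k e : ℕ} {inp : List ℕ} {s₀ s : State}
    (hB : SetupFits B d n m k) (h₀ : Constants d n m k s₀) (hinp : inp.length = m * (d + 1))
    (hu : ∀ e < m, ∀ a < d + 1, label d inp e a < n) (he : e < m) (hs : EdgeInv d n m inp s₀ e s) :
    Within B (edgeBody d) (17 * (d + 1) + 6) (EdgeInv d n m inp s₀ (e + 1)) s := by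
  obtain ⟨b1, b2, b3, b4, b5, b6⟩ := id hB
  refine (Within.seq' (N := 3) (M := 17 * (d + 1) + 3) (R := StepInv d n m inp s₀ e 0) ?_ ?_).mono
    (by omega) fun _ h => h
  · refine Within.block ?_ ⟨?_, ?_, ?_, ?_, ?_, ?_, ?_, ?_, ?_⟩
    · simp; omega
    · simpa [edgeTransitions] using hs.mem
    · simpa using hs.r8
    · simpa using hs.r12
    · simpa using hs.r13
    · simp [prefixCode]
    · simp
    · intro i hi h8
      simp (disch := omega) [Function.update_of_ne, hs.frame i hi h8]
    · simpa using hs.r24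
    · simpa using hs.coins
  intro s₁ hs₁
  refine (Within.seq' (M := 2) (Within.loop (N := 16) (n := d + 1) (StepInv d n m inp s₀ e) hs₁
    (fun a s _ h => h.r15) fun a s ha h => stepBody_within hB h₀ hinp hu he ha h) ?_).mono
      (by omega) fun _ h => h
  intro s₂ hs₂
  have h3 : s₂.reg 3 = 1 := (hs₂.frame 3 (by norm_num) (by norm_num)).trans h₀.r3
  refine Within.block (by simp) ⟨?_, ?_, ?_, ?_, ?_, ?_, ?_⟩
  · rw [inputTransitions_succ]; simpa using hs₂.mem
  · simp [hs₂.r8]; ring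
  · simp [hs₂.r12, h3]; omega
  · simp [hs₂.r13]; ring
  · intro i hi h8
    simp (disch := omega) [Function.update_of_ne, hs₂.frame i hi h8]
  · simpa using hs₂.r24
  · simpa using hs₂.coins

/-- Toss a random number of `2 * n` bits and write it to the end of the used memory. -/
def numberBody : Prog :=
  .seq (block [.const 21 0, .add 20 0 0])
    (.seq (.loop 20 (block [.flip 22, .add 21 21 21, .add 21 21 22, .sub 20 20 3]))
      (block [.store 8 21, .add 8 8 3, .sub 19 19 3]))

/-- The random numbers. -/
def randomNumbers (ω : ℕ → Bool) (L N : ℕ) : List ℕ :=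
  (List.range N).map fun t => coinNum ω (t * L) L

/-- The state after the first `t` of `N` random numbers, written after the list `M`. -/
structure NumberInv (n N : ℕ) (M : List ℕ) (ω : ℕ → Bool) (s₀ : State) (t : ℕ) (s : State) :
    Prop where
  mem : s.mem = listMem (M ++ randomNumbers ω (2 * n) t)
  r8 : s.reg 8 = M.length + t
  r19 : s.reg 19 = N - t
  coins : s.coins = fun q => ω (t * (2 * n) + q)
  frame : ∀ i < 19, i ≠ 8 → s.reg i = s₀.reg i
  r24 : s.reg 24 = s₀.reg 24

/-- Coins are consumed in order, so the number `t` consists of the coins of block `t`, as the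
probability bound requires. -/
theorem numberBody_within {B n N t : ℕ} {M : List ℕ} {ω : ℕ → Bool} {s₀ s : State}
    (h0 : s₀.reg 0 = n) (h3 : s₀.reg 3 = 1) (hB : 2 ^ (2 * n) < 2 ^ B)
    (hN : M.length + N < 2 ^ B) (ht : t < N) (hs : NumberInv n N M ω s₀ t s) :
    Within B numberBody (12 * n + 8) (NumberInv n N M ω s₀ (t + 1)) s := by
  have e0 : s.reg 0 = n := (hs.frame 0 (by norm_num) (by norm_num)).trans h0
  have hn : 2 * n < 2 ^ (2 * n) := Nat.lt_two_pow_self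
  have hB0 : B ≠ 0 := by rintro rfl; omega
  refine (Within.seq' (N := 3) (M := 12 * n + 5) (R := fun s' => s'.mem = s.mem ∧
    s'.reg 8 = s.reg 8 ∧ s'.reg 19 = s.reg 19 ∧ s'.reg 21 = coinNum ω (t * (2 * n)) 0 ∧
    s'.reg 20 = 2 * n - 0 ∧ (s'.coins = fun q => ω (t * (2 * n) + 0 + q)) ∧
    (∀ i < 19, i ≠ 8 → s'.reg i = s₀.reg i) ∧ s'.reg 24 = s₀.reg 24) ?_ ?_).mono
    (by omega) fun _ h => h
  · refine Within.block ?_ ⟨?_, ?_, ?_, ?_, ?_, ?_, ?_, ?_⟩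
    · simp [e0]; omega
    · simp
    · simp
    · simp
    · simp [coinNum]
    · simp [e0]; omega
    · simpa using hs.coins
    · intro i hi h8
      simp (disch := omega) [Function.update_of_ne, hs.frame i hi h8]
    · simpa using hs.r24
  intro s₁ hs₁
  refine (Within.seq' (M := 4) (Within.loop (N := 5) (n := 2 * n) (fun q s' => s'.mem = s.mem ∧
    s'.reg 8 = s.reg 8 ∧ s'.reg 19 = s.reg 19 ∧ s'.reg 21 = coinNum ω (t * (2 * n)) q ∧
    s'.reg 20 = 2 * n - q ∧ (s'.coins = fun q' => ω (t * (2 * n) + q + q')) ∧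
    (∀ i < 19, i ≠ 8 → s'.reg i = s₀.reg i) ∧ s'.reg 24 = s₀.reg 24) hs₁
      (fun q s' _ h => h.2.2.2.2.1) ?_) ?_).mono (by omega) fun _ h => h
  · rintro q s' hq ⟨f1, f2, f3, f4, f5, f6, f7, f8⟩
    have f3' : s'.reg 3 = 1 := (f7 3 (by norm_num) (by norm_num)).trans h3
    have hlt := coinNum_lt ω (t * (2 * n)) (q + 1)
    have hle : 2 ^ (q + 1) ≤ 2 ^ (2 * n) := Nat.pow_le_pow_right (by norm_num) hq
    rw [coinNum] at hlt
    refine Within.block ?_ ⟨?_, ?_, ?_, ?_, ?_, ?_, ?_, ?_⟩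
    · simp [f4, f6, hB0]; omega
    · simp [f1]
    · simp [f2]
    · simp [f3]
    · simp [f4, f6, coinNum]; omega
    · simp [f5, f3']; omega
    · simp only [runBlock, Instr.apply, State.setReg, f6]
      funext q'; congr 1; omega
    · intro i hi h8
      simp (disch := omega) [Function.update_of_ne, f7 i hi h8]
    · simp [f8]
  rintro s₂ ⟨f1, f2, f3, f4, _, f6, f7, f8⟩
  have f3' : s₂.reg 3 = 1 := (f7 3 (by norm_num) (by norm_num)).trans h3
  have hlen : (M ++ randomNumbers ω (2 * n) t).length = M.length + t := by simp [randomNumbers]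
  refine Within.block ?_ ⟨?_, ?_, ?_, ?_, ?_, ?_⟩
  · simp [f2, hs.r8, f3']; omega
  · have : randomNumbers ω (2 * n) (t + 1) =
        randomNumbers ω (2 * n) t ++ [coinNum ω (t * (2 * n)) (2 * n)] := by
      simp [randomNumbers, List.range_succ]
    rw [this, ← List.append_assoc, ← update_listMem, hlen, ← hs.mem]
    simp [f1, f2, hs.r8, f4]
  · simp [f2, hs.r8, f3']; omega
  · simp [f3, hs.r19, f3']; omega
  · simp only [runBlock, Instr.apply, State.setReg, f6]
    funext q'; congr 1; ring
  · intro i hi h8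
    simp (disch := omega) [Function.update_of_ne, f7 i hi h8]
  · simpa using f8

/-- The preparation: constants, transitions, random numbers. -/
def setup (d : ℕ) : Prog :=
  .seq (constants d) (.seq (.loop 12 (edgeBody d))
    (.seq (block [.add 18 8 9, .add 19 2 2, .add 19 19 3, .mul 19 19 0]) (.loop 19 numberBody)))

/-- The memory after the preparation. -/
def setupList (d n m k : ℕ) (inp : List ℕ) (ω : ℕ → Bool) : List ℕ :=
  inp ++ flattenTriples (inputTransitions d n inp m) ++ randomNumbers ω (2 * n) ((2 * k + 1) * n)

theorem length_setupList {d n m : ℕ} (k : ℕ) {inp : List ℕ} (ω : ℕ → Bool)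
    (hinp : inp.length = m * (d + 1)) :
    (setupList d n m k inp ω).length = 4 * (m * (d + 1)) + (2 * k + 1) * n := by
  simp only [setupList, List.length_append, length_flattenTriples, length_inputTransitions, hinp,
    randomNumbers, List.length_map, List.length_range]
  omega

theorem setup_within {B d n m k : ℕ} {inp : List ℕ} {ω : ℕ → Bool} {s : State}
    (hB : SetupFits B d n m k) (h0 : s.reg 0 = n) (h1 : s.reg 1 = m) (h2 : s.reg 2 = k)
    (h9 : s.reg 9 = 0) (h24 : s.reg 24 = 0) (hmem : s.mem = listMem inp) (hω : s.coins = ω)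
    (hinp : inp.length = m * (d + 1)) (hu : ∀ e < m, ∀ a < d + 1, label d inp e a < n) :
    Within B (setup d)
      (4 * d + 4 * k + 24 + m * (17 * (d + 1) + 7) + (2 * k + 1) * n * (12 * n + 9))
      (fun s' => Constants d n m k s' ∧ s'.reg 8 = 4 * (m * (d + 1)) + (2 * k + 1) * n ∧
        s'.reg 18 = 4 * (m * (d + 1)) ∧ s'.mem = listMem (setupList d n m k inp ω)) s := by
  have hkn : (2 * k + 1) * n = 2 * (k * n) + n := by ring
  have hb := hB
  obtain ⟨b1, b2, b3, b4, b5, b6⟩ := hb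
  have hk : k < 2 ^ k := Nat.lt_two_pow_self
  refine (Within.seq' (M := m * (17 * (d + 1) + 7) + (2 * k + 1) * n * (12 * n + 9) + 7)
    (constants_within hB h0 h1 h2 h9 h24) ?_).mono (by omega) fun _ h => h
  rintro s₁ ⟨hC, g8, g12, g13, gm, gc⟩
  refine (Within.seq' (M := (2 * k + 1) * n * (12 * n + 9) + 6)
    (Within.loop (N := 17 * (d + 1) + 6) (n := m) (EdgeInv d n m inp s₁)
      ⟨?_, ?_, ?_, ?_, ?_, rfl, rfl⟩ (fun e s _ h => h.r12)
      fun e s he h => edgeBody_within hB hC hinp hu he h) ?_).mono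
      (by rw [show 17 * (d + 1) + 6 + 1 = 17 * (d + 1) + 7 from rfl]; omega) fun _ h => h
  · simp [gm, hmem, inputTransitions, transitions, flattenTriples]
  · simp [g8]
  · simp [g12]
  · simp [g13]
  · intro i _ _; rfl
  intro s₂ hs₂
  have hC2 : Constants d n m k s₂ := hC.congr hs₂.frame hs₂.r24
  have hlen : (inp ++ flattenTriples (inputTransitions d n inp m)).length =
      4 * (m * (d + 1)) := by
    simp only [List.length_append, length_flattenTriples, length_inputTransitions, hinp]; omega
  refine (Within.seq' (N := 5) (M := (2 * k + 1) * n * (12 * n + 9) + 1) (R := fun s' =>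
    Constants d n m k s' ∧ s'.reg 18 = 4 * (m * (d + 1)) ∧ NumberInv n ((2 * k + 1) * n)
      (inp ++ flattenTriples (inputTransitions d n inp m)) ω s' 0 s') ?_ ?_).mono
        (by omega) fun _ h => h
  · have h8 : s₂.reg 8 = 4 * (m * (d + 1)) := by rw [hs₂.r8]; omega
    refine Within.block ?_ ⟨hC2.congr ?_ ?_, ?_, ⟨?_, ?_, ?_, ?_, ?_, ?_⟩⟩
    · simp [h8, hC2.r9, hC2.r2, hC2.r3, hC2.r0]
      rw [show (k + k + 1) * n = (2 * k + 1) * n by ring]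
      omega
    · intro i hi _
      simp (disch := omega) [Function.update_of_ne]
    · simp
    · simp [h8, hC2.r9]
    · simpa [randomNumbers] using hs₂.mem
    · rw [hlen]; simp [h8]
    · simp [hC2.r2, hC2.r3, hC2.r0]; left; omega
    · simp [hs₂.coins, gc, hω]
    · intro i _ _; rfl
    · rfl
  rintro s₃ ⟨hC3, g18, hinv⟩
  refine ((Within.loop (N := 12 * n + 8) (n := (2 * k + 1) * n) _ hinv
    (fun t s _ h => h.r19) fun t s ht h => numberBody_within hC3.r0 hC3.r3 b4
      (by rw [hlen]; omega) ht h)).mono le_rfl ?_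
  intro s₄ hs₄
  refine ⟨hC3.congr (fun i hi h8 => hs₄.frame i (by omega) h8) hs₄.r24, ?_, ?_, hs₄.mem⟩
  · rw [hs₄.r8, hlen]
  · rw [hs₄.frame 18 (by norm_num) (by norm_num), g18]


/-! ### The searches for walks and for closed walks -/

/-- The data of the computation after the preparation, with the table from address `gb` on. -/
def layout (d n m k : ℕ) (inp : List ℕ) (ω : ℕ → Bool) (gb start : ℕ) : Layout where
  n := n
  k := k
  Q := (n + 1) ^ d
  tb := m * (d + 1)
  xb := 4 * (m * (d + 1))
  lim := 4 * (m * (d + 1)) + (2 * k + 1) * n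
  gb := gb
  start := start
  X := 2 ^ (2 * n)
  T := inputTransitions d n inp m
  M := listMem (setupList d n m k inp ω)

theorem layout_z {d n m k : ℕ} {inp : List ℕ} (hinp : inp.length = m * (d + 1)) (ω : ℕ → Bool)
    (gb start : ℕ) {q : ℕ} (hq : q < (2 * k + 1) * n) :
    (layout d n m k inp ω gb start).M ((layout d n m k inp ω gb start).xb + q) =
      coinNum ω (q * (2 * n)) (2 * n) := by
  have hlen : (inp ++ flattenTriples (inputTransitions d n inp m)).length =
      4 * (m * (d + 1)) := by
    simp only [List.length_append, length_flattenTriples, length_inputTransitions, hinp]; omega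
  change listMem (setupList d n m k inp ω) (4 * (m * (d + 1)) + q) = _
  rw [setupList, ← hlen, listMem_append_right]
  simp [listMem, randomNumbers, hq]

theorem layout_valid {B d n m k gb start : ℕ} {inp : List ℕ} {ω : ℕ → Bool}
    (hinp : inp.length = m * (d + 1)) (hu : ∀ e < m, ∀ a < d + 1, label d inp e a < n)
    (hstart : start < (n + 1) ^ d) (hgb : 4 * (m * (d + 1)) + (2 * k + 1) * n ≤ gb)
    (htab : gb + 2 * (2 ^ k * (n + 1) ^ d) < 2 ^ B)
    (hgrowth : walkGrowth k (2 ^ (2 * n)) (m * (d + 1)) ^ k < 2 ^ B) :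
    (layout d n m k inp ω gb start).Valid B := by
  have hT : (layout d n m k inp ω gb start).T = inputTransitions d n inp m := rfl
  have hlenT : (layout d n m k inp ω gb start).T.length = m * (d + 1) := by
    rw [hT, length_inputTransitions]
  constructor
  · intro τ hτ
    obtain ⟨e, he, a, ha, rfl⟩ := mem_transitions.1 hτ
    exact ⟨prefixCode_lt (by positivity) _ _, hu e he a ha, prefixCode_lt (by positivity) _ _⟩
  · exact hstart
  · exact hlenT.symm
  · rw [hlenT]
    change m * (d + 1) + 3 * (m * (d + 1)) ≤ 4 * (m * (d + 1)) + (2 * k + 1) * n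
    omega
  · exact le_rfl
  · exact hgb
  · exact pow_pos (by norm_num) _
  · intro q hq
    exact (layout_z hinp ω gb start hq).trans_le (coinNum_lt _ _ _).le
  · exact htab
  · rw [hlenT]; exact hgrowth
  · intro q hq
    rw [hlenT] at hq
    have hlenF : (flattenTriples (inputTransitions d n inp m)).length = 3 * (m * (d + 1)) := by
      rw [length_flattenTriples, length_inputTransitions]
    have hrd : ∀ a < 3 * (m * (d + 1)), listMem (setupList d n m k inp ω) (m * (d + 1) + a) =
        (flattenTriples (inputTransitions d n inp m)).getD a 0 := by
      intro a ha
      rw [setupList, listMem_append_left (by rw [List.length_append, hlenF]; omega), ← hinp,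
        listMem_append_right, listMem]
    obtain ⟨h1, h2, h3⟩ := getD_flattenTriples (inputTransitions d n inp m) q
      (by rw [length_inputTransitions]; exact hq)
    refine ⟨(hrd _ (by omega)).trans h1, ?_, ?_⟩
    · exact (hrd (3 * q + 1) (by omega)).trans h2
    · exact (hrd (3 * q + 2) (by omega)).trans h3

theorem layout_holds {d n m k gb start : ℕ} {inp : List ℕ} {ω : ℕ → Bool} {s : State}
    (hC : Constants d n m k s) (h8 : s.reg 8 = gb) (h18 : s.reg 18 = 4 * (m * (d + 1)))
    (h23 : s.reg 23 = start) (hmem : ∀ a < 4 * (m * (d + 1)) + (2 * k + 1) * n,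
      s.mem a = listMem (setupList d n m k inp ω) a) :
    (layout d n m k inp ω gb start).Holds s :=
  ⟨hC.r0, hC.r2, hC.r3, hC.r4, hC.r6, hC.r7, h8, hC.r9, hC.r11, h18, h23, hmem⟩

/-- The reference state only serves the frame conditions. Making the current state the reference
lets the tests change other registers. -/
theorem TableInv.rebase {D : Layout} {s₀ s s' : State} {i : ℕ} (h : TableInv D s₀ i s)
    (h26 : s'.reg 26 = s.reg 26) (h27 : s'.reg 27 = s.reg 27) (hm : s'.mem = s.mem) :
    TableInv D s' i s' :=
  ⟨h26.trans h.r26, h27.trans h.r27, fun _ _ => rfl, fun _ _ => rfl,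
    h.table.congr fun a _ => by rw [hm], fun a ha => by rw [hm]; exact h.high a ha⟩

theorem Layout.Holds.congr' {D : Layout} {s s' : State} (h : D.Holds s)
    (hr : ∀ i < 25, i ≠ 12 → i ≠ 13 → i ≠ 14 → i ≠ 24 → s'.reg i = s.reg i)
    (hm : s'.mem = s.mem) : D.Holds s' := by
  have H : ∀ i < 25, i ≠ 12 → i ≠ 13 → i ≠ 14 → i ≠ 24 → ∀ x, s.reg i = x → s'.reg i = x :=
    fun i h1 h2 h3 h4 h5 x hx => (hr i h1 h2 h3 h4 h5).trans hx
  constructor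
  · exact H 0 (by simp) (by simp) (by simp) (by simp) (by simp) _ h.r0
  · exact H 2 (by simp) (by simp) (by simp) (by simp) (by simp) _ h.r2
  · exact H 3 (by simp) (by simp) (by simp) (by simp) (by simp) _ h.r3
  · exact H 4 (by simp) (by simp) (by simp) (by simp) (by simp) _ h.r4
  · exact H 6 (by simp) (by simp) (by simp) (by simp) (by simp) _ h.r6
  · exact H 7 (by simp) (by simp) (by simp) (by simp) (by simp) _ h.r7
  · exact H 8 (by simp) (by simp) (by simp) (by simp) (by simp) _ h.r8
  · exact H 9 (by simp) (by simp) (by simp) (by simp) (by simp) _ h.r9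
  · exact H 11 (by simp) (by simp) (by simp) (by simp) (by simp) _ h.r11
  · exact H 18 (by simp) (by simp) (by simp) (by simp) (by simp) _ h.r18
  · exact H 23 (by simp) (by simp) (by simp) (by simp) (by simp) _ h.r23
  · intro a ha; rw [hm]; exact h.low a ha

/-- Test the final states of all transitions. -/
def testTargets : Prog :=
  .seq (block [.add 12 11 9, .add 13 11 9])
    (.seq (.loop 13 (.seq (block [.add 12 12 3, .add 12 12 3, .load 14 12, .add 12 12 3])
        (.seq testEntry (block [.sub 13 13 3]))))
      (block [.add 0 24 9]))

/-- The state after the tests for `q` transitions. -/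
structure TargetInv (D : Layout) (q : ℕ) (s : State) : Prop where
  holds : D.Holds s
  table : TableInv D s (2 ^ D.k - 1) s
  r12 : s.reg 12 = D.tb + 3 * q
  r13 : s.reg 13 = D.T.length - q
  r24 : s.reg 24 ≤ 1 ∧ (s.reg 24 ≠ 0 ↔ ∃ p, ∃ h : p < D.T.length, p < q ∧
    pairVal (D.entry (2 ^ D.k - 1) D.T[p].2.2) ≠ 0)

theorem testTargets_within {D : Layout} {B : ℕ} {s₀ s : State} (hD : D.Valid B)
    (hs : D.Holds s) (ht : TableInv D s₀ (2 ^ D.k - 1) s) (h24 : s.reg 24 = 0) :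
    Within B testTargets (D.T.length * 22 + 6)
      (fun s' => s'.reg 0 ≠ 0 ↔ ∃ τ ∈ D.T, pairVal (D.entry (2 ^ D.k - 1) τ.2.2) ≠ 0) s := by
  have hB := hD.table_lt
  have hlim := hD.lim_le
  have htb := hD.tb_le
  have hB0 := hD.bits_ne_zero
  have h1B : 1 < 2 ^ B := Nat.one_lt_two_pow hB0
  refine (Within.seq' (N := 3) (M := D.T.length * 22 + 3) (R := TargetInv D 0) ?_ ?_).mono
    (by omega) fun _ h => h
  · refine Within.block ?_ ⟨hs.congr' ?_ ?_, ht.rebase ?_ ?_ ?_, ?_, ?_, ?_, ?_⟩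
    · simp [hs.r11, hs.r9, hD.tb_eq]; omega
    · intro i h1 h2 h3 h4 h5; simp [h2, h3]
    · simp
    · simp
    · simp
    · simp
    · simp [hs.r11, hs.r9]
    · simp [hs.r11, hs.r9, hD.tb_eq]
    · simp [h24]
    · simp [h24]
  intro s₁ hs₁
  refine (Within.seq' (M := 2) (Within.loop (N := 21) (n := D.T.length) (TargetInv D) hs₁
    (fun q s _ h => h.r13) ?_) ?_).mono (by omega) fun _ h => h
  · intro q s hq h
    have l3 : s.mem (D.tb + 3 * q + 1 + 1) = D.T[q].2.2 := by
      rw [h.holds.low _ (by omega), ← (hD.read q hq).2.2]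
    refine (Within.seq' (N := 5) (M := 16) (R := fun s' => s'.mem = s.mem ∧
      (∀ i, i ≠ 12 → i ≠ 14 → s'.reg i = s.reg i) ∧ s'.reg 12 = D.tb + 3 * (q + 1) ∧
      s'.reg 14 = D.T[q].2.2) ?_ ?_).mono (by omega) fun _ h => h
    · refine Within.block ?_ ⟨?_, ?_, ?_, ?_⟩
      · simp [h.holds.r3, h.r12]; omega
      · simp
      · intro i h1 h2; simp [h1, h2]
      · simp [h.holds.r3, h.r12]; omega
      · simp [h.holds.r3, h.r12, l3]
    rintro s₂ ⟨gm, gf, g12, g14⟩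
    have hH2 : D.Holds s₂ := h.holds.congr' (fun i _ h2 _ h4 _ => gf i h2 h4) gm
    have hT2 : TableInv D s₂ (2 ^ D.k - 1) s₂ :=
      h.table.rebase (gf 26 (by norm_num) (by norm_num)) (gf 27 (by norm_num) (by norm_num)) gm
    refine (Within.seq' (M := 2) (testEntry_within hD hH2 hT2
      (hD.lt_of_mem _ (List.getElem_mem hq)).2.2 g14) ?_).mono (by omega) fun _ h => h
    rintro s₃ ⟨fm, ff, f24⟩
    have hH3 : D.Holds s₃ := hH2.congr' (fun i h1 _ _ _ h2 => ff i (by omega) h2) fm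
    refine Within.block ?_ ⟨hH3.congr' ?_ ?_, hT2.rebase ?_ ?_ ?_, ?_, ?_, ?_⟩
    · simp
    · intro i h1 h2 h3 h4 h5; simp [h3]
    · simp
    · simpa using ff 26 (by norm_num) (by norm_num)
    · simpa using ff 27 (by norm_num) (by norm_num)
    · simpa using fm
    · simpa using (ff 12 (by norm_num) (by norm_num)).trans g12
    · simp [hH3.r3, ff 13, gf 13, h.r13]; omega
    · simp only [runBlock, Instr.apply, State.setReg]
      rw [Function.update_of_ne (by norm_num), f24, gf 24 (by norm_num) (by norm_num)]
      obtain ⟨i1, i2⟩ := h.r24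
      split_ifs with h0
      · refine ⟨i1, i2.trans ⟨?_, ?_⟩⟩
        · rintro ⟨p, hp, hpq, hne⟩; exact ⟨p, hp, by omega, hne⟩
        · rintro ⟨p, hp, hpq, hne⟩
          refine ⟨p, hp, lt_of_le_of_ne (by omega) ?_, hne⟩
          rintro rfl; exact hne h0
      · exact ⟨le_rfl, fun _ => ⟨q, hq, by omega, h0⟩, fun _ => one_ne_zero⟩
  · intro s₂ h
    refine Within.block ?_ ?_
    · have := h.r24.1
      simp [h.holds.r9]; omega
    · simp only [runBlock, Instr.apply, State.setReg, Function.update_self, h.holds.r9, add_zero]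
      rw [h.r24.2]
      constructor
      · rintro ⟨p, hp, _, hne⟩; exact ⟨_, List.getElem_mem hp, hne⟩
      · rintro ⟨τ, hτ, hne⟩
        obtain ⟨p, hp, rfl⟩ := List.getElem_of_mem hτ
        exact ⟨p, hp, hp, hne⟩

/-- The search for tight paths. -/
def pathMain (d : ℕ) : Prog :=
  .seq (setup d) (.seq (block [.const 23 0]) (.seq walkTable testTargets))

/-- The memory needed by the preparation. -/
def setupSize (d n m k : ℕ) : ℕ := 4 * (m * (d + 1)) + (2 * k + 1) * n

/-- The number of steps of the preparation. -/
def setupSteps (d n m k : ℕ) : ℕ :=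
  4 * d + 4 * k + 24 + m * (17 * (d + 1) + 7) + (2 * k + 1) * n * (12 * n + 9)

/-- The number of steps of the computation of a table. -/
def tableSteps (d m k : ℕ) : ℕ := 2 ^ k * (m * (d + 1) * (27 * k + 33) + 8) + 7

/-- The initial state `0` is the empty code. It suffices to inspect the targets of transitions,
since a walk with at least one step ends in one of them; this avoids a pass over all `(n + 1) ^ d`
states. -/
theorem pathMain_within {B d n m k : ℕ} {inp : List ℕ} {ω : ℕ → Bool} {s : State}
    (hB : SetupFits B d n m k) (h0 : s.reg 0 = n) (h1 : s.reg 1 = m) (h2 : s.reg 2 = k)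
    (h9 : s.reg 9 = 0) (h24 : s.reg 24 = 0) (hmem : s.mem = listMem inp) (hω : s.coins = ω)
    (hinp : inp.length = m * (d + 1)) (hu : ∀ e < m, ∀ a < d + 1, label d inp e a < n)
    (htab : setupSize d n m k + 2 * (2 ^ k * (n + 1) ^ d) < 2 ^ B)
    (hgrowth : walkGrowth k (2 ^ (2 * n)) (m * (d + 1)) ^ k < 2 ^ B) :
    Within B (pathMain d) (setupSteps d n m k + tableSteps d m k + m * (d + 1) * 22 + 8)
      (fun s' => s'.reg 0 ≠ 0 ↔ ∃ τ ∈ inputTransitions d n inp m, pairVal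
        ((layout d n m k inp ω (setupSize d n m k) 0).entry (2 ^ k - 1) τ.2.2) ≠ 0) s := by
  have hD : (layout d n m k inp ω (setupSize d n m k) 0).Valid B :=
    layout_valid hinp hu (by positivity) le_rfl htab hgrowth
  have hlenT : (layout d n m k inp ω (setupSize d n m k) 0).T.length = m * (d + 1) :=
    length_inputTransitions _ _ _ _
  refine (Within.seq' (M := tableSteps d m k + m * (d + 1) * 22 + 8)
    (setup_within hB h0 h1 h2 h9 h24 hmem hω hinp hu) ?_).mono
      (by rw [setupSteps]; omega) fun _ h => h
  rintro s₁ ⟨hC, g8, g18, gm⟩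
  refine (Within.seq' (N := 2) (M := tableSteps d m k + m * (d + 1) * 22 + 6)
    (R := fun s' => (layout d n m k inp ω (setupSize d n m k) 0).Holds s' ∧ s'.reg 24 = 0 ∧
      s'.mem = s₁.mem) ?_ ?_).mono (by omega) fun _ h => h
  · refine Within.block ?_ ⟨layout_holds (hC.congr ?_ ?_) ?_ ?_ ?_ ?_, ?_, ?_⟩
    · simp
    · intro i hi _
      simp (disch := omega) [Function.update_of_ne]
    · simp
    · exact g8
    · simpa using g18
    · simp
    · intro a _; simp [gm]
    · simp [hC.r24]
    · simp
  rintro s₂ ⟨hH, f24, fm⟩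
  refine (Within.seq' (M := m * (d + 1) * 22 + 6) (walkTable_within hD hH ?_) ?_).mono ?_
    fun _ h => h
  · intro a ha
    rw [fm, gm, listMem, List.getD_eq_default]
    rw [length_setupList k ω hinp]; exact ha
  · intro s₃ h₃
    have := testTargets_within hD (hH.congr h₃.frame fun a ha => h₃.low a (ha.trans_le hD.lim_le))
      h₃ ((h₃.frame 24 (by norm_num)).trans f24)
    rw [hlenT] at this
    exact this
  · rw [hlenT, tableSteps]
    change 2 ^ k * (m * (d + 1) * (27 * k + 33) + 8) + 7 + _ ≤ _
    omega

/-- The treatment of the closed walks that begin with the next transition. -/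
def cycleBody : Prog :=
  .seq (block [.load 23 12, .add 14 23 9]) (.seq walkTable (.seq testEntry
    (block [.add 12 12 3, .add 12 12 3, .add 12 12 3, .add 8 8 15, .sub 13 13 3])))

/-- The search for tight cycles. -/
def cycleMain (d : ℕ) : Prog :=
  .seq (setup d) (.seq (block [.add 12 11 9, .add 13 11 9, .mul 15 7 6, .add 15 15 15])
    (.seq (.loop 13 cycleBody) (block [.add 0 24 9])))

/-- The number of words of a table. -/
def tableSize (d n k : ℕ) : ℕ := 2 * (2 ^ k * (n + 1) ^ d)

/-- The state after the tests for the closed walks that begin with one of `q` transitions. -/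
structure CycleInv (d n m k : ℕ) (inp : List ℕ) (ω : ℕ → Bool) (q : ℕ) (s : State) : Prop where
  r0 : s.reg 0 = n
  r2 : s.reg 2 = k
  r3 : s.reg 3 = 1
  r4 : s.reg 4 = 2
  r6 : s.reg 6 = (n + 1) ^ d
  r7 : s.reg 7 = 2 ^ k
  r9 : s.reg 9 = 0
  r11 : s.reg 11 = m * (d + 1)
  r18 : s.reg 18 = 4 * (m * (d + 1))
  r8 : s.reg 8 = setupSize d n m k + q * tableSize d n k
  r12 : s.reg 12 = m * (d + 1) + 3 * q
  r13 : s.reg 13 = m * (d + 1) - q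
  r15 : s.reg 15 = tableSize d n k
  low : ∀ a < setupSize d n m k, s.mem a = listMem (setupList d n m k inp ω) a
  high : ∀ a, setupSize d n m k + q * tableSize d n k ≤ a → s.mem a = 0
  r24 : s.reg 24 ≤ 1 ∧ (s.reg 24 ≠ 0 ↔ ∃ p, ∃ h : p < (inputTransitions d n inp m).length,
    p < q ∧ pairVal ((layout d n m k inp ω (setupSize d n m k)
      (inputTransitions d n inp m)[p].1).entry (2 ^ k - 1) (inputTransitions d n inp m)[p].1) ≠ 0)

/-- Each initial state gets a new table behind the previous ones, so nothing has to be erased. The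
value of an entry does not depend on the address of its table, so the invariant may speak of the
address `setupSize` throughout. -/
theorem cycleBody_within {B d n m k q : ℕ} {inp : List ℕ} {ω : ℕ → Bool} {s : State}
    (hinp : inp.length = m * (d + 1)) (hu : ∀ e < m, ∀ a < d + 1, label d inp e a < n)
    (htab : setupSize d n m k + m * (d + 1) * tableSize d n k < 2 ^ B)
    (hgrowth : walkGrowth k (2 ^ (2 * n)) (m * (d + 1)) ^ k < 2 ^ B)
    (hq : q < m * (d + 1)) (hs : CycleInv d n m k inp ω q s) :
    Within B cycleBody (tableSteps d m k + 23) (CycleInv d n m k inp ω (q + 1)) s := by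
  have hlen := length_inputTransitions d n inp m
  have hqT : q < (inputTransitions d n inp m).length := by omega
  have hmem := mem_transitions.1 (List.getElem_mem hqT)
  have hsrc : (inputTransitions d n inp m)[q].1 < (n + 1) ^ d := by
    obtain ⟨e, he, a, ha, h⟩ := hmem
    rw [← h]; exact prefixCode_lt (by positivity) _ _
  have hqs : (q + 1) * tableSize d n k ≤ m * (d + 1) * tableSize d n k :=
    Nat.mul_le_mul_right _ hq
  have hqs' : (q + 1) * tableSize d n k = q * tableSize d n k + tableSize d n k := by ring
  have hsize : setupSize d n m k = 4 * (m * (d + 1)) + (2 * k + 1) * n := rfl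
  have hD : (layout d n m k inp ω (setupSize d n m k + q * tableSize d n k)
      (inputTransitions d n inp m)[q].1).Valid B :=
    layout_valid hinp hu hsrc (by omega) (by
      change _ + q * tableSize d n k + tableSize d n k < _; omega) hgrowth
  have l1 : s.mem (m * (d + 1) + 3 * q) = (inputTransitions d n inp m)[q].1 := by
    rw [hs.low _ (by omega)]; exact (hD.read q hqT).1
  refine (Within.seq' (N := 3) (M := tableSteps d m k + 20) (R := fun s' =>
    (layout d n m k inp ω (setupSize d n m k + q * tableSize d n k)
      (inputTransitions d n inp m)[q].1).Holds s' ∧ s'.mem = s.mem ∧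
      s'.reg 14 = (inputTransitions d n inp m)[q].1 ∧
      ∀ i, i ≠ 14 → i ≠ 23 → s'.reg i = s.reg i) ?_ ?_).mono (by omega) fun _ h => h
  · have hQB := hD.table_lt
    have hQ2 : (n + 1) ^ d ≤ 2 ^ k * (n + 1) ^ d := Nat.le_mul_of_pos_left _ (by positivity)
    change _ + 2 * (2 ^ k * (n + 1) ^ d) < _ at hQB
    refine Within.block ?_ ⟨⟨?_, ?_, ?_, ?_, ?_, ?_, ?_, ?_, ?_, ?_, ?_, ?_⟩, ?_, ?_, ?_⟩
    · simp [hs.r12, l1, hs.r9]; omega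
    · exact hs.r0
    · exact hs.r2
    · exact hs.r3
    · exact hs.r4
    · exact hs.r6
    · exact hs.r7
    · exact hs.r8
    · exact hs.r9
    · exact hs.r11
    · exact hs.r18
    · simp [hs.r12, l1]; rfl
    · exact hs.low
    · simp
    · simp [hs.r12, l1, hs.r9]
    · intro i h1 h2; simp [h1, h2]
  rintro s₁ ⟨hH, gm, g14, gf⟩
  have htable := walkTable_within hD hH (fun a ha => by rw [gm]; exact hs.high a ha)
  rw [show (layout d n m k inp ω (setupSize d n m k + q * tableSize d n k)
      (inputTransitions d n inp m)[q].1).T.length = m * (d + 1) from hlen] at htable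
  refine (Within.seq' (N := tableSteps d m k) (M := 20) htable ?_).mono (by omega) fun _ h => h
  intro s₂ h₂
  refine (Within.seq' (M := 6) (testEntry_within hD hH h₂ hsrc
    ((h₂.frame 14 (by norm_num)).trans g14)) ?_).mono (by omega) fun _ h => h
  rintro s₃ ⟨fm, ff, f24⟩
  have F : ∀ i < 25, i ≠ 14 → i ≠ 23 → i ≠ 24 → ∀ x, s.reg i = x → s₃.reg i = x :=
    fun i h1 h2 h3 h4 x hx =>
      (ff i (by omega) h4).trans ((h₂.frame i h1).trans ((gf i h2 h3).trans hx))
  have e3 := F 3 (by simp) (by simp) (by simp) (by simp) _ hs.r3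
  have e8 := F 8 (by simp) (by simp) (by simp) (by simp) _ hs.r8
  have e12 := F 12 (by simp) (by simp) (by simp) (by simp) _ hs.r12
  have e13 := F 13 (by simp) (by simp) (by simp) (by simp) _ hs.r13
  have e15 := F 15 (by simp) (by simp) (by simp) (by simp) _ hs.r15
  refine Within.block ?_ ⟨?_, ?_, ?_, ?_, ?_, ?_, ?_, ?_, ?_, ?_, ?_, ?_, ?_, ?_, ?_, ?_⟩
  · simp [e3, e8, e12, e15]
    omega
  · simpa using F 0 (by simp) (by simp) (by simp) (by simp) _ hs.r0
  · simpa using F 2 (by simp) (by simp) (by simp) (by simp) _ hs.r2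
  · simpa using e3
  · simpa using F 4 (by simp) (by simp) (by simp) (by simp) _ hs.r4
  · simpa using F 6 (by simp) (by simp) (by simp) (by simp) _ hs.r6
  · simpa using F 7 (by simp) (by simp) (by simp) (by simp) _ hs.r7
  · simpa using F 9 (by simp) (by simp) (by simp) (by simp) _ hs.r9
  · simpa using F 11 (by simp) (by simp) (by simp) (by simp) _ hs.r11
  · simpa using F 18 (by simp) (by simp) (by simp) (by simp) _ hs.r18
  · simp [e8, e15]; omega
  · simp [e3, e12]; omega
  · simp [e3, e13]; omega
  · simpa using e15
  · intro a ha
    have h₃ : s₂.mem a = s₁.mem a := h₂.low a (ha.trans_le (Nat.le_add_right _ _))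
    simp [fm, h₃, gm, hs.low a ha]
  · intro a ha
    simp only [runBlock, Instr.apply, State.setReg, fm]
    refine h₂.high a ?_
    rw [hqs'] at ha
    refine le_trans (le_of_eq ?_) ha
    change setupSize d n m k + q * tableSize d n k + 2 * ((2 ^ k - 1 + 1) * (n + 1) ^ d + 0) = _
    rw [Nat.sub_add_cancel Nat.one_le_two_pow, add_zero, tableSize, add_assoc]
  · simp only [runBlock, Instr.apply, State.setReg]
    rw [Function.update_of_ne (by norm_num), Function.update_of_ne (by norm_num),
      Function.update_of_ne (by norm_num), Function.update_of_ne (by norm_num),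
      Function.update_of_ne (by norm_num), f24, h₂.frame 24 (by norm_num),
      gf 24 (by norm_num) (by norm_num)]
    obtain ⟨i1, i2⟩ := hs.r24
    split_ifs with h0
    · refine ⟨i1, i2.trans ⟨?_, ?_⟩⟩
      · rintro ⟨p, hp, hpq, hne⟩; exact ⟨p, hp, by omega, hne⟩
      · rintro ⟨p, hp, hpq, hne⟩
        refine ⟨p, hp, lt_of_le_of_ne (by omega) ?_, hne⟩
        rintro rfl; exact hne h0
    · exact ⟨le_rfl, fun _ => ⟨q, hqT, by omega, h0⟩, fun _ => one_ne_zero⟩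

/-- The additional `1` in `htab` makes the table size itself fit in `B` bits even if there are no
transitions. -/
theorem cycleMain_within {B d n m k : ℕ} {inp : List ℕ} {ω : ℕ → Bool} {s : State}
    (hB : SetupFits B d n m k) (h0 : s.reg 0 = n) (h1 : s.reg 1 = m) (h2 : s.reg 2 = k)
    (h9 : s.reg 9 = 0) (h24 : s.reg 24 = 0) (hmem : s.mem = listMem inp) (hω : s.coins = ω)
    (hinp : inp.length = m * (d + 1)) (hu : ∀ e < m, ∀ a < d + 1, label d inp e a < n)
    (htab : setupSize d n m k + (m * (d + 1) + 1) * tableSize d n k < 2 ^ B)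
    (hgrowth : walkGrowth k (2 ^ (2 * n)) (m * (d + 1)) ^ k < 2 ^ B) :
    Within B (cycleMain d) (setupSteps d n m k + m * (d + 1) * (tableSteps d m k + 24) + 8)
      (fun s' => s'.reg 0 ≠ 0 ↔ ∃ τ ∈ inputTransitions d n inp m, pairVal
        ((layout d n m k inp ω (setupSize d n m k) τ.1).entry (2 ^ k - 1) τ.1) ≠ 0) s := by
  have hB0 : 1 < 2 ^ B := by have := hB.steps_lt; have := hB.arity_lt; omega
  rw [add_mul, one_mul] at htab
  refine (Within.seq' (M := m * (d + 1) * (tableSteps d m k + 24) + 8)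
    (setup_within hB h0 h1 h2 h9 h24 hmem hω hinp hu) ?_).mono
      (by rw [setupSteps]; omega) fun _ h => h
  rintro s₁ ⟨hC, g8, g18, gm⟩
  refine (Within.seq' (N := 5) (M := m * (d + 1) * (tableSteps d m k + 24) + 3)
    (R := CycleInv d n m k inp ω 0) ?_ ?_).mono (by omega) fun _ h => h
  · have hsize : setupSize d n m k = 4 * (m * (d + 1)) + (2 * k + 1) * n := rfl
    have htsize : tableSize d n k = 2 * (2 ^ k * (n + 1) ^ d) := rfl
    refine Within.block ?_ ⟨?_, ?_, ?_, ?_, ?_, ?_, ?_, ?_, ?_, ?_, ?_, ?_, ?_, ?_, ?_, ?_⟩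
    · simp [hC.r11, hC.r9, hC.r7, hC.r6]; omega
    · simpa using hC.r0
    · simpa using hC.r2
    · simpa using hC.r3
    · simpa using hC.r4
    · simpa using hC.r6
    · simpa using hC.r7
    · simpa using hC.r9
    · simpa using hC.r11
    · simpa using g18
    · simpa [setupSize] using g8
    · simp [hC.r11, hC.r9]
    · simp [hC.r11, hC.r9]
    · simp [hC.r7, hC.r6]; omega
    · intro a _; simp [gm]
    · intro a ha
      simp only [runBlock, Instr.apply, State.setReg]
      rw [gm, listMem, List.getD_eq_default]
      rw [length_setupList k ω hinp]; omega
    · simp [hC.r24]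
  intro s₂ hs₂
  refine (Within.seq' (M := 2) (Within.loop (N := tableSteps d m k + 23) (n := m * (d + 1))
    (CycleInv d n m k inp ω) hs₂ (fun q s _ h => h.r13)
    fun q s hq h => cycleBody_within hinp hu (by omega) hgrowth hq h) ?_).mono le_rfl fun _ h => h
  intro s₃ h
  refine Within.block ?_ ?_
  · have := h.r24.1
    simp [h.r9]; omega
  · simp only [runBlock, Instr.apply, State.setReg, Function.update_self, h.r9, add_zero]
    rw [h.r24.2]
    constructor
    · rintro ⟨p, hp, _, hne⟩; exact ⟨_, List.getElem_mem hp, hne⟩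
    · rintro ⟨τ, hτ, hne⟩
      obtain ⟨p, hp, rfl⟩ := List.getElem_of_mem hτ
      exact ⟨p, hp, by rwa [length_inputTransitions] at hp, hne⟩


/-! ### Trivial cases and the passage to randomized algorithms -/

/-- Run `q` if the number `k` of steps is at most `d`, answer "no" if it exceeds the number of
nodes, and run `main` otherwise. -/
def guarded (d : ℕ) (q main : Prog) : Prog :=
  .seq (block [.const 3 (d + 1), .sub 4 3 2])
    (.ite 4 q (.seq (block [.sub 4 2 0]) (.ite 4 (block [.const 0 0]) main)))

/-- The states differ at most in the registers `3` and `4`. -/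
def AgreeUpTo34 (s s' : State) : Prop :=
  (∀ i, i ≠ 3 → i ≠ 4 → s'.reg i = s.reg i) ∧ s'.mem = s.mem ∧ s'.coins = s.coins

/-- The main program runs only if `k ≤ n`, so that its word length can be bounded in terms of `d`
and `n` alone. -/
theorem guarded_within {B d n k N : ℕ} {q main : Prog} {s : State} {R : Prop} (hB : d + 1 < 2 ^ B)
    (h0 : s.reg 0 = n) (h2 : s.reg 2 = k)
    (hq : k < d + 1 → ∀ s', AgreeUpTo34 s s' → Within B q N (fun s' => s'.reg 0 ≠ 0 ↔ R) s')
    (hno : d + 1 ≤ k → n < k → ¬ R)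
    (hmain : d + 1 ≤ k → k ≤ n → ∀ s', AgreeUpTo34 s s' →
      Within B main N (fun s' => s'.reg 0 ≠ 0 ↔ R) s') :
    Within B (guarded d q main) (N + 10) (fun s' => s'.reg 0 ≠ 0 ↔ R) s := by
  refine (Within.seq' (N := 3) (M := N + 7) (R := fun s' => AgreeUpTo34 s s' ∧
    s'.reg 4 = d + 1 - k) ?_ ?_).mono (by omega) fun _ h => h
  · refine Within.block ?_ ⟨⟨?_, ?_, ?_⟩, ?_⟩
    · simpa using hB
    · intro i h3 h4; simp [h3, h4]
    · simp
    · simp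
    · simp [h2]
  rintro s₁ ⟨ha, h4⟩
  refine (Within.ite (N := N + 6) (fun h => ?_) fun h => ?_).mono le_rfl fun _ h => h
  · exact (hq (by omega) s₁ ha).mono (by omega) fun _ h => h
  · refine (Within.seq' (N := 2) (M := N + 4) (R := fun s' => AgreeUpTo34 s s' ∧
      s'.reg 4 = k - n) ?_ ?_).mono (by omega) fun _ h => h
    · have h0' : s₁.reg 0 = n := (ha.1 0 (by norm_num) (by norm_num)).trans h0
      have h2' : s₁.reg 2 = k := (ha.1 2 (by norm_num) (by norm_num)).trans h2
      refine Within.block ?_ ⟨⟨?_, ?_, ?_⟩, ?_⟩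
      · simp
      · intro i h3 h4; simp [h4, ha.1 i h3 h4]
      · simpa using ha.2.1
      · simpa using ha.2.2
      · simp [h0', h2']
    rintro s₂ ⟨ha, h4'⟩
    refine (Within.ite (N := N + 3) (fun h' => ?_) fun h' => ?_).mono le_rfl fun _ h => h
    · refine (Within.block ?_ ?_).mono (by simp) fun _ h => h
      · simp
      · simp [hno (by omega) (by omega)]
    · exact (hmain (by omega) (by omega) s₂ ha).mono (by omega) fun _ h => h

/-- From a program that decides, for each sequence of coins, whether `R` holds, to a randomized
algorithm. -/
theorem solution_of_within {r n k B N T : ℕ} {p : Prog} {l : List (Fin r ↪ Fin n)} {Q : Prop}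
    {R : (ℕ → Bool) → Prop} (hsmall : ∀ ω, Small B (inputState l k ω))
    (hp : ∀ ω, Within B p N (fun s => s.reg 0 ≠ 0 ↔ R ω) (inputState l k ω))
    (hT : N * (2 * B + 3) ≤ T) (hsound : ∀ ω, R ω → Q)
    (hcomplete : Q → ∃ bad, coinMeasure bad ≤ (1 / 2) ^ n ∧ ∀ ω, ω ∉ bad → R ω) :
    (∀ ω, HaltsWithin p (inputState l k ω) T) ∧
    (Q → 1 - (1 / 2 : ℝ) ^ n ≤ coinMeasure.real {ω | Accepts p (inputState l k ω)}) ∧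
    (¬ Q → ∀ ω, ¬ Accepts p (inputState l k ω)) := by
  -- Acceptance speaks of some run; by determinism it is the run provided by `hp`.
  have hacc : ∀ ω, Accepts p (inputState l k ω) ↔ R ω := by
    intro ω
    obtain ⟨s', t, h₁, _, _, h₂⟩ := hp ω (hsmall ω)
    rw [← h₂]
    constructor
    · rintro ⟨s'', t', g₁, g₂⟩
      rwa [h₁.deterministic g₁]
    · exact fun h => ⟨s', t, h₁, h⟩
  refine ⟨fun ω => ?_, fun hQ => ?_, fun hQ ω h => hQ (hsound ω ((hacc ω).1 h))⟩
  · obtain ⟨s', t, h₁, h₂, _, _⟩ := hp ω (hsmall ω)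
    exact ⟨s', t, h₁, h₂.trans hT⟩
  · obtain ⟨bad, hb, h⟩ := hcomplete hQ
    exact coinMeasure_real_ge hb fun ω hω => (hacc ω).2 (h ω hω)

/-! ### The top coefficient as a polynomial in the random numbers -/

section Polynomial

open MvPolynomial

/-- The variable number `q`, or zero if there is none. -/
noncomputable def varOrZero (N q : ℕ) : MvPolynomial (Fin N) ℤ :=
  if h : q < N then X ⟨q, h⟩ else 0

theorem totalDegree_varOrZero_le (N q : ℕ) : (varOrZero N q).totalDegree ≤ 1 := by
  rw [varOrZero]; split_ifs <;> simp

theorem eval_varOrZero {N : ℕ} (f : ℕ → ℤ) (q : ℕ) :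
    eval (fun i : Fin N => f i) (varOrZero N q) = if q < N then f q else 0 := by
  rw [varOrZero]; split_ifs <;> simp

/-- The sum over the walks from `a` to `t` as a polynomial in the random numbers. -/
noncomputable def walkPoly (T : List (ℕ × ℕ × ℕ)) (n k a t : ℕ) :
    MvPolynomial (Fin ((2 * k + 1) * n)) ℤ :=
  walkSum T (fun i v => varOrZero _ ((k + i) * n + v)) (fun j v => varOrZero _ (j * n + v)) a k t
    (Finset.range k)

theorem eval_walkPoly (T : List (ℕ × ℕ × ℕ)) (n k a t : ℕ) (f : ℕ → ℤ) :
    eval (fun i : Fin ((2 * k + 1) * n) => f i) (walkPoly T n k a t) =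
      walkSum T (fun i v => if (k + i) * n + v < (2 * k + 1) * n then f ((k + i) * n + v) else 0)
        (fun j v => if j * n + v < (2 * k + 1) * n then f (j * n + v) else 0) a k t
        (Finset.range k) := by
  rw [walkPoly, map_walkSum]
  simp only [eval_varOrZero f]

theorem totalDegree_walkPoly_le (T : List (ℕ × ℕ × ℕ)) (n k a t : ℕ) :
    (walkPoly T n k a t).totalDegree ≤ 2 * k :=
  totalDegree_walkSum_le T (fun _ _ => totalDegree_varOrZero_le _ _)
    (fun _ _ => totalDegree_varOrZero_le _ _) a k t _

theorem walkPoly_ne_zero {T : List (ℕ × ℕ × ℕ)} {n k a t : ℕ} {st v : ℕ → ℕ}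
    (hn : ∀ τ ∈ T, τ.2.1 < n) (hw : IsWalk T a t k st v)
    (hv : ∀ l m, l < m → m < k → v l ≠ v m) : walkPoly T n k a t ≠ 0 := by
  intro h0
  -- The variable `q` has block `q / n` and label `q % n`. Blocks below `k` are coordinates. Block
  -- `k + i + 1` has the weights of step `i + 1`, which must select `v i`; the value on block `k` is
  -- immaterial.
  have h := eval_walkPoly T n k a t fun q =>
    if q / n < k then (if q % n = v (q / n) then 1 else 0)
    else (if q % n = v (q / n - k - 1) then 1 else 0)
  rw [h0, map_zero] at h
  refine (walkSum_indicator hw hv ?_ ?_ k le_rfl).2.2.ne (by rw [hw.finish]; exact h)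
  · intro i hi τ hτ
    have hτn := hn τ hτ
    have h₁ : ((k + (i + 1)) * n + τ.2.1) / n = k + (i + 1) := by
      rw [mul_comm, Nat.mul_add_div (by omega), Nat.div_eq_of_lt hτn, add_zero]
    have h₂ : ((k + (i + 1)) * n + τ.2.1) % n = τ.2.1 := by
      rw [mul_comm, Nat.mul_add_mod, Nat.mod_eq_of_lt hτn]
    have h₃ : (k + (i + 1)) * n + n ≤ (2 * k + 1) * n := by
      rw [← Nat.succ_mul]; exact Nat.mul_le_mul_right _ (by omega)
    rw [if_pos (by omega), h₁, h₂, if_neg (by omega), show k + (i + 1) - k - 1 = i by omega]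
  · intro j hj τ hτ
    have hτn := hn τ hτ
    have h₁ : (j * n + τ.2.1) / n = j := by
      rw [mul_comm, Nat.mul_add_div (by omega), Nat.div_eq_of_lt hτn, add_zero]
    have h₂ : (j * n + τ.2.1) % n = τ.2.1 := by
      rw [mul_comm, Nat.mul_add_mod, Nat.mod_eq_of_lt hτn]
    have h₃ : j * n + n ≤ (2 * k + 1) * n := by
      rw [← Nat.succ_mul]; exact Nat.mul_le_mul_right _ (by omega)
    rw [if_pos (by omega), h₁, h₂, if_pos hj]

end Polynomial

/-- Beyond the random numbers the memory is zero, as is `varOrZero`. Entries and polynomial values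
can thus be identified without bounds on the indices. -/
theorem layout_read {d n m k : ℕ} {inp : List ℕ} (hinp : inp.length = m * (d + 1)) (ω : ℕ → Bool)
    (gb start q : ℕ) :
    (layout d n m k inp ω gb start).M ((layout d n m k inp ω gb start).xb + q) =
      if q < (2 * k + 1) * n then coinNum ω (q * (2 * n)) (2 * n) else 0 := by
  split_ifs with hq
  · exact layout_z hinp ω gb start hq
  · change listMem (setupList d n m k inp ω) (4 * (m * (d + 1)) + q) = _
    rw [listMem, List.getD_eq_default]
    rw [length_setupList k ω hinp]; omega

/-- The last table entries are the values of the polynomials at the random numbers. -/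
theorem pairVal_entry {d n m k : ℕ} {inp : List ℕ} (hinp : inp.length = m * (d + 1))
    (ω : ℕ → Bool) (gb a t : ℕ) :
    pairVal ((layout d n m k inp ω gb a).entry (2 ^ k - 1) t) =
      MvPolynomial.eval (fun q : Fin ((2 * k + 1) * n) => (coinNum ω (q * (2 * n)) (2 * n) : ℤ))
        (walkPoly (inputTransitions d n inp m) n k a t) := by
  rw [eval_walkPoly _ n k a t fun q => (coinNum ω (q * (2 * n)) (2 * n) : ℤ), Layout.entry]
  change pairVal (walkPair k (inputTransitions d n inp m) (layout d n m k inp ω gb a).y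
    (layout d n m k inp ω gb a).z a (bitSet k (2 ^ k - 1)).card t (bitSet k (2 ^ k - 1))) = _
  rw [bitSet_two_pow_sub_one, Finset.card_range, pairVal_walkPair _ _ _ _ _ _ _ subset_rfl]
  congr 1
  · funext i v
    have := layout_read (n := n) (k := k) hinp ω gb a ((k + i) * n + v)
    rw [Layout.y, add_assoc]
    change ((layout d n m k inp ω gb a).M ((layout d n m k inp ω gb a).xb + ((k + i) * n + v)) : ℤ)
      = _
    rw [this]
    split_ifs <;> simp
  · funext j v
    have := layout_read (n := n) (k := k) hinp ω gb a (j * n + v)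
    rw [Layout.z, add_assoc]
    change ((layout d n m k inp ω gb a).M ((layout d n m k inp ω gb a).xb + (j * n + v)) : ℤ) = _
    rw [this]
    split_ifs <;> simp

theorem exists_isWalk_of_entry_ne_zero {d n m k : ℕ} {inp : List ℕ}
    (hinp : inp.length = m * (d + 1)) {ω : ℕ → Bool} {gb a t : ℕ}
    (h : pairVal ((layout d n m k inp ω gb a).entry (2 ^ k - 1) t) ≠ 0) :
    ∃ st v, IsWalk (inputTransitions d n inp m) a t k st v ∧
      ∀ l m, l < m → m < k → v l ≠ v m := by
  rw [pairVal_entry hinp,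
    eval_walkPoly _ n k a t fun q => (coinNum ω (q * (2 * n)) (2 * n) : ℤ)] at h
  exact exists_isWalk_of_walkSum_ne_zero fun h0 => h (congrFun h0 _)

theorem coinMeasure_entry_eq_zero_le {d n m k : ℕ} {inp : List ℕ}
    (hinp : inp.length = m * (d + 1)) (hu : ∀ e < m, ∀ a < d + 1, label d inp e a < n)
    (hk : k ≤ n) {gb a t : ℕ} {st v : ℕ → ℕ}
    (hw : IsWalk (inputTransitions d n inp m) a t k st v)
    (hv : ∀ l m, l < m → m < k → v l ≠ v m) :
    coinMeasure {ω | pairVal ((layout d n m k inp ω gb a).entry (2 ^ k - 1) t) = 0} ≤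
      (1 / 2) ^ n := by
  simp only [pairVal_entry hinp]
  refine coinMeasure_eval_eq_zero_le (walkPoly_ne_zero (fun τ hτ => ?_) hw hv)
    ((totalDegree_walkPoly_le _ n k a t).trans ?_)
  · obtain ⟨e, he, b, hb, rfl⟩ := mem_transitions.1 hτ
    exact hu e he b hb
  -- The degree is at most `2 * k ≤ 2 * n ≤ 2 ^ n` for positive `n`; the case `n = 0` is separate.
  · have : n < 2 ^ n := Nat.lt_two_pow_self
    rcases n with _ | n
    · omega
    · have : n < 2 ^ n := Nat.lt_two_pow_self
      rw [pow_succ]; omega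

/-! ### The input, and tight paths and cycles in terms of it -/

section Input

variable {d n : ℕ}

/-- The list of numbers that encodes a list of hyperedges. -/
def inputList (l : List (Fin (d + 1) ↪ Fin n)) : List ℕ :=
  l.flatMap fun e => List.ofFn fun j => (e j : ℕ)

theorem length_inputList (l : List (Fin (d + 1) ↪ Fin n)) :
    (inputList l).length = l.length * (d + 1) := by
  induction l with
  | nil => simp [inputList]
  | cons e l ih =>
    rw [inputList] at ih ⊢
    rw [List.flatMap_cons, List.length_append, ih, List.length_ofFn, List.length_cons]; ring

theorem label_inputList (l : List (Fin (d + 1) ↪ Fin n)) {e a : ℕ} (he : e < l.length)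
    (ha : a < d + 1) : label d (inputList l) e a = l[e] ⟨a, ha⟩ := by
  rw [label]
  induction l generalizing e with
  | nil => simp at he
  | cons f l ih =>
    have hc : inputList (f :: l) = (List.ofFn fun j => (f j : ℕ)) ++ inputList l := rfl
    rw [hc]
    cases e with
    | zero =>
      rw [List.getD_append _ _ _ _ (by simpa using ha), zero_mul, zero_add,
        List.getD_eq_getElem _ _ (by simpa using ha), List.getElem_ofFn, List.getElem_cons_zero]
    | succ e =>
      rw [List.getD_append_right _ _ _ _ (by rw [List.length_ofFn, add_mul]; omega),
        List.length_ofFn, show (e + 1) * (d + 1) + a - (d + 1) = e * (d + 1) + a by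
          rw [add_mul, one_mul]; omega]
      exact ih (by simpa using he)

theorem label_inputList_lt (l : List (Fin (d + 1) ↪ Fin n)) :
    ∀ e < l.length, ∀ a < d + 1, label d (inputList l) e a < n := by
  intro e he a ha
  rw [label_inputList l he ha]; exact Fin.is_lt _

variable {H : DirHypergraph (Fin n) (d + 1)} {l : List (Fin (d + 1) ↪ Fin n)} {k : ℕ}

theorem hasTightPath_iff (hl : H.IsListing l) : H.HasTightPath k ↔ ∃ v : ℕ → ℕ,
    (∀ i < k, v i < n) ∧ (∀ i j, i < j → j < k → v i ≠ v j) ∧ ∀ i, i + (d + 1) ≤ k →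
      ∃ e < l.length, ∀ j < d + 1, label d (inputList l) e j = v (i + j) := by
  constructor
  · rintro ⟨v, hv⟩
    refine ⟨fun i => if h : i < k then v ⟨i, h⟩ else 0, ?_, ?_, ?_⟩
    · intro i hi; simp [hi]
    · intro i j hij hj
      have hi := hij.trans hj
      simp only [hi, hj, dif_pos]
      intro h
      have := v.injective (Fin.ext h)
      simp only [Fin.mk.injEq] at this
      omega
    · intro i hi
      obtain ⟨e, he, h⟩ := hv i hi
      obtain ⟨p, hp, rfl⟩ := List.getElem_of_mem ((hl.2 e).2 he)
      refine ⟨p, hp, fun j hj => ?_⟩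
      rw [label_inputList l hp hj, h ⟨j, hj⟩]
      dsimp only
      rw [dif_pos (by omega)]
  · rintro ⟨v, hv, hinj, hw⟩
    refine ⟨⟨fun i => ⟨v i, hv i i.is_lt⟩, ?_⟩, ?_⟩
    · intro i j hij
      simp only [Fin.mk.injEq] at hij
      rcases lt_trichotomy i j with h | h | h
      · exact absurd hij (hinj i j h j.is_lt)
      · exact h
      · exact absurd hij.symm (hinj j i h i.is_lt)
    · intro i hi
      obtain ⟨p, hp, h⟩ := hw i hi
      refine ⟨l[p], (hl.2 _).1 (List.getElem_mem hp), fun j => Fin.ext ?_⟩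
      have := h j j.is_lt
      rw [label_inputList l hp j.is_lt] at this
      exact this

theorem hasTightCycle_iff (hl : H.IsListing l) (hk : 0 < k) : H.HasTightCycle k ↔ ∃ v : ℕ → ℕ,
    (∀ i < k, v i < n) ∧ (∀ i j, i < j → j < k → v i ≠ v j) ∧ ∀ i < k,
      ∃ e < l.length, ∀ j < d + 1, label d (inputList l) e j = v ((i + j) % k) := by
  constructor
  · rintro ⟨_, v, hv⟩
    refine ⟨fun i => if h : i < k then v ⟨i, h⟩ else 0, ?_, ?_, ?_⟩
    · intro i hi; simp [hi]
    · intro i j hij hj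
      have hi := hij.trans hj
      simp only [hi, hj, dif_pos]
      intro h
      have := v.injective (Fin.ext h)
      simp only [Fin.mk.injEq] at this
      omega
    · intro i hi
      obtain ⟨e, he, h⟩ := hv ⟨i, hi⟩
      obtain ⟨p, hp, rfl⟩ := List.getElem_of_mem ((hl.2 e).2 he)
      refine ⟨p, hp, fun j hj => ?_⟩
      rw [label_inputList l hp hj, h ⟨j, hj⟩]
      dsimp only
      rw [dif_pos (Nat.mod_lt _ hk)]
  · rintro ⟨v, hv, hinj, hw⟩
    refine ⟨hk, ⟨fun i => ⟨v i, hv i i.is_lt⟩, ?_⟩, ?_⟩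
    · intro i j hij
      simp only [Fin.mk.injEq] at hij
      rcases lt_trichotomy i j with h | h | h
      · exact absurd hij (hinj i j h j.is_lt)
      · exact h
      · exact absurd hij.symm (hinj j i h i.is_lt)
    · intro i
      obtain ⟨p, hp, h⟩ := hw i i.is_lt
      refine ⟨l[p], (hl.2 _).1 (List.getElem_mem hp), fun j => Fin.ext ?_⟩
      have := h j j.is_lt
      rw [label_inputList l hp j.is_lt] at this
      exact this

/-- There is no window of `d + 1` nodes, so any `k` distinct nodes will do. -/
theorem hasTightPath_iff_of_lt (H : DirHypergraph (Fin n) (d + 1)) (hk : k < d + 1) :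
    H.HasTightPath k ↔ k ≤ n := by
  constructor
  · rintro ⟨v, _⟩; simpa using Fintype.card_le_of_embedding v
  · exact fun h => ⟨Fin.castLEEmb h, fun i hi => by omega⟩

theorem le_of_hasTightPath (h : H.HasTightPath k) : k ≤ n := by
  obtain ⟨v, _⟩ := h; simpa using Fintype.card_le_of_embedding v

theorem le_of_hasTightCycle (h : H.HasTightCycle k) : k ≤ n := by
  obtain ⟨_, v, _⟩ := h; simpa using Fintype.card_le_of_embedding v

/-- On a shorter cycle the places `0` and `k` of a hyperedge would carry the same node. -/
theorem arity_le_of_hasTightCycle (h : H.HasTightCycle k) : d + 1 ≤ k := by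
  obtain ⟨hk, v, hv⟩ := h
  by_contra! hlt
  obtain ⟨e, _, he⟩ := hv ⟨0, hk⟩
  have h₁ := he ⟨0, by omega⟩
  have h₂ := he ⟨k, hlt⟩
  have : e ⟨0, by omega⟩ = e ⟨k, hlt⟩ := by rw [h₁, h₂]; simp
  have := e.injective this
  simp only [Fin.mk.injEq] at this
  omega

theorem length_eq_card (hl : H.IsListing l) : l.length = H.edges.card := by
  rw [← List.toFinset_card_of_nodup hl.1]
  congr 1
  ext e
  rw [List.mem_toFinset, hl.2]

/-- This bounds the bit length of `m` in terms of `d` and `n`. -/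
theorem length_le (hl : H.IsListing l) : l.length ≤ n ^ (d + 1) := by
  rw [length_eq_card hl]
  refine (Finset.card_le_univ _).trans ?_
  rw [Fintype.card_embedding_eq]
  simpa using Nat.descFactorial_le_pow n (d + 1)

end Input


/-! ### Numerical bounds for word length and time -/

section Bounds

variable {d n m k : ℕ}

/-- The number of bits that suffices for the algorithms. -/
def bits (d n : ℕ) : ℕ := 20 * ((d + 1) * n) * n

theorem pow_succ_le (d n : ℕ) : (n + 1) ^ (d + 1) ≤ 2 ^ ((d + 1) * n) := by
  rw [mul_comm, pow_mul]
  exact Nat.pow_le_pow_left Nat.lt_two_pow_self _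

theorem lt_bits (hn : 1 ≤ n) (hd : 2 ≤ d) {x : ℕ} (hx : x ≤ 13 * (2 ^ ((d + 1) * n)) ^ 4) :
    x < 2 ^ bits d n := by
  set a := (d + 1) * n with ha
  have ha3 : 3 ≤ a := by nlinarith
  calc x ≤ 13 * (2 ^ a) ^ 4 := hx
    _ < 2 ^ 4 * (2 ^ a) ^ 4 := by gcongr; norm_num
    _ = 2 ^ (4 + a * 4) := by rw [← pow_mul, ← pow_add]
    _ ≤ 2 ^ bits d n := Nat.pow_le_pow_right (by norm_num) (by rw [bits, ← ha]; nlinarith)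

theorem le_two_pow_mul (hn : 1 ≤ n) (hd : 2 ≤ d) (hkn : k ≤ n) (hm : m ≤ n ^ (d + 1)) :
    2 ^ n ≤ 2 ^ ((d + 1) * n) ∧ n ≤ 2 ^ ((d + 1) * n) ∧ k ≤ 2 ^ ((d + 1) * n) ∧
    m ≤ 2 ^ ((d + 1) * n) ∧ d + 1 ≤ 2 ^ ((d + 1) * n) ∧ 2 ^ k ≤ 2 ^ ((d + 1) * n) := by
  have h₁ : 2 ^ n ≤ 2 ^ ((d + 1) * n) :=
    Nat.pow_le_pow_right (by norm_num) (Nat.le_mul_of_pos_left _ (by omega))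
  have h₂ : n ≤ 2 ^ n := Nat.lt_two_pow_self.le
  refine ⟨h₁, h₂.trans h₁, hkn.trans (h₂.trans h₁), hm.trans ?_, ?_, ?_⟩
  · exact (Nat.pow_le_pow_left (Nat.le_succ n) _).trans (pow_succ_le d n)
  · exact (Nat.lt_two_pow_self.le).trans
      (Nat.pow_le_pow_right (by norm_num) (Nat.le_mul_of_pos_right _ hn))
  · exact (Nat.pow_le_pow_right (by norm_num) hkn).trans h₁

theorem setupFits_bits (hn : 1 ≤ n) (hd : 2 ≤ d) (hkn : k ≤ n) (hm : m ≤ n ^ (d + 1)) :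
    SetupFits (bits d n) d n m k := by
  obtain ⟨h₁, h₂, h₃, h₄, h₅, h₆⟩ := le_two_pow_mul hn hd hkn hm
  have hc := pow_succ_le d n
  have hX : 2 ^ (2 * n) = 2 ^ n * 2 ^ n := by rw [two_mul, pow_add]
  constructor <;> refine lt_bits hn hd ?_ <;> generalize 2 ^ ((d + 1) * n) = Z at * <;>
    have hZ : 1 ≤ Z := le_trans (by omega) h₂ <;>
    have hZ2 : Z ≤ Z ^ 4 := Nat.le_self_pow (by norm_num) Z <;>
    have hZ3 : Z ^ 2 ≤ Z ^ 4 := Nat.pow_le_pow_right hZ (by norm_num)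
  · have : m * (d + 1) ≤ Z ^ 2 := by rw [sq]; gcongr
    have : (2 * k + 1) * n ≤ 3 * Z ^ 2 := by
      calc (2 * k + 1) * n ≤ (2 * Z + Z) * Z := by gcongr
        _ = 3 * Z ^ 2 := by ring
    omega
  · rw [← pow_succ]; omega
  · omega
  · rw [hX]
    have : 2 ^ n * 2 ^ n ≤ Z ^ 2 := by rw [sq]; gcongr
    omega
  · omega
  · omega

theorem cycle_memory_lt_bits (hn : 1 ≤ n) (hd : 2 ≤ d) (hkn : k ≤ n) (hm : m ≤ n ^ (d + 1)) :
    setupSize d n m k + (m * (d + 1) + 1) * tableSize d n k < 2 ^ bits d n := by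
  obtain ⟨h₁, h₂, h₃, h₄, h₅, h₆⟩ := le_two_pow_mul hn hd hkn hm
  have hc : (n + 1) ^ d ≤ 2 ^ ((d + 1) * n) :=
    (Nat.pow_le_pow_right (by omega) (Nat.le_succ d)).trans (pow_succ_le d n)
  refine lt_bits hn hd ?_
  rw [setupSize, tableSize]
  generalize 2 ^ ((d + 1) * n) = Z at *
  have hZ : 1 ≤ Z := le_trans (by omega) h₂
  calc _ ≤ 4 * (Z * Z) + (2 * Z + Z) * Z + (Z * Z + Z * Z) * (2 * (Z * Z)) := by
        gcongr; nlinarith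
    _ = 7 * Z ^ 2 + 4 * Z ^ 4 := by ring
    _ ≤ 7 * Z ^ 4 + 4 * Z ^ 4 := by gcongr; norm_num
    _ ≤ 13 * Z ^ 4 := by omega

theorem path_memory_lt_bits (hn : 1 ≤ n) (hd : 2 ≤ d) (hkn : k ≤ n) (hm : m ≤ n ^ (d + 1)) :
    setupSize d n m k + 2 * (2 ^ k * (n + 1) ^ d) < 2 ^ bits d n := by
  have := cycle_memory_lt_bits hn hd hkn hm
  rw [tableSize, add_mul, one_mul] at this
  omega

/-- With `Z = 2 ^ ((d + 1) * n)`, the factors `m`, `d + 1`, `k` are at most `Z`, and the square of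
the bound for random numbers is at most `Z ^ 2` as `d ≥ 2`. One step thus multiplies by at most `2 *
Z ^ 5 ≤ Z ^ 6`, and `n` steps need about `6 * (d + 1) * n ^ 2` bits. This is the source of the
quadratic word length. -/
theorem walkGrowth_lt_bits (hn : 1 ≤ n) (hd : 2 ≤ d) (hkn : k ≤ n) (hm : m ≤ n ^ (d + 1)) :
    walkGrowth k (2 ^ (2 * n)) (m * (d + 1)) ^ k < 2 ^ bits d n := by
  obtain ⟨h₁, h₂, h₃, h₄, h₅, h₆⟩ := le_two_pow_mul hn hd hkn hm
  have hX : 2 ^ (2 * n) * 2 ^ (2 * n) ≤ (2 ^ ((d + 1) * n)) ^ 2 := by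
    rw [← pow_add, ← pow_mul]
    exact Nat.pow_le_pow_right (by norm_num) (by nlinarith)
  have ha : 1 ≤ (d + 1) * n := by nlinarith
  have hg : walkGrowth k (2 ^ (2 * n)) (m * (d + 1)) ≤ (2 ^ ((d + 1) * n)) ^ 6 := by
    have hZ : 2 ≤ 2 ^ ((d + 1) * n) := Nat.le_self_pow (by omega) 2
    rw [walkGrowth]
    generalize 2 ^ ((d + 1) * n) = Z at *
    calc m * (d + 1) * (k * (2 ^ (2 * n) * 2 ^ (2 * n))) + 1 ≤ Z * Z * (Z * Z ^ 2) + Z ^ 5 := by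
          gcongr; exact Nat.one_le_pow _ _ (by omega)
      _ = 2 * Z ^ 5 := by ring
      _ ≤ Z * Z ^ 5 := by gcongr
      _ = Z ^ 6 := by ring
  calc _ ≤ ((2 ^ ((d + 1) * n)) ^ 6) ^ n :=
        (Nat.pow_le_pow_left hg k).trans (Nat.pow_le_pow_right (by positivity) hkn)
    _ = 2 ^ (6 * ((d + 1) * n) * n) := by rw [← pow_mul, ← pow_mul]; ring_nf
    _ < 2 ^ bits d n := by
        refine Nat.pow_lt_pow_right (by norm_num) ?_
        rw [bits]
        have : 0 < (d + 1) * n * n := by positivity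
        nlinarith

theorem setupSteps_le (hn : 1 ≤ n) (hk : k ≤ n) {K M : ℕ} (hK : 1 ≤ K) (hM : 1 ≤ M) (hm : m ≤ M) :
    setupSteps d n m k ≤ 119 * (K * M * (d + 1) * n ^ 3) := by
  have hn3 : n ≤ n ^ 3 := Nat.le_self_pow (by norm_num) n
  have h1 : 1 ≤ n ^ 3 := hn.trans hn3
  have e₁ : d ≤ K * M * (d + 1) * n ^ 3 :=
    calc d ≤ 1 * 1 * (d + 1) * 1 := by omega
      _ ≤ _ := by gcongr
  have e₂ : k ≤ K * M * (d + 1) * n ^ 3 :=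
    calc k ≤ 1 * 1 * 1 * n ^ 3 := by omega
      _ ≤ _ := by gcongr; omega
  have e₃ : 1 ≤ K * M * (d + 1) * n ^ 3 :=
    calc 1 ≤ 1 * 1 * 1 * 1 := by omega
      _ ≤ _ := by gcongr; omega
  have e₄ : m * (17 * (d + 1) + 7) ≤ 24 * (K * M * (d + 1) * n ^ 3) :=
    calc m * (17 * (d + 1) + 7) ≤ M * (17 * (d + 1) + 7 * (d + 1)) := by gcongr; omega
      _ = 24 * (1 * M * (d + 1) * 1) := by ring
      _ ≤ _ := by gcongr
  have e₅ : (2 * k + 1) * n * (12 * n + 9) ≤ 63 * (K * M * (d + 1) * n ^ 3) :=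
    calc (2 * k + 1) * n * (12 * n + 9) ≤ (2 * n + n) * n * (12 * n + 9 * n) := by gcongr; omega
      _ = 63 * (1 * 1 * 1 * n ^ 3) := by ring
      _ ≤ _ := by gcongr; omega
  rw [setupSteps]; omega

theorem tableSteps_le (hn : 1 ≤ n) (hk : k ≤ n) {M : ℕ} (hM : 1 ≤ M) (hm : m ≤ M) :
    tableSteps d m k ≤ 75 * (2 ^ k * M * (d + 1) * n ^ 3) := by
  have hn3 : n ≤ n ^ 3 := Nat.le_self_pow (by norm_num) n
  have h1 : 1 ≤ n ^ 3 := hn.trans hn3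
  have hK : 1 ≤ 2 ^ k := Nat.one_le_two_pow
  calc tableSteps d m k ≤ 2 ^ k * (M * (d + 1) * (27 * n ^ 3 + 33 * n ^ 3) +
        8 * (M * (d + 1) * n ^ 3)) + 7 * (2 ^ k * M * (d + 1) * n ^ 3) := by
        rw [tableSteps]
        have e₁ : 1 ≤ M * (d + 1) * n ^ 3 := Nat.mul_pos (Nat.mul_pos hM (by omega)) h1
        have e₂ : 1 ≤ 2 ^ k * M * (d + 1) * n ^ 3 := by
          rw [mul_assoc, mul_assoc, ← mul_assoc M]; exact Nat.mul_pos hK e₁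
        gcongr <;> omega
    _ = 75 * (2 ^ k * M * (d + 1) * n ^ 3) := by ring

theorem bits_le (hn : 1 ≤ n) : 2 * bits d n + 3 ≤ 43 * ((d + 1) * n ^ 2) := by
  have : 1 ≤ (d + 1) * n ^ 2 := Nat.mul_pos (by omega) (by positivity)
  have : bits d n = 20 * ((d + 1) * n ^ 2) := by rw [bits]; ring
  omega

theorem path_time_le (hn : 1 ≤ n) (hk : k ≤ n) :
    (setupSteps d n m k + tableSteps d m k + m * (d + 1) * 22 + 8 + 10) * (2 * bits d n + 3) ≤
      11000 * (d + 1) ^ 3 * 2 ^ k * max m 1 * max n 1 ^ 5 := by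
  have hM : 1 ≤ max m 1 := le_max_right _ _
  have hm : m ≤ max m 1 := le_max_left _ _
  have hK : 1 ≤ 2 ^ k := Nat.one_le_two_pow
  rw [max_eq_left hn]
  generalize max m 1 = M at *
  have h1 : 1 ≤ n ^ 3 := Nat.one_le_pow _ _ hn
  have e₁ := setupSteps_le (d := d) hn hk hK hM hm
  have e₂ := tableSteps_le (d := d) hn hk hM hm
  have e₃ : m * (d + 1) ≤ 2 ^ k * M * (d + 1) * n ^ 3 :=
    calc m * (d + 1) = 1 * m * (d + 1) * 1 := by ring
      _ ≤ _ := by gcongr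
  have e₄ : 1 ≤ 2 ^ k * M * (d + 1) * n ^ 3 := by
    calc 1 = 1 * 1 * 1 * 1 := rfl
      _ ≤ _ := by gcongr; omega
  -- The steps contribute `n ^ 3`, needed to toss about `2 * k * n` numbers of `2 * n` bits, and the
  -- word length contributes `n ^ 2`. The constant `236 = 119 + 99 + 18` is the one needed for
  -- cycles.
  calc _ ≤ 236 * (2 ^ k * M * (d + 1) * n ^ 3) * (43 * ((d + 1) * n ^ 2)) :=
        Nat.mul_le_mul (by omega) (bits_le hn)
    _ = 10148 * (d + 1) ^ 2 * 2 ^ k * M * n ^ 5 := by ring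
    _ ≤ _ := by gcongr <;> omega

theorem cycle_time_le (hn : 1 ≤ n) (hk : k ≤ n) :
    (setupSteps d n m k + m * (d + 1) * (tableSteps d m k + 24) + 8 + 10) * (2 * bits d n + 3) ≤
      11000 * (d + 1) ^ 3 * 2 ^ k * max m 1 ^ 2 * max n 1 ^ 5 := by
  have hM : 1 ≤ max m 1 := le_max_right _ _
  have hm : m ≤ max m 1 := le_max_left _ _
  have hK : 1 ≤ 2 ^ k := Nat.one_le_two_pow
  rw [max_eq_left hn]
  generalize max m 1 = M at *
  have h1 : 1 ≤ n ^ 3 := Nat.one_le_pow _ _ hn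
  have e₁ := setupSteps_le (d := d) hn hk hK hM hm
  have e₂ := tableSteps_le (d := d) hn hk hM hm
  have e₄ : 1 ≤ 2 ^ k * M * (d + 1) * n ^ 3 := by
    calc 1 = 1 * 1 * 1 * 1 := rfl
      _ ≤ _ := by gcongr; omega
  have e₅ : 1 ≤ M * (d + 1) := Nat.mul_pos hM (by omega)
  have e₃ : m * (d + 1) * (tableSteps d m k + 24) ≤
      99 * (M * (d + 1) * (2 ^ k * M * (d + 1) * n ^ 3)) := by
    calc _ ≤ M * (d + 1) * (99 * (2 ^ k * M * (d + 1) * n ^ 3)) := by gcongr; omega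
      _ = _ := by ring
  have e₆ := Nat.mul_le_mul_right (2 ^ k * M * (d + 1) * n ^ 3) e₅
  calc _ ≤ 236 * (M * (d + 1) * (2 ^ k * M * (d + 1) * n ^ 3)) * (43 * ((d + 1) * n ^ 2)) :=
        Nat.mul_le_mul (by omega) (bits_le hn)
    _ = 10148 * (d + 1) ^ 3 * 2 ^ k * M ^ 2 * n ^ 5 := by ring
    _ ≤ _ := by gcongr; norm_num

/-- The number of bits that suffices for the numbers of the input. -/
def inputBits (d n k : ℕ) : ℕ := (d + 1) * n + n + k + d + 2

/-- In the trivial cases `k` may exceed `n`, so the word length involves `k`; the factor `2 ^ k`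
absorbs it. -/
theorem inputBits_time_le (M : ℕ) (hM : 1 ≤ M) :
    14 * (2 * inputBits d n k + 3) ≤ 11000 * (d + 1) ^ 3 * 2 ^ k * M * max n 1 ^ 5 := by
  have hn : n ≤ max n 1 := le_max_left _ _
  have hn1 : 1 ≤ max n 1 := le_max_right _ _
  generalize max n 1 = N at *
  have hk : k ≤ 2 ^ k := Nat.lt_two_pow_self.le
  have hK : 1 ≤ 2 ^ k := Nat.one_le_two_pow
  have e₁ : inputBits d n k ≤ 6 * ((d + 1) * 2 ^ k * 1 * N) := by
    rw [inputBits]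
    have f₁ : (d + 1) * n ≤ (d + 1) * 2 ^ k * 1 * N :=
      calc (d + 1) * n = (d + 1) * 1 * 1 * n := by ring
        _ ≤ _ := by gcongr
    have f₂ : n ≤ (d + 1) * 2 ^ k * 1 * N :=
      calc n = 1 * 1 * 1 * n := by ring
        _ ≤ _ := by gcongr; omega
    have f₃ : k ≤ (d + 1) * 2 ^ k * 1 * N :=
      calc k = 1 * k * 1 * 1 := by ring
        _ ≤ _ := by gcongr; omega
    have f₄ : d + 1 ≤ (d + 1) * 2 ^ k * 1 * N :=
      calc d + 1 = (d + 1) * 1 * 1 * 1 := by ring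
        _ ≤ _ := by gcongr
    omega
  have e₂ : 1 ≤ (d + 1) * 2 ^ k * 1 * N :=
    calc 1 = 1 * 1 * 1 * 1 := by ring
      _ ≤ _ := by gcongr; omega
  calc _ ≤ 210 * ((d + 1) * 2 ^ k * 1 * N) := by omega
    _ = 210 * (d + 1) ^ 1 * 2 ^ k * 1 * N ^ 1 := by ring
    _ ≤ _ := by gcongr <;> omega

end Bounds

/-! ### The two algorithms -/

section Algorithms

variable {d n k B : ℕ} {l : List (Fin (d + 1) ↪ Fin n)} {ω : ℕ → Bool} {s : State}

theorem inputState_mem : (inputState l k ω).mem = listMem (inputList l) := rfl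

theorem small_inputState (hn : n < 2 ^ B) (hm : l.length < 2 ^ B) (hk : k < 2 ^ B) :
    Small B (inputState l k ω) := by
  constructor
  · intro i
    simp only [inputState]
    split_ifs <;> first | assumption | positivity
  · intro a
    rw [inputState_mem, listMem]
    rcases lt_or_ge a (inputList l).length with ha | ha
    · rw [List.getD_eq_getElem _ _ ha]
      have := List.getElem_mem ha
      generalize (inputList l)[a] = x at *
      simp only [inputList, List.mem_flatMap, List.mem_ofFn] at this
      obtain ⟨e, _, j, rfl⟩ := this
      exact (e j).is_lt.trans hn
    · rw [List.getD_eq_default _ _ ha]; positivity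

theorem lt_two_pow_inputBits {H : DirHypergraph (Fin n) (d + 1)} (hl : H.IsListing l) :
    n + 1 < 2 ^ inputBits d n k ∧ l.length < 2 ^ inputBits d n k ∧ k < 2 ^ inputBits d n k ∧
      d + 1 < 2 ^ inputBits d n k := by
  have h : ∀ x, x < inputBits d n k → x < 2 ^ inputBits d n k := fun x hx =>
    hx.trans Nat.lt_two_pow_self
  refine ⟨h _ ?_, ?_, h _ ?_, h _ ?_⟩
  · rw [inputBits]; omega
  · refine (length_le hl).trans_lt ?_
    refine ((Nat.pow_le_pow_left (Nat.le_succ n) _).trans (pow_succ_le d n)).trans_lt ?_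
    exact Nat.pow_lt_pow_right (by norm_num) (by rw [inputBits]; omega)
  · rw [inputBits]; omega
  · rw [inputBits]; omega

theorem small_inputState_inputBits {H : DirHypergraph (Fin n) (d + 1)} (hl : H.IsListing l) :
    Small (inputBits d n k) (inputState l k ω) := by
  obtain ⟨h₁, h₂, h₃, _⟩ := lt_two_pow_inputBits (k := k) hl
  exact small_inputState (by omega) h₂ h₃

theorem small_inputState_bits {H : DirHypergraph (Fin n) (d + 1)} (hl : H.IsListing l) (hd : 2 ≤ d)
    (hk : d + 1 ≤ k) (hkn : k ≤ n) : Small (bits d n) (inputState l k ω) := by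
  have h := setupFits_bits (by omega) hd hkn (length_le hl)
  have h₁ := h.length_lt
  have h₂ := h.steps_lt
  have h₃ : 1 * n ≤ (2 * k + 1) * n := by gcongr; omega
  have h₄ : l.length * 1 ≤ l.length * (d + 1) := by gcongr; omega
  exact small_inputState (by omega) (by omega) (by omega)

/-- The algorithm for tight paths. -/
def pathProg (d : ℕ) : Prog :=
  guarded d (block [.const 5 1, .add 6 0 5, .sub 0 6 2]) (pathMain d)

/-- The algorithm for tight cycles. -/
def cycleProg (d : ℕ) : Prog := guarded d (block [.const 0 0]) (cycleMain d)

theorem pathProg_solves (hd : 2 ≤ d) :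
    Solves (pathProg d) (fun n (H : DirHypergraph (Fin n) (d + 1)) k => H.HasTightPath k)
      (fun n m k => 11000 * (d + 1) ^ 3 * 2 ^ k * max m 1 * max n 1 ^ 5) := by
  intro n H l k hl
  beta_reduce
  rw [← length_eq_card hl]
  have hu := label_inputList_lt l
  have hinp := length_inputList l
  by_cases hmain : d + 1 ≤ k ∧ k ≤ n
  · obtain ⟨hk, hkn⟩ := hmain
    have hn : 1 ≤ n := by omega
    have hfit := setupFits_bits hn hd hkn (length_le hl)
    refine solution_of_within (fun ω => small_inputState_bits hl hd hk hkn)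
      (fun ω => guarded_within (n := n) (k := k) (by have := hfit.arity_lt; omega) rfl rfl
        (by omega) (by omega) fun _ _ s' h =>
          pathMain_within (ω := ω) hfit (h.1 0 (by norm_num) (by norm_num))
          (h.1 1 (by norm_num) (by norm_num)) (h.1 2 (by norm_num) (by norm_num))
          (h.1 9 (by norm_num) (by norm_num)) (h.1 24 (by norm_num) (by norm_num)) h.2.1 h.2.2
          hinp hu (path_memory_lt_bits hn hd hkn (length_le hl))
          (walkGrowth_lt_bits hn hd hkn (length_le hl)))
      (path_time_le hn hkn) ?_ ?_
    · rintro ω ⟨τ, _, h⟩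
      obtain ⟨st, v, hw, hv⟩ := exists_isWalk_of_entry_ne_zero hinp h
      exact (hasTightPath_iff hl).2 ⟨v, (hw.shift hu).1, hv, windows_of_isWalk hu hw⟩
    · intro hQ
      obtain ⟨v, _, hv, hwin⟩ := (hasTightPath_iff hl).1 hQ
      have hw := exists_isWalk_of_windows hu hk hwin
      -- The end of the walk is the target of its last transition, which is among those tested.
      refine ⟨_, coinMeasure_entry_eq_zero_le (gb := setupSize d n l.length k) hinp hu hkn hw hv,
        fun ω hω => ⟨_, hw.step (k - 1) (by omega), ?_⟩⟩
      rw [Nat.sub_add_cancel (by omega)]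
      exact hω
  · have hQ : H.HasTightPath k ↔ k ≤ n := by
      by_cases hk : k < d + 1
      · exact hasTightPath_iff_of_lt H hk
      · exact ⟨le_of_hasTightPath, fun h => (hmain ⟨by omega, h⟩).elim⟩
    obtain ⟨h₁, h₂, h₃, h₄⟩ := lt_two_pow_inputBits (k := k) hl
    refine solution_of_within (R := fun _ => k ≤ n) (fun ω => small_inputState_inputBits hl)
      (fun ω => guarded_within (n := n) (k := k) (N := 4) h₄ rfl rfl ?_ (by omega)
        fun h h' => (hmain ⟨h, h'⟩).elim)
      (inputBits_time_le _ (le_max_right _ _)) (fun _ => hQ.2)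
      fun h => ⟨∅, by simp, fun _ _ => hQ.1 h⟩
    intro _ s' h
    have g0 : s'.reg 0 = n := h.1 0 (by norm_num) (by norm_num)
    have g2 : s'.reg 2 = k := h.1 2 (by norm_num) (by norm_num)
    refine Within.block ?_ ?_
    · have : inputBits d n k ≠ 0 := by rw [inputBits]; omega
      simp [g0, h₁, this]
    -- The answer is `n + 1 - k`, which is nonzero exactly when `k ≤ n`.
    · simp [g0, g2]; omega

theorem cycleProg_solves (hd : 2 ≤ d) :
    Solves (cycleProg d) (fun n (H : DirHypergraph (Fin n) (d + 1)) k => H.HasTightCycle k)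
      (fun n m k => 11000 * (d + 1) ^ 3 * 2 ^ k * max m 1 ^ 2 * max n 1 ^ 5) := by
  intro n H l k hl
  beta_reduce
  rw [← length_eq_card hl]
  have hu := label_inputList_lt l
  have hinp := length_inputList l
  by_cases hmain : d + 1 ≤ k ∧ k ≤ n
  · obtain ⟨hk, hkn⟩ := hmain
    have hn : 1 ≤ n := by omega
    have hfit := setupFits_bits hn hd hkn (length_le hl)
    refine solution_of_within (fun ω => small_inputState_bits hl hd hk hkn)
      (fun ω => guarded_within (n := n) (k := k) (by have := hfit.arity_lt; omega) rfl rfl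
        (by omega) (by omega) fun _ _ s' h =>
          cycleMain_within (ω := ω) hfit (h.1 0 (by norm_num) (by norm_num))
          (h.1 1 (by norm_num) (by norm_num)) (h.1 2 (by norm_num) (by norm_num))
          (h.1 9 (by norm_num) (by norm_num)) (h.1 24 (by norm_num) (by norm_num)) h.2.1 h.2.2
          hinp hu (cycle_memory_lt_bits hn hd hkn (length_le hl))
          (walkGrowth_lt_bits hn hd hkn (length_le hl)))
      (cycle_time_le hn hkn) ?_ ?_
    · rintro ω ⟨τ, _, h⟩
      obtain ⟨st, v, hw, hv⟩ := exists_isWalk_of_entry_ne_zero hinp h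
      exact (hasTightCycle_iff hl (by omega)).2
        ⟨v, (hw.shift hu).1, hv, windows_of_isWalk_closed hu hw hk⟩
    · intro hQ
      obtain ⟨v, _, hv, hwin⟩ := (hasTightCycle_iff hl (by omega)).1 hQ
      obtain ⟨τ, hτ, st, hw⟩ := exists_isWalk_closed_of_windows hu hk hwin
      -- The bad event concerns only the table for the source of `τ`; that one test succeeding is
      -- enough.
      exact ⟨_, coinMeasure_entry_eq_zero_le (gb := setupSize d n l.length k) hinp hu hkn hw hv,
        fun ω hω => ⟨τ, hτ, hω⟩⟩
  · have hQ : ¬ H.HasTightCycle k := fun h => hmain ⟨arity_le_of_hasTightCycle h, le_of_hasTightCycle h⟩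
    obtain ⟨h₁, h₂, h₃, h₄⟩ := lt_two_pow_inputBits (k := k) hl
    refine solution_of_within (R := fun _ => False) (fun ω => small_inputState_inputBits hl)
      (fun ω => guarded_within (n := n) (k := k) (N := 4) h₄ rfl rfl ?_ (by simp)
        fun h h' => (hmain ⟨h, h'⟩).elim)
      (inputBits_time_le _ (Nat.one_le_pow _ _ (Nat.le_max_right _ 1))) (fun _ h => h.elim)
      fun h => (hQ h).elim
    intro _ s' h
    refine (Within.block (l := [.const 0 0]) ?_ ?_).mono (by simp) fun _ h => h
    · simp
    · simp

end Algorithms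

end LogRAM

theorem theorem4 :
    (∃ c : ℕ, ∀ r : ℕ, 3 ≤ r → ∃ (C : ℕ) (p : LogRAM.Prog),
      LogRAM.Solves p (fun n (H : DirHypergraph (Fin n) r) k => H.HasTightPath k)
        (fun n m k => C * 2 ^ k * max m 1 * max n 1 ^ c)) ∧
    (∃ c : ℕ, ∀ r : ℕ, 3 ≤ r → ∃ (C : ℕ) (p : LogRAM.Prog),
      LogRAM.Solves p (fun n (H : DirHypergraph (Fin n) r) k => H.HasTightCycle k)
        (fun n m k => C * 2 ^ k * max m 1 ^ 2 * max n 1 ^ c)) := by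
  refine ⟨⟨5, fun r hr => ?_⟩, ⟨5, fun r hr => ?_⟩⟩ <;>
    obtain ⟨d, rfl⟩ : ∃ d, r = d + 1 := ⟨r - 1, by omega⟩
  · exact ⟨_, _, LogRAM.pathProg_solves (by omega)⟩
  · exact ⟨_, _, LogRAM.cycleProg_solves (by omega)⟩
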